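/- **Setting.** Let $\mathfrak h$ be a complex Hilbert space (inner product linear in the second variable), $\kappa$ an antiunitary involution of $\mathfrak h$, and $U$ a unitary operator on $\mathfrak h$ with $\kappa U^\dagger\kappa=-U$. Let $\mathfrak h^{\wedge n}$ be the completed antisymmetric tensor power, with $\langle f_1\wedge\dots\wedge f_n,g_1\wedge\dots\wedge g_n\rangle=\frac1{n!}\det(\langle f_i,g_j\rangle)$, and $\mathcal F_a(\mathfrak h)=\bigoplus_n\mathfrak h^{\wedge n}$ the antisymmetric Fock space with vacuum $\mathbb 1$. Let $\alpha^\dagger(f)$ be the operator $f_1\wedge\dots\wedge f_n\mapsto\sqrt{n+1}\,f\wedge f_1\wedge\dots\wedge f_n$ and $\alpha(f)$ its adjoint. The CAR algebra $\mathcal A(\mathfrak h)$ is the norm-closed $*$-algebra of operators on $\mathcal F_a(\mathfrak h)$ generated by all $\alpha^\dagger(f)$, with vacuum state $\omega(A)=\langle\mathbb 1,A\mathbb 1\rangle$; put $\Psi(f)=\alpha^\dagger(f)+\alpha(\kappa Uf)$. For a state $\omega$ on a $C^*$-algebra $\mathcal B$, $L^2(\mathcal B,\omega)$ is the completion of $\mathcal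 B/\{a:\omega(a^*a)=0\}$ for $\langle a,b\rangle=\omega(a^*b)$, and $[a]$ is the class of $a$. Let $\mathfrak A$ be the free unital $*$-algebra on generators $\boldsymbol\alpha^\dagger(f)$, $\boldsymbol\alpha(f)=\boldsymbol\alpha^\dagger(f)^*$, $f\in\mathfrak h$, with $\boldsymbol\alpha^\dagger$ linear. For a finite-dimensional subspace $b\subset\mathfrak h$ with orthogonal projection $P_b$ let $\pi_b\colon\mathfrak A\to\mathcal A(b)$ be the $*$-homomorphism with $\pi_b(\boldsymbol\alpha^\dagger(f))=\alpha^\dagger(P_bf)$, and $\|a\|_b=\|\pi_b(a)\|$. Let $\Gamma$ be a set of finite-dimensional subspaces of $\mathfrak h$ with a filtration: subsets $\Gamma_0\subset\Gamma_1\subset\cdots$ of $\Gamma$ with $\sup_{b\in\Gamma_n}\dim b<\infty$ for each $n$, such that $\Gamma_\infty=\bigcup_n\Gamma_n$ is directed by inclusion and $\bigcup_{b\in\Gamma_\infty}b$ is dense in $\mathfrak h$ (for example, all finite-dimensional subspaces, or all $\kappa U$-invariant ones, with $\Gamma_n=\{b\in\Gamma:\dim b\le n\}$). Let $\widehat{\mathfrak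 A}$ be the quotient of $\mathfrak A$ by the ideal $\mathfrak I_\Gamma=\{a:\pi_b(a)=0\ \forall b\in\Gamma\}$, put $\|a\|_n=\sup_{b\in\Gamma_n}\|a\|_b$, and let $\mathscr A$, the extended CAR algebra, be the (Hausdorff) completion of $\widehat{\mathfrak A}$ for the seminorms $\|\cdot\|_n$, to which these seminorms, and $\pi_b$ and $\|\cdot\|_b$ for $b\in\Gamma_\infty$, extend continuously. Put $\|a\|_\infty=\sup_n\|a\|_n\in[0,\infty]$ for $a\in\mathscr A$, and let $\mathfrak A_\infty\subset\mathscr A$ be the set of those $a$ for which there is, for each $\varepsilon>0$, an $x\in\widehat{\mathfrak A}$ with $\|a-x\|_\infty\le\varepsilon$. Put $\boldsymbol\Psi(f)=\boldsymbol\alpha^\dagger(f)+\boldsymbol\alpha(\kappa Uf)$ and $[x,y]_+=xy+yx$. The lifted Wick products are defined by $\boldsymbol\Psi^{\diamond0}=1$, $\boldsymbol\Psi^{\diamond1}=\boldsymbol\Psi$ and $$\boldsymbol\Psi^{\diamond n}(f_1\wedge\dots\wedge f_n)=\boldsymbol\Psi(f_1)\boldsymbol\Psi^{\diamond(n-1)}(f_2\wedge\dots\wedge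 f_n)-\sum_{i=2}^n(-1)^i[\boldsymbol\alpha(\kappa Uf_1),\boldsymbol\alpha^\dagger(f_i)]_+\,\boldsymbol\Psi^{\diamond(n-2)}(f_2\wedge\dots\widehat{f_i}\dots\wedge f_n),$$ and $\Psi^{\diamond n}$ in $\mathcal A(\mathfrak h)$ by the same recursion with $\Psi$ in place of $\boldsymbol\Psi$ and $\omega(\Psi(f_1)\Psi(f_i))$ in place of the anticommutators. **Theorem.** 1. $\mathscr A$ with the seminorms $(\|\cdot\|_n)_n$ is a locally $C^*$-algebra: a complete Hausdorff topological $*$-algebra whose topology is generated by these seminorms, each of which is submultiplicative and satisfies the $C^*$-identity. 2. $\mathfrak A_\infty$ is a dense $*$-subalgebra of $\mathscr A$, and a $C^*$-algebra with the norm $\|\cdot\|_\infty$. 3. The $*$-homomorphism $\mathfrak A\to\mathcal A(\mathfrak h)$, $\boldsymbol\alpha^\dagger(f)\mapsto\alpha^\dagger(f)$, vanishes on $\mathfrak I_\Gamma$, and the induced map on $\widehat{\mathfrak A}$ extends to a unique $*$-homomorphism $F\colon\mathfrak A_\infty\to\mathcal A(\mathfrak h)$, which is continuous and surjective. The vacuum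 state pulls back to a state $\boldsymbol\omega=\omega\circF$ on $\mathfrak A_\infty$, and $[a]\mapsto[F(a)]$ defines an isometric isomorphism $L^2(\mathfrak A_\infty,\boldsymbol\omega)\simeq L^2(\mathcal A(\mathfrak h),\omega)$. Moreover $F(\boldsymbol\Psi^{\diamond n}(f_1\wedge\dots\wedge f_n))=\Psi^{\diamond n}(f_1\wedge\dots\wedge f_n)$. 4. If $(P_k)_k$ is a sequence in the unital subalgebra of $\mathcal A(\mathfrak h)$ generated by the $\Psi(f)$, and $[P_k]$ converges in $L^2(\mathcal A(\mathfrak h),\omega)$, then there are $\mathbf P_k$ in the unital subalgebra of $\mathfrak A_\infty$ generated by the $\boldsymbol\Psi(f)$ and the anticommutators $[\boldsymbol\alpha(f),\boldsymbol\alpha^\dagger(g)]_+$ with $F(\mathbf P_k)=P_k$ for all $k$ such that $(\mathbf P_k)_k$ converges in $\mathscr A$. 5. For every $n\ge1$ the recursion yields a well-defined alternating $n$-linear map $(f_1,\dots,f_n)\mapsto\boldsymbol\Psi^{\diamond n}(f_1\wedge\dots\wedge f_n)\in\widehat{\mathfrak A}$. There are constants $C_n$, which depend on $n$ only, such that for every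 finite-dimensional subspace $b$ of $\mathfrak h$ the map $\pi_b\circ\boldsymbol\Psi^{\diamond n}$ extends to a continuous linear map $\mathfrak h^{\wedge n}\to\mathcal A(b)$, and, writing $\|\boldsymbol\Psi^{\diamond n}(G)\|_b$ for the norm of its value at $G$, $$\|\boldsymbol\Psi^{\diamond n}(G)\|_b\le C_n(1+\dim b)^{\frac{n-1}2}\,\|G\|_{\mathfrak h^{\wedge n}}\qquad\text{for all }G\in\mathfrak h^{\wedge n}.$$ Further, $\boldsymbol\Psi^{\diamond n}$ extends to a continuous linear map $\mathfrak h^{\wedge n}\to\mathscr A$, which satisfies the same bound for the seminorms $\|\cdot\|_b$, $b\in\Gamma_\infty$, of $\mathscr A$, and $\|G\|_{\mathfrak h^{\wedge n}}\le\|\boldsymbol\Psi^{\diamond n}(G)\|_\infty$ for all $G\in\mathfrak h^{\wedge n}$. -/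

import Mathlib

namespace ExtendedCAR
noncomputable section

open scoped InnerProductSpace ComplexConjugate ComplexOrder
open UniformSpace

section Fock

variable (H : Type*) [NormedAddCommGroup H] [InnerProductSpace ℂ H]

/-- Tuples of vectors of any finite length. -/
abbrev Tuples := Σ n : ℕ, (Fin n → H)

variable {H}

/-- The inner product `⟨x₁ ∧ ⋯ ∧ xₙ, y₁ ∧ ⋯ ∧ yₘ⟩`, which is `det(⟨xᵢ, yⱼ⟩) / n!` if `n = m`, and
`0` otherwise. -/
def wedgeKernel (a b : Tuples H) : ℂ :=
  if h : a.1 = b.1 then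
    ((a.1.factorial : ℂ))⁻¹ *
      (Matrix.of fun i j : Fin a.1 => ⟪a.2 i, b.2 (Fin.cast h j)⟫_ℂ).det
  else 0

lemma wedgeKernel_same {n : ℕ} (x y : Fin n → H) :
    wedgeKernel (⟨n, x⟩ : Tuples H) ⟨n, y⟩ =
      ((n.factorial : ℂ))⁻¹ * (Matrix.of fun i j => ⟪x i, y j⟫_ℂ).det := by
  simp [wedgeKernel]

lemma wedgeKernel_ne {n m : ℕ} (h : n ≠ m) (x : Fin n → H) (y : Fin m → H) :
    wedgeKernel (⟨n, x⟩ : Tuples H) ⟨m, y⟩ = 0 := by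
  simp [wedgeKernel, h]

lemma wedgeKernel_conj (a b : Tuples H) : conj (wedgeKernel b a) = wedgeKernel a b := by
  obtain ⟨n, x⟩ := a
  obtain ⟨m, y⟩ := b
  by_cases h : n = m
  · subst h
    rw [wedgeKernel_same, wedgeKernel_same, map_mul, RingHom.map_det, ← Matrix.det_transpose]
    congr 2
    · simp
    · ext i j; simp
  · rw [wedgeKernel_ne h, wedgeKernel_ne (Ne.symm h), map_zero]

/-- The Cauchy-Binet formula, in the form needed for positivity. -/
lemma det_inner_eq_sum {ι : Type*} [Fintype ι] (n : ℕ) (u v : Fin n → ι → ℂ) :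
    ∑ φ : Fin n → ι, conj (Matrix.of fun i j => u j (φ i)).det *
        (Matrix.of fun i j => v j (φ i)).det =
      (n.factorial : ℂ) * (Matrix.of fun i j => ∑ k, conj (u i k) * v j k).det := by
  classical
  have key : ∀ σ : Equiv.Perm (Fin n),
      ∑ φ : Fin n → ι, (∏ i, conj (u (σ i) (φ i))) *
        (Matrix.of fun i j => v j (φ i)).det =
      ((Equiv.Perm.sign σ : ℤ) : ℂ) * (Matrix.of fun i j => ∑ k, conj (u i k) * v j k).det := by
    intro σ
    have h1 := (Matrix.detRowAlternating (R := ℂ) (n := Fin n)).toMultilinearMap.map_sum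
      (fun i (k : ι) => (fun j => conj (u (σ i) k) * v j k))
    have h2 : Matrix.det (fun i j => ∑ k, conj (u (σ i) k) * v j k) =
        ∑ φ : Fin n → ι, Matrix.det (fun i j => conj (u (σ i) (φ i)) * v j (φ i)) := by
      have h0 : Matrix.det (fun i j => ∑ k, conj (u (σ i) k) * v j k) =
          Matrix.det (fun i => ∑ k, (fun j => conj (u (σ i) k) * v j k)) := by
        congr 1
        funext i j
        rw [Finset.sum_apply]
      rw [h0]
      exact h1
    have h3 := Matrix.det_permute σ (Matrix.of fun i j => ∑ k, conj (u i k) * v j k)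
    rw [← h3]
    have h4 : ((Matrix.of fun i j => ∑ k, conj (u i k) * v j k).submatrix (⇑σ) id) =
       (fun i j => ∑ k, conj (u (σ i) k) * v j k) := by
      ext i j; simp
    rw [h4, h2]
    refine Finset.sum_congr rfl fun φ _ => ?_
    exact (Matrix.det_mul_column (fun i => conj (u (σ i) (φ i)))
      (Matrix.of fun i j => v j (φ i))).symm
  have : ∀ φ : Fin n → ι, conj (Matrix.of fun i j => u j (φ i)).det =
      ∑ σ : Equiv.Perm (Fin n), ((Equiv.Perm.sign σ : ℤ) : ℂ) * ∏ i, conj (u (σ i) (φ i)) := by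
    intro φ
    rw [← Matrix.det_transpose, Matrix.det_apply']
    simp
  simp_rw [this, Finset.sum_mul]
  rw [Finset.sum_comm]
  simp_rw [mul_assoc, ← Finset.mul_sum, key, ← mul_assoc]
  rw [← Finset.sum_mul]
  congr 1
  have : ∀ σ : Equiv.Perm (Fin n), (((Equiv.Perm.sign σ : ℤ) : ℂ) * ((Equiv.Perm.sign σ : ℤ) : ℂ)) = 1 := by
    intro σ
    norm_cast
    simp
  simp [this, Fintype.card_perm]

lemma exists_features (s : Finset (Tuples H)) :
    ∃ (J : Type) (_ : Fintype J) (T : J → Tuples H → ℂ),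
      ∀ a ∈ s, ∀ b ∈ s, wedgeKernel a b = ∑ j, conj (T j a) * T j b := by
  classical
  let W : Submodule ℂ H := Submodule.span ℂ (⋃ a ∈ s, Set.range a.2)
  have hfin : (⋃ a ∈ s, Set.range a.2).Finite :=
    s.finite_toSet.biUnion fun a _ => Set.finite_range _
  have : FiniteDimensional ℂ W := FiniteDimensional.span_of_finite ℂ hfin
  have hmem : ∀ a ∈ s, ∀ i, a.2 i ∈ W := fun a ha i =>
    Submodule.subset_span (Set.mem_biUnion ha ⟨i, rfl⟩)
  let e := stdOrthonormalBasis ℂ W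
  let ι := Fin (Module.finrank ℂ W)
  have parse : ∀ x ∈ W, ∀ y ∈ W, ⟪x, y⟫_ℂ = ∑ k : ι, conj ⟪(e k : H), x⟫_ℂ * ⟪(e k : H), y⟫_ℂ := by
    intro x hx y hy
    have := e.sum_inner_mul_inner (⟨x, hx⟩ : W) ⟨y, hy⟩
    simp only [Submodule.coe_inner] at this
    rw [← this]
    simp only [inner_conj_symm]
    rfl
  let N := s.sup (fun a => a.1)
  let T : (Σ n : Fin (N + 1), (Fin n → ι)) → Tuples H → ℂ := fun j a =>
    if h : a.1 = j.1 then ((a.1.factorial : ℂ))⁻¹ *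
      (Matrix.of fun (i : Fin a.1) (l : Fin a.1) =>
        ⟪(e (j.2 (Fin.cast h i)) : H), a.2 l⟫_ℂ).det else 0
  refine ⟨_, inferInstance, T, ?_⟩
  rintro ⟨n, x⟩ ha ⟨m, y⟩ hb
  have hn : n < N + 1 := Nat.lt_succ_of_le (Finset.le_sup (f := fun a : Tuples H => a.1) ha)
  rw [Fintype.sum_sigma]
  rw [Finset.sum_eq_single (⟨n, hn⟩ : Fin (N + 1))]
  · by_cases h : n = m
    · subst h
      rw [wedgeKernel_same]
      have := det_inner_eq_sum n (fun i k => ⟪(e k : H), x i⟫_ℂ) (fun i k => ⟪(e k : H), y i⟫_ℂ)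
      have h2 : (Matrix.of fun i j => ⟪x i, y j⟫_ℂ) = (Matrix.of fun i j =>
          ∑ k, conj ⟪(e k : H), x i⟫_ℂ * ⟪(e k : H), y j⟫_ℂ) := by
        ext i j
        exact parse _ (hmem _ ha i) _ (hmem _ hb j)
      have hf : (n.factorial : ℂ) ≠ 0 := by exact_mod_cast n.factorial_ne_zero
      have h3 : ∀ φ : Fin n → ι, conj (T ⟨⟨n, hn⟩, φ⟩ ⟨n, x⟩) * T ⟨⟨n, hn⟩, φ⟩ ⟨n, y⟩ =
         (((n.factorial : ℂ))⁻¹ * ((n.factorial : ℂ))⁻¹) * (conj (Matrix.of fun i j => ⟪(e (φ i) : H), x j⟫_ℂ).det *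
          (Matrix.of fun i j => ⟪(e (φ i) : H), y j⟫_ℂ).det) := by
        intro φ
        simp [T]
        ring
      rw [Finset.sum_congr rfl fun φ _ => h3 φ, ← Finset.mul_sum, this, h2]
      field_simp
    · rw [wedgeKernel_ne h]
      symm
      refine Finset.sum_eq_zero fun φ _ => ?_
      have : T ⟨⟨n, hn⟩, φ⟩ ⟨m, y⟩ = 0 := by simp [T, Ne.symm h]
      rw [this, mul_zero]
  · intro k _ hk
    refine Finset.sum_eq_zero fun φ _ => ?_
    have : T ⟨k, φ⟩ ⟨n, x⟩ = 0 := by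
      have : ¬ (n = (k : ℕ)) := fun h => hk (Fin.ext h.symm)
      simp [T, this]
    rw [this, map_zero, zero_mul]
  · simp

/-- Finite formal linear combinations of tuples. With the semi-inner product below, its Hausdorff
completion is the antisymmetric Fock space. -/
abbrev PreFock (H : Type*) [NormedAddCommGroup H] [InnerProductSpace ℂ H] := Tuples H →₀ ℂ

namespace PreFock

/-- The tuple `x`, which represents `x₁ ∧ ⋯ ∧ xₙ`. -/
def single {n : ℕ} (x : Fin n → H) : PreFock H := Finsupp.single (⟨n, x⟩ : Tuples H) (1 : ℂ)

lemma induction_on {p : PreFock H → Prop} (u : PreFock H) (h0 : p 0)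
    (hadd : ∀ u v, p u → p v → p (u + v)) (hsmul : ∀ (c : ℂ) u, p u → p (c • u))
    (hs : ∀ {n : ℕ} (x : Fin n → H), p (single x)) : p u := by
  refine Finsupp.induction_linear (motive := p) u h0 (fun f g hf hg => hadd f g hf hg) ?_
  rintro ⟨n, x⟩ c
  have : (Finsupp.single (⟨n, x⟩ : Tuples H) c : Tuples H →₀ ℂ) =
      c • (Finsupp.single (⟨n, x⟩ : Tuples H) (1 : ℂ)) := by simp
  rw [this]
  exact hsmul c _ (hs x)

/-- Linear extension of a function on tuples. -/
def lift {M : Type*} [AddCommGroup M] [Module ℂ M] (φ : ∀ n : ℕ, (Fin n → H) → M) :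
    PreFock H →ₗ[ℂ] M :=
  Finsupp.linearCombination ℂ (fun a : Tuples H => φ a.1 a.2)

@[simp] lemma lift_single {M : Type*} [AddCommGroup M] [Module ℂ M]
    (φ : ∀ n : ℕ, (Fin n → H) → M) {n : ℕ} (x : Fin n → H) : lift φ (single x) = φ n x := by
  unfold lift single
  erw [Finsupp.linearCombination_single]
  simp

/-- The semi-inner product given by `wedgeKernel`. -/
instance core : PreInnerProductSpace.Core ℂ (PreFock H) where
  inner u v := Finsupp.sum (u : Tuples H →₀ ℂ) fun a c =>
    Finsupp.sum (v : Tuples H →₀ ℂ) fun b d => conj c * d * wedgeKernel a b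
  conj_inner_symm u v := by
    rw [Finsupp.sum_comm]
    simp only [map_finsuppSum]
    congr! 4
    ext b d
    rw [map_mul, wedgeKernel_conj]
    simp [mul_comm]
  add_left u v w := by
    erw [Finsupp.sum_add_index'] <;> simp [← Finsupp.sum_add, add_mul]
  smul_left u v c := by
    erw [Finsupp.sum_smul_index] <;> simp [Finsupp.mul_sum, ← mul_assoc]
  re_inner_nonneg u := by
    obtain ⟨J, _, T, hT⟩ := exists_features (Finsupp.support (u : Tuples H →₀ ℂ))
    have : Finsupp.sum (u : Tuples H →₀ ℂ) (fun a c =>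
        Finsupp.sum (u : Tuples H →₀ ℂ) fun b d => conj c * d * wedgeKernel a b) =
        ∑ j, conj (Finsupp.sum (u : Tuples H →₀ ℂ) fun a c => c * T j a) *
          (Finsupp.sum (u : Tuples H →₀ ℂ) fun a c => c * T j a) := by
      simp only [Finsupp.sum, map_sum, Finset.sum_mul_sum]
      rw [Finset.sum_comm (s := Finset.univ)]
      refine Finset.sum_congr rfl fun a ha => ?_
      rw [Finset.sum_comm (s := Finset.univ)]
      refine Finset.sum_congr rfl fun b hb => ?_
      rw [hT a ha b hb, Finset.mul_sum]
      refine Finset.sum_congr rfl fun j _ => ?_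
      rw [map_mul]; ring
    rw [this, map_sum]
    refine Finset.sum_nonneg fun j _ => ?_
    rw [← Complex.normSq_eq_conj_mul_self]
    exact Complex.normSq_nonneg _

instance : SeminormedAddCommGroup (PreFock H) :=
  InnerProductSpace.Core.toSeminormedAddCommGroup (𝕜 := ℂ)

instance : InnerProductSpace ℂ (PreFock H) := .ofCore _

lemma inner_single {n m : ℕ} (x : Fin n → H) (y : Fin m → H) :
    ⟪single x, single y⟫_ℂ = wedgeKernel (⟨n, x⟩ : Tuples H) ⟨m, y⟩ := by
  change Finsupp.sum (Finsupp.single (⟨n, x⟩ : Tuples H) (1 : ℂ)) (fun a c =>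
    Finsupp.sum (Finsupp.single (⟨m, y⟩ : Tuples H) (1 : ℂ)) fun b d =>
      conj c * d * wedgeKernel a b) = _
  simp

/-- The creation operator `f₁ ∧ ⋯ ∧ fₙ ↦ √(n+1) f ∧ f₁ ∧ ⋯ ∧ fₙ`. -/
def create (f : H) : PreFock H →ₗ[ℂ] PreFock H :=
  lift fun n x => ((√(n + 1 : ℝ) : ℝ) : ℂ) • single (Fin.cons f x : Fin (n + 1) → H)

/-- The annihilation operator, adjoint to the creation operator. -/
def annih (f : H) : PreFock H →ₗ[ℂ] PreFock H :=
  lift fun n => match n with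
    | 0 => fun _ => 0
    | n + 1 => fun x => ((√(n + 1 : ℝ) : ℝ) : ℂ)⁻¹ •
        ∑ j : Fin (n + 1), ((-1) ^ (j : ℕ) * ⟪f, x j⟫_ℂ) • single (fun i => x (j.succAbove i))

lemma create_single (f : H) {n : ℕ} (x : Fin n → H) :
    create f (single x) = ((√(n + 1 : ℝ) : ℝ) : ℂ) • single (Fin.cons f x : Fin (n + 1) → H) := by
  simp [create]

lemma annih_single_zero (f : H) (x : Fin 0 → H) : annih f (single x) = 0 := by
  simp [annih]

lemma annih_single_succ (f : H) {n : ℕ} (x : Fin (n + 1) → H) :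
    annih f (single x) = ((√(n + 1 : ℝ) : ℝ) : ℂ)⁻¹ •
      ∑ j : Fin (n + 1), ((-1) ^ (j : ℕ) * ⟪f, x j⟫_ℂ) • single (fun i => x (j.succAbove i)) := by
  simp [annih]

lemma sqrt_mul_sqrt (n : ℕ) : ((√(n + 1 : ℝ) : ℝ) : ℂ) * ((√(n + 1 : ℝ) : ℝ) : ℂ) = n + 1 := by
  rw [← Complex.ofReal_mul, Real.mul_self_sqrt (by positivity)]
  push_cast; rfl

lemma sqrt_ne (n : ℕ) : ((√(n + 1 : ℝ) : ℝ) : ℂ) ≠ 0 := by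
  rw [Complex.ofReal_ne_zero]; positivity

lemma inner_create (f : H) (u v : PreFock H) : ⟪create f u, v⟫_ℂ = ⟪u, annih f v⟫_ℂ := by
  induction u using induction_on with
  | h0 => simp
  | hadd u w hu hw => rw [map_add, inner_add_left, inner_add_left, hu, hw]
  | hsmul c u hu => rw [map_smul, inner_smul_left, inner_smul_left, hu]
  | @hs n x =>
  induction v using induction_on with
  | h0 => simp
  | hadd u w hu hw => rw [map_add, inner_add_right, inner_add_right, hu, hw]
  | hsmul c u hu => rw [map_smul, inner_smul_right, inner_smul_right, hu]
  | @hs m y =>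
  rw [create_single, inner_smul_left, inner_single, Complex.conj_ofReal]
  cases m with
  | zero => rw [annih_single_zero, inner_zero_right, wedgeKernel_ne (by omega), mul_zero]
  | succ m =>
    rw [annih_single_succ, inner_smul_right, inner_sum]
    simp_rw [inner_smul_right, inner_single]
    by_cases h : n = m
    · subst h
      simp_rw [wedgeKernel_same]
      rw [Matrix.det_succ_row_zero, Finset.mul_sum, Finset.mul_sum, Finset.mul_sum]
      refine Finset.sum_congr rfl fun j _ => ?_
      have hM : ((Matrix.of fun i j => ⟪(Fin.cons f x : Fin (n + 1) → H) i, y j⟫_ℂ).submatrix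
          Fin.succ j.succAbove) = Matrix.of fun i l => ⟪x i, y (j.succAbove l)⟫_ℂ := by
        ext i l; simp
      rw [hM]
      simp only [Matrix.of_apply, Fin.cons_zero]
      have h1 := sqrt_mul_sqrt n
      have h2 := sqrt_ne n
      have h3 : (n.factorial : ℂ) ≠ 0 := by exact_mod_cast n.factorial_ne_zero
      have h4 : ((n : ℂ) + 1) ≠ 0 := by exact_mod_cast n.succ_ne_zero
      rw [Nat.factorial_succ]
      push_cast
      rw [mul_inv, ← h1, mul_inv]
      field_simp
    · rw [wedgeKernel_ne (by omega)]
      simp [wedgeKernel_ne h]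

lemma annih_create (f g : H) (u : PreFock H) :
    annih f (create g u) + create g (annih f u) = ⟪f, g⟫_ℂ • u := by
  induction u using induction_on with
  | h0 => simp
  | hadd u w hu hw => simp only [map_add, smul_add, ← hu, ← hw]; abel
  | hsmul c u hu => simp only [map_smul, ← smul_add, hu, smul_comm c]
  | @hs n x =>
  rw [create_single, map_smul, annih_single_succ, smul_smul, mul_inv_cancel₀ (sqrt_ne n), one_smul,
    Fin.sum_univ_succ]
  simp only [Fin.val_zero, pow_zero, Fin.cons_zero, one_mul, Fin.zero_succAbove, Fin.cons_succ,
    Fin.val_succ]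
  cases n with
  | zero => rw [annih_single_zero, map_zero]; simp
  | succ n =>
    rw [annih_single_succ, map_smul, map_sum]
    simp_rw [map_smul, create_single]
    rw [add_assoc]
    convert add_zero _
    rw [Finset.smul_sum, ← Finset.sum_add_distrib]
    refine Finset.sum_eq_zero fun j _ => ?_
    rw [smul_comm _ ((√(n + 1 : ℝ) : ℝ) : ℂ), smul_smul, inv_mul_cancel₀ (sqrt_ne n), one_smul]
    have : (fun i => (Fin.cons g x : Fin (n + 2) → H) (j.succ.succAbove i)) =
        (Fin.cons g (fun i => x (j.succAbove i)) : Fin (n + 1) → H) := by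
      ext i
      refine Fin.cases ?_ (fun i => ?_) i
      · simp
      · simp
    rw [this, ← add_smul, pow_succ]
    convert zero_smul ℂ _
    ring

lemma norm_create_le (f : H) (u : PreFock H) : ‖create f u‖ ≤ ‖f‖ * ‖u‖ := by
  have h1 : ⟪create f u, create f u⟫_ℂ + ⟪annih f u, annih f u⟫_ℂ = ⟪f, f⟫_ℂ * ⟪u, u⟫_ℂ := by
    rw [inner_create, ← inner_smul_right, ← annih_create f f u, inner_add_right,
      ← inner_conj_symm u (create f _), inner_create, inner_conj_symm]
  have h2 := congrArg Complex.re h1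
  simp only [inner_self_eq_norm_sq_to_K] at h2
  have h3 : ‖create f u‖ ^ 2 + ‖annih f u‖ ^ 2 = ‖f‖ ^ 2 * ‖u‖ ^ 2 := by
    exact_mod_cast h2
  refine abs_le_of_sq_le_sq' ?_ (by positivity) |>.2
  nlinarith [sq_nonneg ‖annih f u‖]

lemma annih_add (f g : H) (u : PreFock H) : annih (f + g) u = annih f u + annih g u := by
  induction u using induction_on with
  | h0 => simp
  | hadd u w hu hw => simp only [map_add, hu, hw]; abel
  | hsmul c u hu => simp only [map_smul, hu, smul_add]
  | @hs n x =>
  cases n with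
  | zero => simp [annih_single_zero]
  | succ n =>
    simp only [annih_single_succ, inner_add_left, mul_add, add_smul, Finset.sum_add_distrib,
      smul_add]

lemma annih_smul (c : ℂ) (f : H) (u : PreFock H) : annih (c • f) u = conj c • annih f u := by
  induction u using induction_on with
  | h0 => simp
  | hadd u w hu hw => simp only [map_add, hu, hw, smul_add]
  | hsmul d u hu => simp only [map_smul, hu, smul_comm d]
  | @hs n x =>
  cases n with
  | zero => simp [annih_single_zero]
  | succ n =>
    simp only [annih_single_succ, inner_smul_left, Finset.smul_sum, smul_smul]
    refine Finset.sum_congr rfl fun j _ => ?_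
    congr 1; ring

end PreFock

variable (H) in
/-- The antisymmetric Fock space `⊕ₙ H^{∧n}`. -/
abbrev Fock := Completion (PreFock H)

lemma coe_eq_of_inner {u v : PreFock H} (h : ∀ w : PreFock H, ⟪u, w⟫_ℂ = ⟪v, w⟫_ℂ) :
    (u : Fock H) = v := by
  rw [← sub_eq_zero, ← Completion.coe_sub, ← norm_eq_zero, Completion.norm_coe]
  have : ⟪u - v, u - v⟫_ℂ = 0 := by rw [inner_sub_left, h, sub_self]
  rw [inner_self_eq_norm_sq_to_K] at this
  exact Complex.ofReal_eq_zero.1 (pow_eq_zero_iff two_ne_zero |>.1 this)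

/-- The creation operator `α†(f)`, as a bounded operator on the Fock space. -/
def creationCLM (f : H) : Fock H →L[ℂ] Fock H :=
  ((PreFock.create f).mkContinuous ‖f‖ (PreFock.norm_create_le f)).completion

lemma creationCLM_coe (f : H) (u : PreFock H) :
    creationCLM f (u : Fock H) = (PreFock.create f u : PreFock H) := by
  rw [creationCLM, ContinuousLinearMap.completion_apply_coe, LinearMap.mkContinuous_apply]

/-- The creation operator `α†(f)`, as a linear function of `f`. -/
def creation : H →ₗ[ℂ] (Fock H →L[ℂ] Fock H) where
  toFun := creationCLM
  map_add' f g := by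
    ext u
    induction u using Completion.induction_on with
    | hp => exact isClosed_eq (ContinuousLinearMap.continuous _) (ContinuousLinearMap.continuous _)
    | ih u =>
      rw [add_apply, creationCLM_coe, creationCLM_coe, creationCLM_coe, ← Completion.coe_add]
      refine coe_eq_of_inner fun v => ?_
      rw [inner_add_left, PreFock.inner_create, PreFock.inner_create, PreFock.inner_create,
        PreFock.annih_add, inner_add_right]
  map_smul' c f := by
    ext u
    induction u using Completion.induction_on with
    | hp => exact isClosed_eq (ContinuousLinearMap.continuous _) (ContinuousLinearMap.continuous _)
    | ih u =>
      rw [smul_apply, creationCLM_coe, creationCLM_coe, ← Completion.coe_smul]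
      refine coe_eq_of_inner fun v => ?_
      rw [RingHom.id_apply, inner_smul_left, PreFock.inner_create, PreFock.inner_create,
        PreFock.annih_smul, inner_smul_right]

lemma norm_creation_le (f : H) : ‖creation f‖ ≤ ‖f‖ := by
  refine ContinuousLinearMap.opNorm_le_bound _ (norm_nonneg _) fun u => ?_
  induction u using Completion.induction_on with
  | hp => exact isClosed_le (by fun_prop) (by fun_prop)
  | ih u =>
    change ‖creationCLM f _‖ ≤ _
    rw [creationCLM_coe, Completion.norm_coe, Completion.norm_coe]
    exact PreFock.norm_create_le f u

end Fock

section CARAlgebra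

variable {H : Type*} [NormedAddCommGroup H] [InnerProductSpace ℂ H]

/-- The vector `f₁ ∧ ⋯ ∧ fₙ` of the Fock space. -/
def wedge {n : ℕ} (x : Fin n → H) : Fock H := (PreFock.single x : PreFock H)

variable (H) in
/-- The vacuum vector. -/
def vacuum : Fock H := wedge (Fin.elim0 : Fin 0 → H)

variable (H) in
/-- The Hilbert space `H^{∧n}`, as a closed subspace of the Fock space. -/
def wedgePower (n : ℕ) : Submodule ℂ (Fock H) :=
  (Submodule.span ℂ (Set.range fun x : Fin n → H => wedge x)).topologicalClosure

lemma wedge_mem {n : ℕ} (x : Fin n → H) : wedge x ∈ wedgePower H n :=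
  Submodule.le_topologicalClosure _ (Submodule.subset_span ⟨x, rfl⟩)

variable (H) in
/-- The norm-closed `*`-algebra of operators on the Fock space generated by all `α†(f)`. -/
def carSubalgebra : StarSubalgebra ℂ (Fock H →L[ℂ] Fock H) :=
  (StarAlgebra.adjoin ℂ (Set.range (creation (H := H)))).topologicalClosure

variable (H) in
/-- The CAR algebra of `H`, a `C*`-algebra. -/
def CAR : Type _ := carSubalgebra H

instance isClosed_car : IsClosed (carSubalgebra H : Set (Fock H →L[ℂ] Fock H)) :=
  StarSubalgebra.isClosed_topologicalClosure _

instance : CStarAlgebra (Fock H →L[ℂ] Fock H) where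

instance : CStarAlgebra (CAR H) := inferInstanceAs (CStarAlgebra (carSubalgebra H))

instance : PartialOrder (CAR H) := CStarAlgebra.spectralOrder _
instance : StarOrderedRing (CAR H) := CStarAlgebra.spectralOrderedRing _

namespace CAR

/-- The action of the CAR algebra on the Fock space. -/
def toOp : CAR H →⋆ₐ[ℂ] (Fock H →L[ℂ] Fock H) := (carSubalgebra H).subtype

lemma norm_toOp (A : CAR H) : ‖toOp A‖ = ‖A‖ := rfl

/-- The generator `α†(f)`. -/
def create : H →ₗ[ℂ] CAR H :=
  (creation (H := H)).codRestrict (Subalgebra.toSubmodule (carSubalgebra H).toSubalgebra)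
    fun f => StarSubalgebra.le_topologicalClosure _ (StarAlgebra.subset_adjoin ℂ _ ⟨f, rfl⟩)

/-- The generator `α(f) = α†(f)*`. -/
def annih (f : H) : CAR H := star (create f)

lemma norm_create_le (f : H) : ‖create f‖ ≤ ‖f‖ := norm_creation_le f

variable (H) in
/-- The vacuum state `ω(A) = ⟨vacuum, A vacuum⟩`. -/
def vacuumState : CAR H →ₚ[ℂ] ℂ :=
  PositiveLinearMap.mk₀
    { toFun := fun A => ⟪vacuum H, toOp A (vacuum H)⟫_ℂ
      map_add' := fun A B => by rw [map_add, add_apply, inner_add_right]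
      map_smul' := fun c A => by rw [map_smul, smul_apply, inner_smul_right]; rfl }
    (fun A hA => by
      obtain ⟨B, rfl⟩ := CStarAlgebra.nonneg_iff_eq_star_mul_self.1 hA
      have h : ⟪vacuum H, toOp (star B * B) (vacuum H)⟫_ℂ =
          ⟪toOp B (vacuum H), toOp B (vacuum H)⟫_ℂ := by
        rw [map_mul, map_star]
        exact ContinuousLinearMap.adjoint_inner_right (toOp B) (vacuum H) (toOp B (vacuum H))
      change 0 ≤ ⟪vacuum H, toOp (star B * B) (vacuum H)⟫_ℂ
      rw [h, inner_self_eq_norm_sq_to_K]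
      simp)

end CAR
end CARAlgebra

section FreeStarAlgebra

/-- The complex conjugate of a complex vector space. -/
def ConjSpace (H : Type*) := H

namespace ConjSpace
variable {H : Type*} [AddCommGroup H] [Module ℂ H]
instance : AddCommGroup (ConjSpace H) := inferInstanceAs (AddCommGroup H)
instance : Module ℂ (ConjSpace H) := Module.compHom H (starRingEnd ℂ)

/-- The identity, as an antilinear map. -/
def mk : H →ₗ⋆[ℂ] ConjSpace H where
  toFun f := f
  map_add' _ _ := rfl
  map_smul' c f := by
    change c • f = (starRingEnd ℂ) ((starRingEnd ℂ) c) • f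
    rw [Complex.conj_conj]

/-- The identity, as an antilinear map. -/
def out : ConjSpace H →ₗ⋆[ℂ] H where
  toFun f := f
  map_add' _ _ := rfl
  map_smul' _ _ := rfl

@[simp] lemma out_mk (f : H) : out (mk f) = f := rfl
@[simp] lemma mk_out (f : ConjSpace H) : mk (out f) = f := rfl
end ConjSpace

/-- The opposite algebra with conjugated scalars. -/
def ConjOp (A : Type*) := Aᵐᵒᵖ

namespace ConjOp
variable {A : Type*} [Ring A]
instance : Ring (ConjOp A) := inferInstanceAs (Ring Aᵐᵒᵖ)
/-- The identity map to the opposite algebra. -/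
def op (a : A) : ConjOp A := MulOpposite.op a
/-- The identity map from the opposite algebra. -/
def unop (a : ConjOp A) : A := MulOpposite.unop a
lemma unop_mul (a b : ConjOp A) : unop (a * b) = unop b * unop a := rfl
lemma unop_add (a b : ConjOp A) : unop (a + b) = unop a + unop b := rfl
variable [Algebra ℂ A]
instance : Algebra ℂ (ConjOp A) :=
  RingHom.toAlgebra' ((algebraMap ℂ Aᵐᵒᵖ).comp (starRingEnd ℂ))
    fun c x => Algebra.commutes (A := Aᵐᵒᵖ) (conj c) x
lemma unop_algebraMap (c : ℂ) : unop (algebraMap ℂ (ConjOp A) c) = algebraMap ℂ A (conj c) := rfl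
lemma smul_op (c : ℂ) (a : A) : c • op a = op (conj c • a) := by
  have : unop (c • op a) = conj c • a := by
    rw [Algebra.smul_def, unop_mul, unop_algebraMap, Algebra.smul_def, Algebra.commutes]
    rfl
  exact congrArg op this
end ConjOp

variable (H : Type*) [AddCommGroup H] [Module ℂ H]

/-- The free unital `*`-algebra over `H`: the free algebra on generators `α†(f)`, linear in `f`,
and `α(f)`, antilinear in `f`, with `α†(f)* = α(f)`. -/
def FreeStar : Type _ := TensorAlgebra ℂ (H × ConjSpace H)

namespace FreeStar

instance : Ring (FreeStar H) := inferInstanceAs (Ring (TensorAlgebra ℂ (H × ConjSpace H)))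
instance : Algebra ℂ (FreeStar H) :=
  inferInstanceAs (Algebra ℂ (TensorAlgebra ℂ (H × ConjSpace H)))

variable {H}

/-- The space of generators. -/
def ι : (H × ConjSpace H) →ₗ[ℂ] FreeStar H := TensorAlgebra.ι ℂ

/-- The generator `α†(f)`. -/
def create : H →ₗ[ℂ] FreeStar H := ι ∘ₗ LinearMap.inl ℂ H (ConjSpace H)

/-- The generator `α(f)`, antilinear in `f`. -/
def annih : H →ₗ⋆[ℂ] FreeStar H := (ι ∘ₗ LinearMap.inr ℂ H (ConjSpace H)).comp ConjSpace.mk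

lemma ι_eq (p : H × ConjSpace H) : ι p = create p.1 + annih (ConjSpace.out p.2) := by
  simp only [create, annih, LinearMap.comp_apply, ← map_add]
  congr 1
  simp

lemma induction_on {p : FreeStar H → Prop} (a : FreeStar H)
    (hc : ∀ c : ℂ, p (algebraMap ℂ _ c)) (hcr : ∀ f, p (create f)) (han : ∀ f, p (annih f))
    (hadd : ∀ a b, p a → p b → p (a + b)) (hmul : ∀ a b, p a → p b → p (a * b)) : p a := by
  refine TensorAlgebra.induction (C := p) hc (fun x => ?_) hmul hadd a
  change p (ι x)
  rw [ι_eq]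
  exact hadd _ _ (hcr _) (han _)

/-- The involution, as a homomorphism to the conjugate opposite algebra. -/
def starAux : FreeStar H →ₐ[ℂ] ConjOp (FreeStar H) :=
  TensorAlgebra.lift ℂ
    { toFun := fun p => ConjOp.op (create (ConjSpace.out p.2) + annih p.1)
      map_add' := fun p q => by
        change _ = ConjOp.op _
        congr 1
        change create (ConjSpace.out (p.2 + q.2)) + annih (p.1 + q.1) =
          (create (ConjSpace.out p.2) + annih p.1) + (create (ConjSpace.out q.2) + annih q.1)
        simp only [map_add]; abel
      map_smul' := fun c p => by
        change ConjOp.op (create (ConjSpace.out (c • p.2)) + annih (c • p.1)) =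
          c • ConjOp.op (create (ConjSpace.out p.2) + annih p.1)
        rw [ConjOp.smul_op]
        simp only [map_smulₛₗ, smul_add]
        rfl }

instance : Star (FreeStar H) := ⟨fun a => ConjOp.unop (starAux a)⟩

lemma star_def (a : FreeStar H) : star a = ConjOp.unop (starAux a) := rfl

lemma starAux_ι (p : H × ConjSpace H) :
    starAux (ι p) = ConjOp.op (create (ConjSpace.out p.2) + annih p.1) :=
  TensorAlgebra.lift_ι_apply _ _

lemma star_create (f : H) : star (create f) = annih f := by
  rw [star_def, create, LinearMap.comp_apply, starAux_ι]
  change create (ConjSpace.out (0 : ConjSpace H)) + annih f = annih f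
  simp

lemma star_annih (f : H) : star (annih f) = create f := by
  rw [star_def, annih, LinearMap.comp_apply, LinearMap.comp_apply, starAux_ι]
  change create (ConjSpace.out (ConjSpace.mk f)) + annih (0 : H) = create f
  simp

protected lemma star_add (a b : FreeStar H) : star (a + b) = star a + star b := by
  simp only [star_def, map_add, ConjOp.unop_add]
protected lemma star_mul (a b : FreeStar H) : star (a * b) = star b * star a := by
  simp only [star_def, map_mul, ConjOp.unop_mul]
protected lemma star_algebraMap (c : ℂ) :
    star (algebraMap ℂ (FreeStar H) c) = algebraMap ℂ _ (conj c) := by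
  rw [star_def, AlgHom.commutes, ConjOp.unop_algebraMap]

instance : StarRing (FreeStar H) where
  star_involutive a := by
    induction a using induction_on with
    | hc c => rw [FreeStar.star_algebraMap, FreeStar.star_algebraMap, Complex.conj_conj]
    | hcr f => rw [star_create, star_annih]
    | han f => rw [star_annih, star_create]
    | hadd a b ha hb => rw [FreeStar.star_add, FreeStar.star_add, ha, hb]
    | hmul a b ha hb => rw [FreeStar.star_mul, FreeStar.star_mul, ha, hb]
  star_mul := FreeStar.star_mul
  star_add := FreeStar.star_add

instance : StarModule ℂ (FreeStar H) where
  star_smul c a := by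
    rw [Algebra.smul_def, FreeStar.star_mul, FreeStar.star_algebraMap, Algebra.smul_def,
      Algebra.commutes]
    rfl

/-- The universal property: the `*`-homomorphism with `α†(f) ↦ T f`. -/
def lift {B : Type*} [Ring B] [StarRing B] [Algebra ℂ B] [StarModule ℂ B] (T : H →ₗ[ℂ] B) :
    FreeStar H →⋆ₐ[ℂ] B :=
  let φ : FreeStar H →ₐ[ℂ] B := TensorAlgebra.lift ℂ
    { toFun := fun p => T p.1 + star (T (ConjSpace.out p.2))
      map_add' := fun p q => by
        change T (p.1 + q.1) + star (T (ConjSpace.out (p.2 + q.2))) = _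
        simp only [map_add, star_add]; abel
      map_smul' := fun c p => by
        change T (c • p.1) + star (T (ConjSpace.out (c • p.2))) = _
        simp only [map_smulₛₗ, smul_add, star_smul, RingHom.id_apply]
        simp }
  have hι : ∀ p, φ (ι p) = T p.1 + star (T (ConjSpace.out p.2)) := fun p =>
    TensorAlgebra.lift_ι_apply _ _
  have hcr : ∀ f, φ (create f) = T f := fun f => by
    rw [create, LinearMap.comp_apply, hι]
    simp
  have han : ∀ f, φ (annih f) = star (T f) := fun f => by
    rw [annih, LinearMap.comp_apply, LinearMap.comp_apply, hι]
    simp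
  { φ with
    map_star' := fun a => by
      change φ (star a) = star (φ a)
      induction a using induction_on with
      | hc c =>
        rw [FreeStar.star_algebraMap, AlgHom.commutes, AlgHom.commutes, ← algebraMap_star_comm]
        rfl
      | hcr f => rw [star_create, hcr, han]
      | han f => rw [star_annih, hcr, han, star_star]
      | hadd a b ha hb => rw [star_add, map_add, map_add, star_add, ha, hb]
      | hmul a b ha hb => rw [star_mul, map_mul, map_mul, star_mul, ha, hb] }

@[simp] lemma lift_create {B : Type*} [Ring B] [StarRing B] [Algebra ℂ B] [StarModule ℂ B]
    (T : H →ₗ[ℂ] B) (f : H) : lift T (create f) = T f := by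
  change TensorAlgebra.lift ℂ _ (TensorAlgebra.ι ℂ ((f, 0) : H × ConjSpace H)) = _
  rw [TensorAlgebra.lift_ι_apply]
  change T f + star (T (ConjSpace.out (0 : ConjSpace H))) = T f
  simp

end FreeStar
end FreeStarAlgebra

section Points

variable (H : Type*) [NormedAddCommGroup H] [InnerProductSpace ℂ H]

/-- The set of all finite-dimensional subspaces of `H`. -/
abbrev Gr := {b : Submodule ℂ H // FiniteDimensional ℂ b}

variable {H}

instance (b : Gr H) : FiniteDimensional ℂ b.1 := b.2

/-- The representation `π_b` of the free `*`-algebra in the CAR algebra of the finite-dimensional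
subspace `b`, given by `α†(f) ↦ α†(P_b f)` with the orthogonal projection `P_b` onto `b`. -/
def rep (b : Gr H) : FreeStar H →⋆ₐ[ℂ] CAR b.1 :=
  FreeStar.lift (CAR.create ∘ₗ (b.1.orthogonalProjectionOnto : H →ₗ[ℂ] b.1))

lemma rep_create (b : Gr H) (f : H) :
    rep b (FreeStar.create f) = CAR.create (b.1.orthogonalProjectionOnto f) := by
  simp [rep]

lemma rep_bounded (a : FreeStar H) : ∃ M : ℝ, ∀ b : Gr H, ‖rep b a‖ ≤ M := by
  have hcr : ∀ f : H, ∀ b : Gr H, ‖rep b (FreeStar.create f)‖ ≤ ‖f‖ := fun f b => by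
    rw [rep_create]
    exact (CAR.norm_create_le _).trans (b.1.norm_orthogonalProjectionOnto_apply_le f)
  induction a using FreeStar.induction_on with
  | hc c =>
    refine ⟨‖c‖ * 1, fun b => ?_⟩
    rw [AlgHomClass.commutes, norm_algebraMap]
    refine mul_le_mul_of_nonneg_left ?_ (norm_nonneg _)
    rw [← CAR.norm_toOp, map_one]
    exact ContinuousLinearMap.norm_id_le
  | hcr f => exact ⟨‖f‖, hcr f⟩
  | han f =>
    refine ⟨‖f‖, fun b => ?_⟩
    rw [← FreeStar.star_create, map_star, norm_star]
    exact hcr f b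
  | hadd x y hx hy =>
    obtain ⟨M, hM⟩ := hx
    obtain ⟨N, hN⟩ := hy
    exact ⟨M + N, fun b => by rw [map_add]; exact (norm_add_le _ _).trans (add_le_add (hM b) (hN b))⟩
  | hmul x y hx hy =>
    obtain ⟨M, hM⟩ := hx
    obtain ⟨N, hN⟩ := hy
    exact ⟨M * N, fun b => by
      rw [map_mul]
      exact (norm_mul_le _ _).trans (mul_le_mul (hM b) (hN b) (norm_nonneg _)
        ((norm_nonneg _).trans (hM b)))⟩

/-- The ideal of all elements `a` with `π_b(a) = 0` for all `b ∈ Γ`. -/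
def vanishingIdeal (Γ : Set (Gr H)) : Ideal (FreeStar H) where
  carrier := {a | ∀ b ∈ Γ, rep b a = 0}
  add_mem' ha hb c hc := by rw [map_add, ha c hc, hb c hc, add_zero]
  zero_mem' c _ := map_zero _
  smul_mem' x a ha c hc := by rw [smul_eq_mul, map_mul, ha c hc, mul_zero]

instance (Γ : Set (Gr H)) : (vanishingIdeal Γ).IsTwoSided :=
  ⟨fun {a} x ha c hc => by rw [map_mul, ha c hc, zero_mul]⟩

variable (Γ : Set (Gr H))

/-- A filtration of a set `Γ` of finite-dimensional subspaces: an increasing sequence of subsets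
`Γₙ` of `Γ`, each with bounded dimensions, such that the union of the `Γₙ` is directed by inclusion
and the subspaces which belong to it have a dense union in `H`. -/
structure Filtration where
  /-- the sets `Γₙ` -/
  level : ℕ → Set (Gr H)
  level_subset : ∀ n, level n ⊆ Γ
  monotone : Monotone level
  dim_bounded : ∀ n, ∃ d : ℕ, ∀ b ∈ level n, Module.finrank ℂ b.1 ≤ d
  directed : ∀ b ∈ ⋃ n, level n, ∀ c ∈ ⋃ n, level n, ∃ d ∈ ⋃ n, level n, b ≤ d ∧ c ≤ d
  dense : Dense (⋃ b ∈ ⋃ n, level n, (b.1 : Set H))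

variable {Γ}

/-- The union of all `Γₙ`. -/
def Filtration.points (𝓕 : Filtration Γ) : Set (Gr H) := ⋃ n, 𝓕.level n

lemma Filtration.points_subset (𝓕 : Filtration Γ) : 𝓕.points ⊆ Γ :=
  Set.iUnion_subset 𝓕.level_subset

/-- The `*`-algebra `𝔄̂`: the free `*`-algebra modulo the elements which vanish on `Γ`. It carries
the topology of the seminorms `‖·‖ₙ` of the filtration. -/
def HatAlg (_𝓕 : Filtration Γ) : Type _ := FreeStar H ⧸ vanishingIdeal Γ

namespace HatAlg

variable (𝓕 : Filtration Γ)

instance : Ring (HatAlg 𝓕) := inferInstanceAs (Ring (FreeStar H ⧸ vanishingIdeal Γ))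
instance : Algebra ℂ (HatAlg 𝓕) := inferInstanceAs (Algebra ℂ (FreeStar H ⧸ vanishingIdeal Γ))

/-- The quotient map, as an algebra homomorphism. -/
def mkₐ : FreeStar H →ₐ[ℂ] HatAlg 𝓕 := Ideal.Quotient.mkₐ ℂ (vanishingIdeal Γ)

lemma mkₐ_surjective : Function.Surjective (mkₐ 𝓕) := Ideal.Quotient.mk_surjective

lemma mkₐ_eq_iff {x y : FreeStar H} : mkₐ 𝓕 x = mkₐ 𝓕 y ↔ ∀ b ∈ Γ, rep b x = rep b y := by
  refine (Ideal.Quotient.eq (I := vanishingIdeal Γ)).trans ?_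
  refine forall₂_congr fun b _ => ?_
  rw [map_sub, sub_eq_zero]

instance : Star (HatAlg 𝓕) where
  star := Quotient.map star fun x y h => by
    have h1 : mkₐ 𝓕 x = mkₐ 𝓕 y := Quotient.sound h
    rw [mkₐ_eq_iff] at h1
    have h2 : mkₐ 𝓕 (star x) = mkₐ 𝓕 (star y) := by
      rw [mkₐ_eq_iff]
      intro b hb
      rw [map_star, map_star, h1 b hb]
    exact Quotient.exact h2

lemma star_mkₐ (x : FreeStar H) : star (mkₐ 𝓕 x) = mkₐ 𝓕 (star x) := rfl

instance : StarRing (HatAlg 𝓕) where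
  star_involutive a := by
    obtain ⟨x, rfl⟩ := mkₐ_surjective 𝓕 a
    rw [star_mkₐ, star_mkₐ, star_star]
  star_mul a b := by
    obtain ⟨x, rfl⟩ := mkₐ_surjective 𝓕 a
    obtain ⟨y, rfl⟩ := mkₐ_surjective 𝓕 b
    rw [← map_mul, star_mkₐ, star_mkₐ, star_mkₐ, star_mul, map_mul]
  star_add a b := by
    obtain ⟨x, rfl⟩ := mkₐ_surjective 𝓕 a
    obtain ⟨y, rfl⟩ := mkₐ_surjective 𝓕 b
    rw [← map_add, star_mkₐ, star_mkₐ, star_mkₐ, star_add, map_add]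

instance : StarModule ℂ (HatAlg 𝓕) where
  star_smul c a := by
    obtain ⟨x, rfl⟩ := mkₐ_surjective 𝓕 a
    rw [← map_smul, star_mkₐ, star_mkₐ, star_smul, map_smul]

/-- The quotient map. -/
def mk : FreeStar H →⋆ₐ[ℂ] HatAlg 𝓕 := { mkₐ 𝓕 with map_star' := fun _ => rfl }

lemma mk_surjective : Function.Surjective (mk 𝓕) := mkₐ_surjective 𝓕

/-- The representation `π_b` on the quotient, for `b ∈ Γ`. -/
def rep (b : Γ) : HatAlg 𝓕 →⋆ₐ[ℂ] CAR b.1.1 :=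
  { Ideal.Quotient.liftₐ (vanishingIdeal Γ) (ExtendedCAR.rep b.1 : FreeStar H →ₐ[ℂ] CAR b.1.1)
      (fun _ ha => ha b.1 b.2) with
    map_star' := fun a => by
      obtain ⟨x, rfl⟩ := mk_surjective 𝓕 a
      exact map_star (ExtendedCAR.rep b.1) x }

lemma rep_mk (b : Γ) (x : FreeStar H) : rep 𝓕 b (mk 𝓕 x) = ExtendedCAR.rep b.1 x := rfl

lemma bddAbove (n : ℕ) (a : HatAlg 𝓕) : BddAbove (Set.range fun b : 𝓕.level n =>
    ‖rep 𝓕 ⟨b.1, 𝓕.level_subset n b.2⟩ a‖) := by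
  obtain ⟨x, rfl⟩ := mk_surjective 𝓕 a
  obtain ⟨M, hM⟩ := rep_bounded x
  exact ⟨M, by rintro _ ⟨b, rfl⟩; exact hM _⟩

/-- `‖a‖ₙ = sup_{b ∈ Γₙ} ‖π_b(a)‖`, as a function. -/
def seminormFun (n : ℕ) (a : HatAlg 𝓕) : ℝ :=
  ⨆ b : 𝓕.level n, ‖rep 𝓕 ⟨b.1, 𝓕.level_subset n b.2⟩ a‖

lemma seminormFun_nonneg (n : ℕ) (a : HatAlg 𝓕) : 0 ≤ seminormFun 𝓕 n a :=
  Real.iSup_nonneg fun _ => norm_nonneg _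

lemma le_seminormFun (n : ℕ) (a : HatAlg 𝓕) (b : 𝓕.level n) :
    ‖rep 𝓕 ⟨b.1, 𝓕.level_subset n b.2⟩ a‖ ≤ seminormFun 𝓕 n a :=
  le_ciSup (bddAbove 𝓕 n a) b

/-- The seminorm `‖a‖ₙ = sup_{b ∈ Γₙ} ‖π_b(a)‖`. -/
def seminorm (n : ℕ) : Seminorm ℂ (HatAlg 𝓕) :=
  Seminorm.of (seminormFun 𝓕 n)
    (fun x y => Real.iSup_le (fun b => by
      rw [map_add]
      exact (norm_add_le _ _).trans (add_le_add (le_seminormFun 𝓕 n x b) (le_seminormFun 𝓕 n y b)))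
      (add_nonneg (seminormFun_nonneg 𝓕 n x) (seminormFun_nonneg 𝓕 n y)))
    (fun c x => by
      simp only [seminormFun, map_smul, norm_smul]
      rw [Real.mul_iSup_of_nonneg (norm_nonneg _)])

lemma seminorm_apply (n : ℕ) (a : HatAlg 𝓕) : seminorm 𝓕 n a =
    ⨆ b : 𝓕.level n, ‖rep 𝓕 ⟨b.1, 𝓕.level_subset n b.2⟩ a‖ := rfl

lemma seminorm_mul_le (n : ℕ) (x y : HatAlg 𝓕) :
    seminorm 𝓕 n (x * y) ≤ seminorm 𝓕 n x * seminorm 𝓕 n y :=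
  Real.iSup_le (fun b => by
      rw [map_mul]
      exact (norm_mul_le _ _).trans (mul_le_mul (le_seminormFun 𝓕 n x b) (le_seminormFun 𝓕 n y b)
        (norm_nonneg _) (seminormFun_nonneg 𝓕 n x)))
      (mul_nonneg (seminormFun_nonneg 𝓕 n x) (seminormFun_nonneg 𝓕 n y))

lemma seminorm_star (n : ℕ) (x : HatAlg 𝓕) : seminorm 𝓕 n (star x) = seminorm 𝓕 n x := by
  simp only [seminorm_apply, map_star, norm_star]

lemma seminorm_star_mul_self (n : ℕ) (x : HatAlg 𝓕) :
    seminorm 𝓕 n (star x * x) = seminorm 𝓕 n x ^ 2 := by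
  refine le_antisymm ?_ ?_
  · refine (seminorm_mul_le 𝓕 n _ _).trans ?_
    rw [seminorm_star, sq]
  · have h : seminorm 𝓕 n x ≤ √(seminorm 𝓕 n (star x * x)) :=
      Real.iSup_le (fun b => Real.le_sqrt_of_sq_le (by
        rw [sq, ← CStarRing.norm_star_mul_self, ← map_star, ← map_mul]
        exact le_seminormFun 𝓕 n (star x * x) b)) (Real.sqrt_nonneg _)
    calc seminorm 𝓕 n x ^ 2 ≤ √(seminorm 𝓕 n (star x * x)) ^ 2 :=
          pow_le_pow_left₀ (apply_nonneg _ _) h 2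
      _ = _ := Real.sq_sqrt (apply_nonneg _ _)

lemma seminorm_mono {m n : ℕ} (h : m ≤ n) : seminorm 𝓕 m ≤ seminorm 𝓕 n := fun x =>
  Real.iSup_le (fun b => le_seminormFun 𝓕 n x ⟨b.1, 𝓕.monotone h b.2⟩) (seminormFun_nonneg 𝓕 n x)

lemma bddAbove_seminorm (a : HatAlg 𝓕) : ∃ M, 0 ≤ M ∧ ∀ n, seminorm 𝓕 n a ≤ M := by
  obtain ⟨x, rfl⟩ := mk_surjective 𝓕 a
  obtain ⟨M, hM⟩ := rep_bounded x
  exact ⟨max M 0, le_max_right _ _, fun n => Real.iSup_le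
    (fun b => (hM b.1).trans (le_max_left _ _)) (le_max_right _ _)⟩

/-- The uniform structure generated by the seminorms. -/
instance : UniformSpace (HatAlg 𝓕) :=
  ⨅ n, (seminorm 𝓕 n).toSeminormedAddCommGroup.toUniformSpace

instance : IsUniformAddGroup (HatAlg 𝓕) := isUniformAddGroup_iInf fun n => by
  let _ := (seminorm 𝓕 n).toSeminormedAddCommGroup
  infer_instance

lemma withSeminorms : WithSeminorms (seminorm 𝓕) :=
  (SeminormFamily.withSeminorms_iff_uniformSpace_eq_iInf _).2 rfl

instance : ContinuousSMul ℂ (HatAlg 𝓕) := (withSeminorms 𝓕).continuousSMul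

lemma topology_eq : (inferInstance : TopologicalSpace (HatAlg 𝓕)) =
    ⨅ n, (seminorm 𝓕 n).toSeminormedAddCommGroup.toUniformSpace.toTopologicalSpace :=
  UniformSpace.toTopologicalSpace_iInf

/-- The semi-normed ring `(HatAlg, ‖·‖ₙ)`. -/
abbrev seminormedRing (n : ℕ) : SeminormedRing (HatAlg 𝓕) :=
  { (seminorm 𝓕 n).toSeminormedAddCommGroup, (inferInstance : Ring (HatAlg 𝓕)) with
    norm_mul_le := seminorm_mul_le 𝓕 n }

instance : ContinuousMul (HatAlg 𝓕) := by
  rw [show (UniformSpace.toTopologicalSpace : TopologicalSpace (HatAlg 𝓕)) = _ from topology_eq 𝓕]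
  exact continuousMul_iInf fun n =>
    (@NonUnitalSeminormedRing.toIsTopologicalRing _
      (seminormedRing 𝓕 n).toNonUnitalSeminormedRing).toContinuousMul

instance : IsTopologicalRing (HatAlg 𝓕) where

instance : UniformContinuousConstSMul ℂ (HatAlg 𝓕) :=
  uniformContinuousConstSMul_of_continuousConstSMul _ _

end HatAlg
end Points

section Extended

open Filter Topology

variable {H : Type*} [NormedAddCommGroup H] [InnerProductSpace ℂ H] {Γ : Set (Gr H)}

/-- The extended CAR algebra `𝒜`: the completion of `𝔄̂` for the seminorms `‖·‖ₙ`. -/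
abbrev ExtCAR (𝓕 : Filtration Γ) : Type _ := Completion (HatAlg 𝓕)

namespace ExtCAR

variable (𝓕 : Filtration Γ)

/-- The canonical map `𝔄̂ → 𝒜`. -/
def coe : HatAlg 𝓕 →+* ExtCAR 𝓕 := Completion.coeRingHom

lemma coe_apply (x : HatAlg 𝓕) : coe 𝓕 x = (x : ExtCAR 𝓕) := rfl

lemma coe_smul' (c : ℂ) (x : HatAlg 𝓕) : ((c • x : HatAlg 𝓕) : ExtCAR 𝓕) = c • (x : ExtCAR 𝓕) :=
  Completion.coe_smul c x

lemma uniformContinuous_seminorm (n : ℕ) : UniformContinuous (HatAlg.seminorm 𝓕 n) :=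
  Seminorm.uniformContinuous_of_continuousAt_zero
    ((HatAlg.withSeminorms 𝓕).continuous_seminorm n).continuousAt

lemma continuous_star_hat : Continuous (star : HatAlg 𝓕 → HatAlg 𝓕) := by
  let T : HatAlg 𝓕 →ₗ⋆[ℂ] HatAlg 𝓕 :=
    { toFun := star
      map_add' := star_add
      map_smul' := fun c x => star_smul c x }
  refine WithSeminorms.continuous_of_isBounded (HatAlg.withSeminorms 𝓕) (HatAlg.withSeminorms 𝓕) T ?_
  intro n
  refine ⟨{n}, 1, fun x => ?_⟩
  simpa [T] using (HatAlg.seminorm_star 𝓕 n x).le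

instance : Star (ExtCAR 𝓕) := ⟨Completion.map star⟩

lemma uniformContinuous_star_hat : UniformContinuous (star : HatAlg 𝓕 → HatAlg 𝓕) :=
  uniformContinuous_addMonoidHom_of_continuous (f := (starAddEquiv : HatAlg 𝓕 ≃+ HatAlg 𝓕))
    (continuous_star_hat 𝓕)

lemma star_coe (x : HatAlg 𝓕) : star (x : ExtCAR 𝓕) = ((star x : HatAlg 𝓕) : ExtCAR 𝓕) :=
  Completion.map_coe (uniformContinuous_star_hat 𝓕) x

instance : ContinuousStar (ExtCAR 𝓕) := ⟨Completion.continuous_map⟩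

instance : StarRing (ExtCAR 𝓕) where
  star_involutive a := by
    induction a using Completion.induction_on with
    | hp => exact isClosed_eq (continuous_star.comp continuous_star) continuous_id
    | ih x => rw [star_coe, star_coe, star_star]
  star_mul a b := by
    induction a, b using Completion.induction_on₂ with
    | hp => exact isClosed_eq (by fun_prop) (by fun_prop)
    | ih x y => rw [← Completion.coe_mul, star_coe, star_coe, star_coe, star_mul, Completion.coe_mul]
  star_add a b := by
    induction a, b using Completion.induction_on₂ with
    | hp => exact isClosed_eq (by fun_prop) (by fun_prop)
    | ih x y => rw [← Completion.coe_add, star_coe, star_coe, star_coe, star_add, Completion.coe_add]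

instance : StarModule ℂ (ExtCAR 𝓕) where
  star_smul c a := by
    induction a using Completion.induction_on with
    | hp => exact isClosed_eq (continuous_star.comp (continuous_const_smul c))
              ((continuous_const_smul (star c)).comp continuous_star)
    | ih x => rw [← coe_smul', star_coe, star_coe, star_smul, coe_smul']

/-- The continuous extension to `𝒜` of the seminorm `‖·‖ₙ`, as a function. -/
def seminormFun (n : ℕ) : ExtCAR 𝓕 → ℝ := Completion.extension (HatAlg.seminorm 𝓕 n)

lemma continuous_seminormFun (n : ℕ) : Continuous (seminormFun 𝓕 n) :=
  Completion.continuous_extension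

lemma seminormFun_coe (n : ℕ) (x : HatAlg 𝓕) :
    seminormFun 𝓕 n (x : ExtCAR 𝓕) = HatAlg.seminorm 𝓕 n x :=
  Completion.extension_coe (uniformContinuous_seminorm 𝓕 n) x

/-- The continuous extension to `𝒜` of the seminorm `‖·‖ₙ`. -/
def seminorm (n : ℕ) : Seminorm ℂ (ExtCAR 𝓕) :=
  Seminorm.of (seminormFun 𝓕 n)
    (fun a b => by
      have hc := continuous_seminormFun 𝓕 n
      induction a, b using Completion.induction_on₂ with
      | hp => exact isClosed_le (by fun_prop) (by fun_prop)
      | ih x y =>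
        rw [← Completion.coe_add, seminormFun_coe, seminormFun_coe, seminormFun_coe]
        exact map_add_le_add _ x y)
    (fun c a => by
      have hc := continuous_seminormFun 𝓕 n
      induction a using Completion.induction_on with
      | hp => exact isClosed_eq (hc.comp (continuous_const_smul c)) (by fun_prop)
      | ih x =>
        rw [← coe_smul', seminormFun_coe, seminormFun_coe]
        exact map_smul_eq_mul _ c x)

lemma continuous_seminorm (n : ℕ) : Continuous (seminorm 𝓕 n) := continuous_seminormFun 𝓕 n

lemma seminorm_coe (n : ℕ) (x : HatAlg 𝓕) :
    seminorm 𝓕 n (x : ExtCAR 𝓕) = HatAlg.seminorm 𝓕 n x := seminormFun_coe 𝓕 n x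

lemma seminorm_mul_le (n : ℕ) (a b : ExtCAR 𝓕) :
    seminorm 𝓕 n (a * b) ≤ seminorm 𝓕 n a * seminorm 𝓕 n b := by
  have hc := continuous_seminorm 𝓕 n
  induction a, b using Completion.induction_on₂ with
  | hp => exact isClosed_le (by fun_prop) (by fun_prop)
  | ih x y =>
    rw [← Completion.coe_mul, seminorm_coe, seminorm_coe, seminorm_coe]
    exact HatAlg.seminorm_mul_le 𝓕 n x y

lemma seminorm_star (n : ℕ) (a : ExtCAR 𝓕) : seminorm 𝓕 n (star a) = seminorm 𝓕 n a := by
  have hc := continuous_seminorm 𝓕 n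
  induction a using Completion.induction_on with
  | hp => exact isClosed_eq (by fun_prop) (by fun_prop)
  | ih x => rw [star_coe, seminorm_coe, seminorm_coe, HatAlg.seminorm_star]

lemma seminorm_star_mul_self (n : ℕ) (a : ExtCAR 𝓕) :
    seminorm 𝓕 n (star a * a) = seminorm 𝓕 n a ^ 2 := by
  have hc := continuous_seminorm 𝓕 n
  induction a using Completion.induction_on with
  | hp => exact isClosed_eq (by fun_prop) (by fun_prop)
  | ih x =>
    rw [star_coe, ← Completion.coe_mul, seminorm_coe, seminorm_coe, HatAlg.seminorm_star_mul_self]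

lemma dense_aux (n : ℕ) (r : ℝ) (a : ExtCAR 𝓕) (ha : seminorm 𝓕 n a < r)
    (V : Set (ExtCAR 𝓕)) (hV : IsClosed V)
    (h : ∀ x : HatAlg 𝓕, HatAlg.seminorm 𝓕 n x < r → (x : ExtCAR 𝓕) ∈ V) : a ∈ V := by
  have ho : IsOpen {a | seminorm 𝓕 n a < r} := isOpen_lt (continuous_seminorm 𝓕 n) continuous_const
  have hd := (Completion.denseRange_coe (α := HatAlg 𝓕)).open_subset_closure_inter ho ha
  refine closure_minimal ?_ hV hd
  rintro _ ⟨hx, x, rfl⟩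
  exact h x (by rwa [Set.mem_ofPred_eq, seminorm_coe] at hx)

lemma withSeminorms : WithSeminorms (seminorm 𝓕) := by
  rw [SeminormFamily.withSeminorms_iff_nhds_eq_iInf]
  refine le_antisymm (le_iInf fun n => ?_) fun U hU => ?_
  · rw [← tendsto_iff_comap]
    exact (continuous_seminorm 𝓕 n).tendsto' 0 0 (map_zero _)
  · obtain ⟨V, hV, hVc, hVU⟩ := exists_mem_nhds_isClosed_subset hU
    have h1 : ((↑) : HatAlg 𝓕 → ExtCAR 𝓕) ⁻¹' V ∈ 𝓝 (0 : HatAlg 𝓕) :=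
      (Completion.continuous_coe (HatAlg 𝓕)).continuousAt.preimage_mem_nhds
        (by rwa [Completion.coe_zero])
    rw [(SeminormFamily.withSeminorms_iff_nhds_eq_iInf (HatAlg.seminorm 𝓕)).1 (HatAlg.withSeminorms 𝓕),
      mem_iInf_of_directed] at h1
    · obtain ⟨n, hn⟩ := h1
      obtain ⟨W, hW, hWV⟩ := mem_comap.1 hn
      obtain ⟨r, hr, hrW⟩ := Metric.mem_nhds_iff.1 hW
      refine mem_iInf_of_mem n (mem_comap.2 ⟨Metric.ball 0 r, Metric.ball_mem_nhds 0 hr,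
        fun a ha => hVU (dense_aux 𝓕 n r a ?_ V hVc fun x hx => hWV (hrW ?_))⟩)
      · rw [Set.mem_preimage, mem_ball_zero_iff, Real.norm_eq_abs] at ha
        exact (le_abs_self _).trans_lt ha
      · rw [mem_ball_zero_iff, Real.norm_eq_abs, abs_of_nonneg (apply_nonneg _ _)]
        exact hx
    · intro m n
      refine ⟨max m n, ?_, ?_⟩
      all_goals
        refine fun S hS => ?_
        obtain ⟨W, hW, hWS⟩ := mem_comap.1 hS
        obtain ⟨r, hr, hrW⟩ := Metric.mem_nhds_iff.1 hW
        refine mem_comap.2 ⟨Metric.ball 0 r, Metric.ball_mem_nhds 0 hr, fun x hx => hWS (hrW ?_)⟩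
        rw [Set.mem_preimage, mem_ball_zero_iff, Real.norm_eq_abs,
          abs_of_nonneg (apply_nonneg _ _)] at hx
        rw [mem_ball_zero_iff, Real.norm_eq_abs, abs_of_nonneg (apply_nonneg _ _)]
      · exact (HatAlg.seminorm_mono 𝓕 (le_max_left m n) x).trans_lt hx
      · exact (HatAlg.seminorm_mono 𝓕 (le_max_right m n) x).trans_lt hx

lemma eq_zero_of_seminorm (a : ExtCAR 𝓕) (h : ∀ n, seminorm 𝓕 n a = 0) : a = 0 := by
  by_contra hne
  obtain ⟨n, hn⟩ := (withSeminorms 𝓕).separating_of_T1 a hne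
  exact hn (h n)

lemma continuous_rep_hat (b : Gr H) (hb : b ∈ 𝓕.points) :
    Continuous (HatAlg.rep 𝓕 ⟨b, 𝓕.points_subset hb⟩) := by
  obtain ⟨n, hn⟩ := Set.mem_iUnion.1 hb
  refine WithSeminorms.continuous_of_isBounded (HatAlg.withSeminorms 𝓕)
    (norm_withSeminorms ℂ (CAR b.1))
    (HatAlg.rep 𝓕 ⟨b, 𝓕.points_subset hb⟩ : HatAlg 𝓕 →ₐ[ℂ] CAR b.1).toLinearMap ?_
  intro _
  refine ⟨{n}, 1, fun x => ?_⟩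
  have h : ‖HatAlg.rep 𝓕 ⟨b, 𝓕.points_subset hb⟩ x‖ ≤ HatAlg.seminorm 𝓕 n x :=
    HatAlg.le_seminormFun 𝓕 n x ⟨b, hn⟩
  simpa using h

/-- The continuous extension of `π_b` to `𝒜`, for a point `b` of the filtration. -/
def rep (b : 𝓕.points) : ExtCAR 𝓕 →+* CAR b.1.1 :=
  Completion.extensionHom (HatAlg.rep 𝓕 ⟨b.1, 𝓕.points_subset b.2⟩ : HatAlg 𝓕 →+* CAR b.1.1)
    (continuous_rep_hat 𝓕 b.1 b.2)

lemma rep_coe (b : 𝓕.points) (x : HatAlg 𝓕) :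
    rep 𝓕 b (x : ExtCAR 𝓕) = HatAlg.rep 𝓕 ⟨b.1, 𝓕.points_subset b.2⟩ x :=
  Completion.extensionHom_coe _ (continuous_rep_hat 𝓕 b.1 b.2) x

end ExtCAR

variable (𝓕 : Filtration Γ)

lemma exists_bound_of_approx {a : ExtCAR 𝓕} {ε : ℝ} {x : HatAlg 𝓕}
    (h : ∀ n, ExtCAR.seminorm 𝓕 n (a - x) ≤ ε) :
    ∃ M, 0 ≤ M ∧ ∀ n, ExtCAR.seminorm 𝓕 n a ≤ M := by
  obtain ⟨M, hM, hx⟩ := HatAlg.bddAbove_seminorm 𝓕 x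
  have hε : 0 ≤ ε := (apply_nonneg _ _).trans (h 0)
  refine ⟨ε + M, by positivity, fun n => ?_⟩
  calc ExtCAR.seminorm 𝓕 n a = ExtCAR.seminorm 𝓕 n ((a - x) + x) := by rw [sub_add_cancel]
    _ ≤ _ := map_add_le_add _ _ _
    _ ≤ _ := add_le_add (h n) (by rw [ExtCAR.seminorm_coe]; exact hx n)

/-- The `*`-subalgebra `𝔄_∞` of `𝒜`: the closure of `𝔄̂` in `𝒜` with respect to
`‖a‖_∞ = supₙ ‖a‖ₙ`. -/
def boundedSubalgebra : StarSubalgebra ℂ (ExtCAR 𝓕) where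
  carrier := {a | ∀ ε : ℝ, 0 < ε → ∃ x : HatAlg 𝓕, ∀ n, ExtCAR.seminorm 𝓕 n (a - x) ≤ ε}
  mul_mem' := by
    intro a b ha hb ε hε
    obtain ⟨x₀, hx₀⟩ := ha 1 one_pos
    obtain ⟨M, hM, haM⟩ := exists_bound_of_approx 𝓕 hx₀
    obtain ⟨y, hy⟩ := hb (ε / (2 * (M + 1))) (by positivity)
    obtain ⟨N, hN, hyN⟩ := HatAlg.bddAbove_seminorm 𝓕 y
    obtain ⟨x, hx⟩ := ha (ε / (2 * (N + 1))) (by positivity)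
    refine ⟨x * y, fun n => ?_⟩
    have h1 : a * b - ((x * y : HatAlg 𝓕) : ExtCAR 𝓕) = a * (b - y) + (a - x) * y := by
      rw [Completion.coe_mul]; noncomm_ring
    rw [h1]
    have h2 : M * (ε / (2 * (M + 1))) ≤ ε / 2 := by
      rw [mul_div_assoc', div_le_div_iff₀ (by positivity) (by positivity)]
      nlinarith
    have h3 : (ε / (2 * (N + 1))) * N ≤ ε / 2 := by
      rw [div_mul_eq_mul_div, div_le_div_iff₀ (by positivity) (by positivity)]
      nlinarith
    calc _ ≤ _ := map_add_le_add (ExtCAR.seminorm 𝓕 n) _ _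
      _ ≤ M * (ε / (2 * (M + 1))) + (ε / (2 * (N + 1))) * N := by
        refine add_le_add ((ExtCAR.seminorm_mul_le 𝓕 n _ _).trans ?_)
          ((ExtCAR.seminorm_mul_le 𝓕 n _ _).trans ?_)
        · exact mul_le_mul (haM n) (hy n) (apply_nonneg _ _) hM
        · rw [ExtCAR.seminorm_coe]
          exact mul_le_mul (hx n) (hyN n) (apply_nonneg _ _) (by positivity)
      _ ≤ ε := by linarith
  add_mem' := by
    intro a b ha hb ε hε
    obtain ⟨x, hx⟩ := ha (ε / 2) (by positivity)
    obtain ⟨y, hy⟩ := hb (ε / 2) (by positivity)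
    refine ⟨x + y, fun n => ?_⟩
    rw [Completion.coe_add, add_sub_add_comm]
    calc _ ≤ _ := map_add_le_add (ExtCAR.seminorm 𝓕 n) _ _
      _ ≤ _ := add_le_add (hx n) (hy n)
      _ = ε := add_halves ε
  algebraMap_mem' := by
    intro c ε hε
    refine ⟨algebraMap ℂ _ c, fun n => ?_⟩
    rw [Completion.algebraMap_def, sub_self, map_zero]
    exact hε.le
  star_mem' := by
    intro a ha ε hε
    obtain ⟨x, hx⟩ := ha ε hε
    refine ⟨star x, fun n => ?_⟩
    rw [← ExtCAR.star_coe, ← star_sub, ExtCAR.seminorm_star]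
    exact hx n

/-- The `C*`-algebra `𝔄_∞`. -/
def AInf : Type _ := boundedSubalgebra 𝓕

namespace AInf

instance : Ring (AInf 𝓕) := inferInstanceAs (Ring (boundedSubalgebra 𝓕))
instance : Algebra ℂ (AInf 𝓕) := inferInstanceAs (Algebra ℂ (boundedSubalgebra 𝓕))
instance : StarRing (AInf 𝓕) := inferInstanceAs (StarRing (boundedSubalgebra 𝓕))
instance : StarModule ℂ (AInf 𝓕) := inferInstanceAs (StarModule ℂ (boundedSubalgebra 𝓕))

/-- The inclusion `𝔄_∞ ⊆ 𝒜`. -/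
def incl : AInf 𝓕 →⋆ₐ[ℂ] ExtCAR 𝓕 := (boundedSubalgebra 𝓕).subtype

lemma incl_injective : Function.Injective (incl 𝓕) := Subtype.val_injective

lemma approx (a : AInf 𝓕) : ∀ ε : ℝ, 0 < ε →
    ∃ x : HatAlg 𝓕, ∀ n, ExtCAR.seminorm 𝓕 n (incl 𝓕 a - x) ≤ ε := a.2

lemma bddAbove (a : AInf 𝓕) :
    BddAbove (Set.range fun n => ExtCAR.seminorm 𝓕 n (incl 𝓕 a)) := by
  obtain ⟨x, hx⟩ := approx 𝓕 a 1 one_pos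
  obtain ⟨M, -, hM⟩ := exists_bound_of_approx 𝓕 hx
  exact ⟨M, by rintro _ ⟨n, rfl⟩; exact hM n⟩

/-- `‖a‖_∞ = supₙ ‖a‖ₙ`. -/
instance : Norm (AInf 𝓕) := ⟨fun a => ⨆ n, ExtCAR.seminorm 𝓕 n (incl 𝓕 a)⟩

lemma norm_def (a : AInf 𝓕) : ‖a‖ = ⨆ n, ExtCAR.seminorm 𝓕 n (incl 𝓕 a) := rfl

lemma le_norm (a : AInf 𝓕) (n : ℕ) : ExtCAR.seminorm 𝓕 n (incl 𝓕 a) ≤ ‖a‖ :=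
  le_ciSup (bddAbove 𝓕 a) n

protected lemma norm_nonneg (a : AInf 𝓕) : 0 ≤ ‖a‖ := Real.iSup_nonneg fun _ => apply_nonneg _ _

lemma norm_le {a : AInf 𝓕} {M : ℝ} (h : ∀ n, ExtCAR.seminorm 𝓕 n (incl 𝓕 a) ≤ M) : ‖a‖ ≤ M :=
  ciSup_le h

instance : NormedRing (AInf 𝓕) := RingNorm.toNormedRing
  { toFun := fun a => ‖a‖
    map_zero' := le_antisymm (norm_le 𝓕 fun n => by rw [map_zero, map_zero]) (AInf.norm_nonneg 𝓕 _)
    add_le' := fun a b => norm_le 𝓕 fun n => by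
      rw [map_add]
      exact (map_add_le_add _ _ _).trans (add_le_add (le_norm 𝓕 a n) (le_norm 𝓕 b n))
    neg' := fun a => by simp only [norm_def, map_neg, map_neg_eq_map]
    mul_le' := fun a b => norm_le 𝓕 fun n => by
      rw [map_mul]
      exact (ExtCAR.seminorm_mul_le 𝓕 n _ _).trans
        (mul_le_mul (le_norm 𝓕 a n) (le_norm 𝓕 b n) (apply_nonneg _ _) (AInf.norm_nonneg 𝓕 a))
    eq_zero_of_map_eq_zero' := fun a ha => incl_injective 𝓕 <| by
      rw [map_zero]
      refine ExtCAR.eq_zero_of_seminorm 𝓕 _ fun n => le_antisymm ?_ (apply_nonneg _ _)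
      exact (le_norm 𝓕 a n).trans ha.le }

instance : NormedAlgebra ℂ (AInf 𝓕) where
  norm_smul_le c a := norm_le 𝓕 fun n => by
    rw [map_smul, map_smul_eq_mul]
    exact mul_le_mul_of_nonneg_left (le_norm 𝓕 a n) (norm_nonneg c)

instance : CStarRing (AInf 𝓕) where
  norm_mul_self_le a := by
    have h : ‖a‖ ≤ √‖star a * a‖ := norm_le 𝓕 fun n => Real.le_sqrt_of_sq_le (by
      rw [← ExtCAR.seminorm_star_mul_self, ← map_star, ← map_mul]
      exact le_norm 𝓕 _ n)
    calc ‖a‖ * ‖a‖ ≤ √‖star a * a‖ * √‖star a * a‖ :=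
          mul_le_mul h h (norm_nonneg a) (Real.sqrt_nonneg _)
      _ = _ := Real.mul_self_sqrt (norm_nonneg _)

lemma continuous_incl : Continuous (incl 𝓕) := by
  refine WithSeminorms.continuous_of_isBounded (norm_withSeminorms ℂ (AInf 𝓕))
    (ExtCAR.withSeminorms 𝓕) (incl 𝓕 : AInf 𝓕 →ₐ[ℂ] ExtCAR 𝓕).toLinearMap ?_
  intro n
  refine ⟨{0}, 1, fun a => ?_⟩
  simpa using le_norm 𝓕 a n

instance : CompleteSpace (AInf 𝓕) := by
  refine Metric.complete_of_cauchySeq_tendsto fun u hu => ?_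
  have hui : UniformContinuous (incl 𝓕) :=
    uniformContinuous_addMonoidHom_of_continuous (continuous_incl 𝓕)
  obtain ⟨a, ha⟩ := cauchySeq_tendsto_of_complete (hui.comp_cauchySeq hu)
  have key : ∀ ε : ℝ, 0 < ε → ∃ N, ∀ k ≥ N, ∀ n, ExtCAR.seminorm 𝓕 n (a - incl 𝓕 (u k)) ≤ ε := by
    intro ε hε
    obtain ⟨N, hN⟩ := Metric.cauchySeq_iff.1 hu ε hε
    refine ⟨N, fun k hk n => ?_⟩
    have hc := continuous_iff_continuousAt.1 (ExtCAR.continuous_seminorm 𝓕 n)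
      (a - incl 𝓕 (u k))
    refine le_of_tendsto (hc.tendsto.comp (ha.sub_const (incl 𝓕 (u k))))
      (eventually_atTop.2 ⟨N, fun m hm => ?_⟩)
    have h := (hN m hm k hk).le
    rw [dist_eq_norm] at h
    refine le_trans ?_ ((le_norm 𝓕 (u m - u k) n).trans h)
    rw [map_sub]
    rfl
  have hmem : a ∈ boundedSubalgebra 𝓕 := by
    intro ε hε
    obtain ⟨N, hN⟩ := key (ε / 2) (by positivity)
    obtain ⟨x, hx⟩ := approx 𝓕 (u N) (ε / 2) (by positivity)
    refine ⟨x, fun n => ?_⟩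
    calc ExtCAR.seminorm 𝓕 n (a - x)
        = ExtCAR.seminorm 𝓕 n ((a - incl 𝓕 (u N)) + (incl 𝓕 (u N) - x)) := by
          rw [sub_add_sub_cancel]
      _ ≤ _ := map_add_le_add _ _ _
      _ ≤ _ := add_le_add (hN N le_rfl n) (hx n)
      _ = ε := add_halves ε
  let a' : AInf 𝓕 := ⟨a, hmem⟩
  refine ⟨a', Metric.tendsto_atTop.2 fun ε hε => ?_⟩
  obtain ⟨N, hN⟩ := key (ε / 2) (by positivity)
  refine ⟨N, fun k hk => ?_⟩
  rw [dist_comm, dist_eq_norm]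
  refine lt_of_le_of_lt (norm_le 𝓕 (M := ε / 2) fun n => ?_) (by linarith)
  rw [map_sub]
  exact hN k hk n

instance : CStarAlgebra (AInf 𝓕) where

instance : PartialOrder (AInf 𝓕) := CStarAlgebra.spectralOrder _
instance : StarOrderedRing (AInf 𝓕) := CStarAlgebra.spectralOrderedRing _

/-- The canonical map from the free `*`-algebra to `𝔄_∞`. -/
def ofFree : FreeStar H →⋆ₐ[ℂ] AInf 𝓕 :=
  { toFun := fun x => ⟨((HatAlg.mk 𝓕 x : HatAlg 𝓕) : ExtCAR 𝓕),
      fun ε hε => ⟨HatAlg.mk 𝓕 x, fun n => by rw [sub_self, map_zero]; exact hε.le⟩⟩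
    map_one' := Subtype.ext (by rw [map_one]; rfl)
    map_zero' := Subtype.ext (by rw [map_zero]; rfl)
    map_mul' := fun x y => Subtype.ext (by rw [map_mul]; exact Completion.coe_mul _ _)
    map_add' := fun x y => Subtype.ext (by rw [map_add]; exact Completion.coe_add _ _)
    commutes' := fun c => Subtype.ext (by rw [AlgHomClass.commutes]; rfl)
    map_star' := fun x => Subtype.ext (by rw [map_star]; exact (ExtCAR.star_coe 𝓕 _).symm) }

lemma incl_ofFree (x : FreeStar H) : incl 𝓕 (ofFree 𝓕 x) = (HatAlg.mk 𝓕 x : HatAlg 𝓕) := rfl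

end AInf
end Extended

section LocallyCStar

/-- `A` is a locally `C*`-algebra for the family `p` of seminorms: a complete Hausdorff topological
`*`-algebra whose topology is generated by `p`, each `p i` being a submultiplicative seminorm which
satisfies the `C*`-identity. -/
structure IsLocallyCStarAlgebra {ι : Type*} (A : Type*) [Ring A] [Algebra ℂ A] [StarRing A]
    [UniformSpace A] (p : ι → Seminorm ℂ A) : Prop where
  completeSpace : CompleteSpace A
  t2Space : T2Space A
  isUniformAddGroup : IsUniformAddGroup A
  isTopologicalRing : IsTopologicalRing A
  continuousSMul : ContinuousSMul ℂ A
  starModule : StarModule ℂ A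
  continuousStar : ContinuousStar A
  withSeminorms : WithSeminorms p
  mul_le : ∀ i a b, p i (a * b) ≤ p i a * p i b
  star_mul_self : ∀ i a, p i (star a * a) = p i a ^ 2

end LocallyCStar

section PullBack

variable {A B : Type*} [CStarAlgebra A] [PartialOrder A] [StarOrderedRing A]
  [CStarAlgebra B] [PartialOrder B] [StarOrderedRing B]

/-- The pull-back `ω ∘ φ` of a positive functional along a `*`-homomorphism of `C*`-algebras. -/
def pullback (φ : A →⋆ₐ[ℂ] B) (ω : B →ₚ[ℂ] ℂ) : A →ₚ[ℂ] ℂ :=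
  PositiveLinearMap.mk₀ (ω.toLinearMap ∘ₗ (φ : A →ₐ[ℂ] B).toLinearMap) (fun a ha => by
    obtain ⟨b, rfl⟩ := CStarAlgebra.nonneg_iff_eq_star_mul_self.1 ha
    change 0 ≤ ω (φ (star b * b))
    rw [map_mul, map_star]
    exact ω.map_nonneg (star_mul_self_nonneg _))

/-- The class `[a]` of `a` in the non-commutative `L²` space of the positive functional `ω`, which
is the completion of `A` modulo `{a | ω(a* a) = 0}` for the inner product `⟨a, b⟩ = ω(a* b)`. -/
def toL2 (ω : A →ₚ[ℂ] ℂ) (a : A) : ω.GNS := (ω.toPreGNS a : ω.GNS)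

end PullBack

section Fields

variable (H : Type*) [NormedAddCommGroup H] [InnerProductSpace ℂ H] [CompleteSpace H]

/-- The data `(κ, U)` which determine the fermionic field: an antiunitary involution `κ` and a
unitary operator `U` with `κ U† κ = -U`. -/
structure FieldData where
  /-- the antiunitary involution `κ` -/
  kappa : H →ₗ⋆[ℂ] H
  /-- the covariance `U` -/
  U : H →L[ℂ] H
  inner_kappa : ∀ f g, ⟪kappa f, kappa g⟫_ℂ = ⟪g, f⟫_ℂ
  kappa_kappa : ∀ f, kappa (kappa f) = f
  unitary : U ∈ unitary (H →L[ℂ] H)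
  antisymm : ∀ f, kappa (star U (kappa f)) = -U f

variable {H}

/-- The anticommutator `[α(f), α†(g)]₊` in the free `*`-algebra. -/
def FreeStar.anticomm (f g : H) : FreeStar H :=
  FreeStar.annih f * FreeStar.create g + FreeStar.create g * FreeStar.annih f

namespace FieldData

variable (D : FieldData H)

/-- The lifted field `𝚿(f) = α†(f) + α(κ U f)` in the free `*`-algebra. -/
def freeField (f : H) : FreeStar H := FreeStar.create f + FreeStar.annih (D.kappa (D.U f))

/-- The field `Ψ(f) = α†(f) + α(κ U f)` in the CAR algebra. -/
def field (f : H) : CAR H := CAR.create f + CAR.annih (D.kappa (D.U f))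

/-- The lifted Wick product `𝚿^{⋄n}(f₁ ∧ ⋯ ∧ fₙ)`, as an element of the free `*`-algebra,
defined by `𝚿^{⋄0} = 1`, `𝚿^{⋄1} = 𝚿` and
`𝚿^{⋄n}(f₁ ∧ ⋯ ∧ fₙ) = 𝚿(f₁) 𝚿^{⋄(n-1)}(f₂ ∧ ⋯ ∧ fₙ)
  - ∑_{i=2}^n (-1)^i [α(κ U f₁), α†(fᵢ)]₊ 𝚿^{⋄(n-2)}(f₂ ∧ ⋯ omit fᵢ ⋯ ∧ fₙ)`.
The index `i : Fin (n + 1)` in the code stands for `fᵢ₊₂` in this formula. -/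
def freeWick : (n : ℕ) → (Fin n → H) → FreeStar H
  | 0, _ => 1
  | 1, f => D.freeField (f 0)
  | n + 2, f => D.freeField (f 0) * freeWick (n + 1) (fun j => f j.succ) -
      ∑ i : Fin (n + 1), (-1 : ℂ) ^ (i : ℕ) •
        (FreeStar.anticomm (D.kappa (D.U (f 0))) (f i.succ) *
          freeWick n (fun j => f (i.succAbove j).succ))

/-- The Wick product `Ψ^{⋄n}(f₁ ∧ ⋯ ∧ fₙ)` in the CAR algebra, defined by the same recursion with
`ω(Ψ(f₁) Ψ(fᵢ))` in place of the anticommutators. -/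
def wick : (n : ℕ) → (Fin n → H) → CAR H
  | 0, _ => 1
  | 1, f => D.field (f 0)
  | n + 2, f => D.field (f 0) * wick (n + 1) (fun j => f j.succ) -
      ∑ i : Fin (n + 1), ((-1 : ℂ) ^ (i : ℕ) *
          CAR.vacuumState H (D.field (f 0) * D.field (f i.succ))) •
        wick n (fun j => f (i.succAbove j).succ)

end FieldData

end Fields

end
end ExtendedCAR

open ExtendedCAR

/-!
Write `J = κ U`. The hypotheses on `κ` and `U` make `J` antiunitary with `J² = -1`, and `𝚿(f)` is
the sum of the creator `α†(f)` and the annihilator `α(J f)`, both linear in `f`.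

*Wick products.* In any algebra in which creators anticommute, annihilators anticommute, and the
mixed anticommutators are central, the Wick recursion produces the normal ordered products of the
fields (`normalProd_add_two`, `IsCARHom.wickMap_apply`). These come from a representation of the
exterior algebra, hence are alternating. The quotient `𝔄̂` and every `𝒜(b)` are such algebras.

*The bound in `𝒜(b)`.* The fields in `𝒜(b)` factor through the projection to a subspace which
contains `b` and `J b`, of dimension `d ≤ 2 dim b`. Expanding in an orthonormal basis `e` of it, the
value of `π_b ∘ 𝚿^{⋄n}` at `G` is `∑ᵢ ⟨e_{i₁} ∧ ⋯ ∧ e_{iₙ}, G⟩ π_b(𝚿^{⋄n}(e_{i₁} ∧ ⋯ ∧ e_{iₙ}))`, with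
square summable coefficients by a Bessel inequality (`sum_norm_inner_single_sq_le`). The
Cauchy-Schwarz inequality would cost `d^{n/2}`; one factor `√d` is gained as the recursion either
sums one index inside a field, with `‖Ψ(f)‖ ≤ 2 ‖f‖`, or contracts two indices with the covariance,
which has Hilbert-Schmidt norm at most `√d` (`norm_sum_rep_freeWick_le`). The lower bound holds since
`Ψ^{⋄n}(G)` maps the vacuum of `𝒜(b)` to `√n!` times the projection of `G`, and these projections
converge to `G` along the filtration.

*The homomorphism `F`.* The Fock space of `b` embeds isometrically in that of the whole space, and
this intertwines `π_b` with the representation `α†(f) ↦ α†(P_b f)`, which converges in norm to the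
one with `α†(f) ↦ α†(f)`. Therefore the norm in `𝒜(𝔥)` is dominated by `‖·‖_∞`
(`norm_lift_create_le`), and `F` exists by density. It is surjective as its range is dense and
elements of the range have preimages of comparable norm, by functional calculus
(`surjective_of_denseRange`).

*Lifting of convergent sequences.* In `𝒜(𝔥)`, polynomials in the fields are linear combinations of
Wick products, and a Wick polynomial is determined by the vector of the Fock space to which it maps
the vacuum, whose norm is the `L²` norm. The lifted Wick polynomial depends continuously on this
vector, because in `𝒜(b)` alternating expressions of degree larger than `2 dim b` vanish
(`rep_freeWick_eq_zero`), so that only finitely many degrees contribute to each seminorm.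
-/

namespace ExtendedCAR
noncomputable section

open scoped InnerProductSpace ComplexConjugate ComplexOrder
open UniformSpace

/-! ### Normal ordered products -/

section NormalOrdering

variable {V A : Type*} [AddCommGroup V] [Module ℂ V] [Ring A] [Algebra ℂ A]

/-- The operator `X ↦ c(f) X + (-1)ⁿ X a(f)` on sequences in `A`, which sends degree `n` to degree
`n + 1`. Iterating it on `1` in degree zero produces the normal ordered products. -/
def normalShift (c a : V →ₗ[ℂ] A) : V →ₗ[ℂ] Module.End ℂ (ℕ → A) where
  toFun f :=
    { toFun := fun X n => match n with
        | 0 => 0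
        | n + 1 => c f * X n + (-1 : ℂ) ^ n • (X n * a f)
      map_add' := fun X Y => by
        ext n
        cases n with
        | zero => simp
        | succ n => simp only [Pi.add_apply, mul_add, add_mul, smul_add]; abel
      map_smul' := fun r X => by
        ext n
        cases n with
        | zero => simp
        | succ n =>
          simp only [Pi.smul_apply, mul_smul_comm, smul_mul_assoc, smul_add, RingHom.id_apply]
          rw [smul_comm r] }
  map_add' f g := by
    ext X n
    cases n with
    | zero => simp
    | succ n =>
      simp only [map_add, add_mul, mul_add, smul_add, LinearMap.coe_mk, AddHom.coe_mk,
        LinearMap.add_apply, Pi.add_apply]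
      abel
  map_smul' r f := by
    ext X n
    cases n with
    | zero => simp
    | succ n =>
      simp only [map_smul, smul_mul_assoc, mul_smul_comm, LinearMap.coe_mk, AddHom.coe_mk,
        LinearMap.smul_apply, Pi.smul_apply, smul_add, RingHom.id_apply]
      rw [smul_comm r]

variable {c a : V →ₗ[ℂ] A}

lemma normalShift_apply_zero (f : V) (X : ℕ → A) : normalShift c a f X 0 = 0 := rfl

lemma normalShift_apply_succ (f : V) (X : ℕ → A) (n : ℕ) :
    normalShift c a f X (n + 1) = c f * X n + (-1 : ℂ) ^ n • (X n * a f) := rfl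

lemma normalShift_sq (hc : ∀ f, c f * c f = 0) (ha : ∀ f, a f * a f = 0) (f : V) :
    normalShift c a f * normalShift c a f = 0 := by
  ext X n
  match n with
  | 0 => rfl
  | 1 => simp [normalShift_apply_succ, normalShift_apply_zero, Module.End.mul_apply]
  | n + 2 =>
    simp only [Module.End.mul_apply, normalShift_apply_succ, LinearMap.zero_apply, Pi.zero_apply,
      mul_add, add_mul, mul_smul_comm, smul_mul_assoc, ← mul_assoc, hc, zero_mul, zero_add]
    rw [mul_assoc (X n), ha, mul_zero, smul_zero, add_zero, ← add_smul, pow_succ]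
    simp

/-- The normal ordered product `∑_S ± ∏_{i ∈ S} c(fᵢ) ∏_{i ∉ S} a(fᵢ)` of the `c(fᵢ) + a(fᵢ)`. It is
alternating because the operators `normalShift c a f` generate an exterior algebra. -/
def normalProd (hc : ∀ f, c f * c f = 0) (ha : ∀ f, a f * a f = 0) (n : ℕ) :
    V [⋀^Fin n]→ₗ[ℂ] A :=
  ((LinearMap.proj n ∘ₗ LinearMap.applyₗ (Pi.single 0 1 : ℕ → A)) ∘ₗ
    (ExteriorAlgebra.lift ℂ ⟨normalShift c a, normalShift_sq hc ha⟩).toLinearMap).compAlternatingMap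
      (ExteriorAlgebra.ιMulti ℂ n)

variable (hc : ∀ f, c f * c f = 0) (ha : ∀ f, a f * a f = 0)

lemma normalProd_zero (f : Fin 0 → V) : normalProd hc ha 0 f = 1 := by
  simp [normalProd]

lemma normalProd_succ {n : ℕ} (f : Fin (n + 1) → V) :
    normalProd hc ha (n + 1) f = c (f 0) * normalProd hc ha n (fun j => f j.succ) +
      (-1 : ℂ) ^ n • (normalProd hc ha n (fun j => f j.succ) * a (f 0)) := by
  simp only [normalProd, LinearMap.compAlternatingMap_apply, ExteriorAlgebra.ιMulti_succ_apply,
    LinearMap.comp_apply, AlgHom.toLinearMap_apply, map_mul, ExteriorAlgebra.lift_ι_apply,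
    LinearMap.applyₗ_apply_apply, LinearMap.proj_apply, Module.End.mul_apply,
    normalShift_apply_succ]
  rfl

lemma anticomm_of_sq {c : V →ₗ[ℂ] A} (hc : ∀ f, c f * c f = 0) (f g : V) :
    c f * c g = - (c g * c f) := by
  have h := hc (f + g)
  rw [map_add, add_mul, mul_add, mul_add, hc, hc, zero_add, add_zero] at h
  exact eq_neg_of_add_eq_zero_left h

variable {B : V → V → A} (hB : ∀ f g, a f * c g + c g * a f = B f g)
  (hBc : ∀ f g x, Commute (B f g) (c x))

include hB hBc in
/-- Moving an annihilator through a normal ordered product. -/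
lemma annih_mul_normalProd (g : V) {n : ℕ} (f : Fin (n + 1) → V) :
    a g * normalProd hc ha (n + 1) f = (-1 : ℂ) ^ (n + 1) • (normalProd hc ha (n + 1) f * a g) +
      ∑ i : Fin (n + 1), (-1 : ℂ) ^ (i : ℕ) •
        (B g (f i) * normalProd hc ha n (fun j => f (i.succAbove j))) := by
  have hac : ∀ x, a g * c x = B g x - c x * a g := fun x => eq_sub_of_add_eq (hB g x)
  induction n with
  | zero =>
    rw [normalProd_succ, normalProd_zero]
    simp [normalProd_zero, mul_add, add_mul, hac, anticomm_of_sq ha g (f 0)]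
    abel
  | succ n ih =>
    rw [normalProd_succ, Fin.sum_univ_succ]
    set N := normalProd hc ha (n + 1) (fun j => f j.succ) with hN
    set S := ∑ i : Fin (n + 1), (-1 : ℂ) ^ (i : ℕ) •
        (B g (f i.succ) * normalProd hc ha n (fun j => f (i.succAbove j).succ)) with hS
    have h1 : a g * N = (-1 : ℂ) ^ (n + 1) • (N * a g) + S := ih _
    have h2 : ∑ i : Fin (n + 1), (-1 : ℂ) ^ (i.succ : ℕ) •
        (B g (f i.succ) * normalProd hc ha (n + 1) (fun j => f (i.succ.succAbove j))) =
        - (c (f 0) * S) + (-1 : ℂ) ^ (n + 1) • (S * a (f 0)) := by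
      rw [hS, Finset.mul_sum, Finset.sum_mul, Finset.smul_sum, ← Finset.sum_neg_distrib,
        ← Finset.sum_add_distrib]
      refine Finset.sum_congr rfl fun i _ => ?_
      have h3 := normalProd_succ hc ha (fun j => f (i.succ.succAbove j))
      simp only [Fin.succ_succAbove_zero, Fin.succ_succAbove_succ] at h3
      rw [h3, mul_add, ← mul_assoc, (hBc _ _ _).eq]
      simp only [mul_smul_comm, smul_mul_assoc, smul_add, smul_smul, Fin.val_succ, mul_assoc]
      rw [pow_succ, pow_succ]
      simp only [mul_neg, mul_one, neg_smul]
      congr 2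
      ring_nf
    rw [h2, mul_add, mul_smul_comm, ← mul_assoc, hac, sub_mul, mul_assoc (c (f 0)), ← mul_assoc (a g),
      h1]
    simp only [mul_add, add_mul, smul_add, smul_mul_assoc, mul_smul_comm, mul_assoc,
      anticomm_of_sq ha g (f 0), smul_smul, Fin.val_zero, pow_zero, one_smul, Fin.zero_succAbove]
    rw [← hN]
    have h4 : (-1 : ℂ) ^ (n + 1) * (-1) ^ (n + 1) = 1 := by
      rw [← mul_pow]; simp
    have h5 : (-1 : ℂ) ^ (n + 1 + 1) * (-1) ^ (n + 1) = -1 := by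
      rw [pow_succ (-1 : ℂ) (n + 1), mul_right_comm, h4]; simp
    have h6 : (-1 : ℂ) ^ (n + 1 + 1) = - (-1) ^ (n + 1) := by rw [pow_succ]; simp
    rw [h4, h5, h6]
    simp only [one_smul, neg_smul, mul_neg]
    abel

include hB hBc in
/-- The normal ordered products satisfy the recursion of the Wick products. -/
lemma normalProd_add_two {n : ℕ} (f : Fin (n + 2) → V) :
    normalProd hc ha (n + 2) f = (c (f 0) + a (f 0)) * normalProd hc ha (n + 1) (fun j => f j.succ) -
      ∑ i : Fin (n + 1), (-1 : ℂ) ^ (i : ℕ) •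
        (B (f 0) (f i.succ) * normalProd hc ha n (fun j => f (i.succAbove j).succ)) := by
  rw [add_mul, annih_mul_normalProd hc ha hB hBc, normalProd_succ]
  abel

end NormalOrdering

/-! ### The canonical anticommutation relations -/

section Relations

variable {H : Type*} [NormedAddCommGroup H] [InnerProductSpace ℂ H]

lemma Fock.coe_induction {p : Fock H → Prop} (hp : IsClosed {v | p v})
    (h : ∀ u : PreFock H, p (u : Fock H)) (v : Fock H) : p v :=
  Completion.induction_on v hp h

lemma CAR.ext_coe {A B : CAR H}
    (h : ∀ u : PreFock H, CAR.toOp A (u : Fock H) = CAR.toOp B (u : Fock H)) : A = B := by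
  have h1 : CAR.toOp A = CAR.toOp B := by
    ext v
    induction v using Fock.coe_induction with
    | hp => exact isClosed_eq (ContinuousLinearMap.continuous _) (ContinuousLinearMap.continuous _)
    | h u => exact h u
  exact Subtype.ext h1

lemma CAR.toOp_create_coe (f : H) (u : PreFock H) :
    CAR.toOp (CAR.create f) (u : Fock H) = (PreFock.create f u : PreFock H) :=
  creationCLM_coe f u

lemma CAR.toOp_annih_coe (f : H) (u : PreFock H) :
    CAR.toOp (CAR.annih f) (u : Fock H) = (PreFock.annih f u : PreFock H) := by
  refine ext_inner_left ℂ fun v => ?_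
  induction v using Fock.coe_induction with
  | hp => exact isClosed_eq (by fun_prop) (by fun_prop)
  | h w =>
    have h1 : CAR.toOp (CAR.annih f) =
        ContinuousLinearMap.adjoint (CAR.toOp (CAR.create f)) := by
      rw [CAR.annih, map_star]; rfl
    rw [h1, ContinuousLinearMap.adjoint_inner_right, CAR.toOp_create_coe, Completion.inner_coe,
      Completion.inner_coe, PreFock.inner_create]

lemma CAR.create_mul_self (f : H) : CAR.create f * CAR.create f = 0 := by
  refine CAR.ext_coe fun u => ?_
  rw [map_mul, mul_apply_eq_comp, CAR.toOp_create_coe, CAR.toOp_create_coe, map_zero,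
    zero_apply, ← Completion.coe_zero]
  refine coe_eq_of_inner fun w => ?_
  rw [inner_zero_left]
  induction u using PreFock.induction_on with
  | h0 => simp
  | hadd u w hu hw => rw [map_add, map_add, inner_add_left, hu, hw, add_zero]
  | hsmul c u hu => rw [map_smul, map_smul, inner_smul_left, hu, mul_zero]
  | @hs n x =>
  induction w using PreFock.induction_on with
  | h0 => simp
  | hadd u w hu hw => rw [inner_add_right, hu, hw, add_zero]
  | hsmul c u hu => rw [inner_smul_right, hu, mul_zero]
  | @hs m y =>
  rw [PreFock.create_single, map_smul, PreFock.create_single, inner_smul_left, inner_smul_left,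
    PreFock.inner_single]
  by_cases h : n + 1 + 1 = m
  · subst h
    rw [wedgeKernel_same]
    rw [Matrix.det_zero_of_row_eq (i := 0) (j := 1) (by simp) (by ext j; simp)]
    simp
  · rw [wedgeKernel_ne h]; simp

lemma CAR.annih_mul_self (f : H) : CAR.annih f * CAR.annih f = 0 := by
  rw [CAR.annih, ← star_mul, CAR.create_mul_self, star_zero]

lemma CAR.annih_create (f g : H) :
    CAR.annih f * CAR.create g + CAR.create g * CAR.annih f = algebraMap ℂ (CAR H) ⟪f, g⟫_ℂ := by
  refine CAR.ext_coe fun u => ?_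
  rw [map_add, map_mul, map_mul, add_apply, mul_apply_eq_comp,
    mul_apply_eq_comp, CAR.toOp_create_coe, CAR.toOp_annih_coe, CAR.toOp_annih_coe,
    CAR.toOp_create_coe, ← Completion.coe_add, PreFock.annih_create, Algebra.algebraMap_eq_smul_one,
    map_smul, map_one, Completion.coe_smul]
  rfl

lemma CAR.toOp_annih_vacuum (f : H) : CAR.toOp (CAR.annih f) (vacuum H) = 0 := by
  rw [vacuum, wedge, CAR.toOp_annih_coe, PreFock.annih_single_zero, Completion.coe_zero]

lemma CAR.toOp_create_wedge (f : H) {n : ℕ} (x : Fin n → H) :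
    CAR.toOp (CAR.create f) (wedge x) =
      ((√(n + 1 : ℝ) : ℝ) : ℂ) • wedge (Fin.cons f x : Fin (n + 1) → H) := by
  rw [wedge, CAR.toOp_create_coe, PreFock.create_single, Completion.coe_smul, wedge]

lemma wedge_zero (x : Fin 0 → H) : wedge x = vacuum H := by
  rw [vacuum, Subsingleton.elim x Fin.elim0]

lemma norm_vacuum : ‖vacuum H‖ = 1 := by
  have h : ⟪vacuum H, vacuum H⟫_ℂ = 1 := by
    rw [vacuum, wedge, Completion.inner_coe, PreFock.inner_single, wedgeKernel_same]
    simp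
  rw [@norm_eq_sqrt_re_inner ℂ, h]
  simp

lemma CAR.vacuumState_apply (A : CAR H) :
    CAR.vacuumState H A = ⟪vacuum H, CAR.toOp A (vacuum H)⟫_ℂ := rfl

lemma vacuumState_create_mul (f : H) (X : CAR H) :
    CAR.vacuumState H (CAR.create f * X) = 0 := by
  rw [CAR.vacuumState_apply, map_mul, mul_apply_eq_comp]
  have h : CAR.toOp (CAR.create f) = ContinuousLinearMap.adjoint (CAR.toOp (CAR.annih f)) := by
    rw [CAR.annih, map_star, ← ContinuousLinearMap.star_eq_adjoint, star_star]
  rw [h, ContinuousLinearMap.adjoint_inner_right, CAR.toOp_annih_vacuum, inner_zero_left]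

lemma vacuumState_mul_annih (f : H) (X : CAR H) :
    CAR.vacuumState H (X * CAR.annih f) = 0 := by
  rw [CAR.vacuumState_apply, map_mul, mul_apply_eq_comp, CAR.toOp_annih_vacuum, map_zero,
    inner_zero_right]

lemma vacuumState_one : CAR.vacuumState H 1 = 1 := by
  rw [CAR.vacuumState_apply, map_one, one_apply_eq_self, inner_self_eq_norm_sq_to_K, norm_vacuum]
  simp

end Relations

/-! ### Functoriality of the Fock space -/

section Functoriality

variable {H K L : Type*} [NormedAddCommGroup H] [InnerProductSpace ℂ H]
  [NormedAddCommGroup K] [InnerProductSpace ℂ K] [NormedAddCommGroup L] [InnerProductSpace ℂ L]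

namespace PreFock

/-- The second quantization `x₁ ∧ ⋯ ∧ xₙ ↦ T x₁ ∧ ⋯ ∧ T xₙ` of a map `T`. -/
def map (T : H → K) : PreFock H →ₗ[ℂ] PreFock K := lift fun _ x => single fun i => T (x i)

@[simp] lemma map_single (T : H → K) {n : ℕ} (x : Fin n → H) :
    map T (single x) = single fun i => T (x i) := by simp [map]

/-- Second quantization respects adjoints. -/
lemma inner_map {T : H → K} {S : K → H} (h : ∀ x y, ⟪T x, y⟫_ℂ = ⟪x, S y⟫_ℂ)
    (u : PreFock H) (v : PreFock K) : ⟪map T u, v⟫_ℂ = ⟪u, map S v⟫_ℂ := by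
  induction u using induction_on with
  | h0 => simp
  | hadd u w hu hw => rw [map_add, inner_add_left, inner_add_left, hu, hw]
  | hsmul c u hu => rw [map_smul, inner_smul_left, inner_smul_left, hu]
  | @hs n x =>
  induction v using induction_on with
  | h0 => simp
  | hadd u w hu hw => rw [map_add, inner_add_right, inner_add_right, hu, hw]
  | hsmul c u hu => rw [map_smul, inner_smul_right, inner_smul_right, hu]
  | @hs m y =>
  rw [map_single, map_single, inner_single, inner_single]
  by_cases hnm : n = m
  · subst hnm
    simp only [wedgeKernel_same, h]
  · rw [wedgeKernel_ne hnm, wedgeKernel_ne hnm]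

lemma map_create (T : H → K) (f : H) (u : PreFock H) :
    map T (create f u) = create (T f) (map T u) := by
  induction u using induction_on with
  | h0 => simp
  | hadd u w hu hw => simp only [map_add, hu, hw]
  | hsmul c u hu => simp only [map_smul, hu]
  | hs x =>
    rw [create_single, map_smul, map_single, map_single, create_single]
    congr 2
    ext i
    refine Fin.cases ?_ (fun i => ?_) i <;> simp

lemma map_annih {T : H → K} (hT : ∀ x y, ⟪T x, T y⟫_ℂ = ⟪x, y⟫_ℂ) (f : H) (u : PreFock H) :
    map T (annih f u) = annih (T f) (map T u) := by
  induction u using induction_on with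
  | h0 => simp
  | hadd u w hu hw => simp only [map_add, hu, hw]
  | hsmul c u hu => simp only [map_smul, hu]
  | @hs n x =>
    cases n with
    | zero => rw [map_single, annih_single_zero, annih_single_zero, map_zero]
    | succ n =>
      simp only [map_single, annih_single_succ, map_smul, map_sum, hT]

lemma norm_map_of_inner {T : H → K} (hT : ∀ x y, ⟪T x, T y⟫_ℂ = ⟪x, y⟫_ℂ) (u : PreFock H) :
    ‖map T u‖ = ‖u‖ := by
  have h : ∀ u v : PreFock H, ⟪map T u, map T v⟫_ℂ = ⟪u, v⟫_ℂ := by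
    intro u v
    induction u using induction_on with
    | h0 => simp
    | hadd u w hu hw => rw [map_add, inner_add_left, inner_add_left, hu, hw]
    | hsmul c u hu => rw [map_smul, inner_smul_left, inner_smul_left, hu]
    | @hs n x =>
    induction v using induction_on with
    | h0 => simp
    | hadd u w hu hw => rw [map_add, inner_add_right, inner_add_right, hu, hw]
    | hsmul c u hu => rw [map_smul, inner_smul_right, inner_smul_right, hu]
    | @hs m y =>
    rw [map_single, map_single, inner_single, inner_single]
    by_cases hnm : n = m
    · subst hnm
      simp only [wedgeKernel_same, hT]
    · rw [wedgeKernel_ne hnm, wedgeKernel_ne hnm]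
  rw [@norm_eq_sqrt_re_inner ℂ, @norm_eq_sqrt_re_inner ℂ, h]

end PreFock

variable (b : Gr H)

lemma coe_inner_coe (x y : b.1) : ⟪(x : H), (y : H)⟫_ℂ = ⟪x, y⟫_ℂ := rfl

lemma inner_proj_left (x : H) (y : b.1) :
    ⟪b.1.orthogonalProjectionOnto x, y⟫_ℂ = ⟪x, (y : H)⟫_ℂ := by
  exact Submodule.inner_orthogonalProjectionOnto_eq_of_mem_right y x

/-- The inclusion of the Fock space of the subspace `b`. -/
def fockIncl : Fock b.1 →L[ℂ] Fock H :=
  ((PreFock.map ((↑) : b.1 → H)).mkContinuous 1 fun u => by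
    rw [one_mul, PreFock.norm_map_of_inner (coe_inner_coe b)]).completion

lemma fockIncl_coe (u : PreFock b.1) :
    fockIncl b (u : Fock b.1) = (PreFock.map ((↑) : b.1 → H) u : PreFock H) := by
  rw [fockIncl, ContinuousLinearMap.completion_apply_coe, LinearMap.mkContinuous_apply]

lemma norm_fockIncl (v : Fock b.1) : ‖fockIncl b v‖ = ‖v‖ := by
  induction v using Fock.coe_induction with
  | hp => exact isClosed_eq (by fun_prop) (by fun_prop)
  | h u =>
    rw [fockIncl_coe, Completion.norm_coe, Completion.norm_coe,
      PreFock.norm_map_of_inner (coe_inner_coe b)]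

lemma PreFock.norm_map_proj_le (u : PreFock H) :
    ‖PreFock.map b.1.orthogonalProjectionOnto u‖ ≤ ‖u‖ := by
  set v := PreFock.map b.1.orthogonalProjectionOnto u with hv
  have h1 : ⟪v, v⟫_ℂ = ⟪u, PreFock.map ((↑) : b.1 → H) v⟫_ℂ :=
    PreFock.inner_map (inner_proj_left b) u v
  have h2 : ‖v‖ * ‖v‖ ≤ ‖u‖ * ‖v‖ := by
    have := norm_inner_le_norm (𝕜 := ℂ) u (PreFock.map ((↑) : b.1 → H) v)
    rwa [← h1, ← inner_self_re_eq_norm, inner_self_eq_norm_mul_norm,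
      PreFock.norm_map_of_inner (coe_inner_coe b)] at this
  rcases (norm_nonneg v).eq_or_lt with h | h
  · rw [← h]; exact norm_nonneg u
  · exact le_of_mul_le_mul_right h2 h

/-- The projection onto the Fock space of the subspace `b`, adjoint to the inclusion. -/
def fockProj : Fock H →L[ℂ] Fock b.1 :=
  ((PreFock.map b.1.orthogonalProjectionOnto).mkContinuous 1 fun u => by
    rw [one_mul]; exact PreFock.norm_map_proj_le b u).completion

lemma fockProj_coe (u : PreFock H) :
    fockProj b (u : Fock H) = (PreFock.map b.1.orthogonalProjectionOnto u : PreFock b.1) := by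
  rw [fockProj, ContinuousLinearMap.completion_apply_coe, LinearMap.mkContinuous_apply]

lemma fockProj_wedge {n : ℕ} (x : Fin n → H) :
    fockProj b (wedge x) = wedge fun i => b.1.orthogonalProjectionOnto (x i) := by
  rw [wedge, fockProj_coe, PreFock.map_single, wedge]

lemma fockIncl_wedge {n : ℕ} (x : Fin n → b.1) :
    fockIncl b (wedge x) = wedge fun i => (x i : H) := by
  rw [wedge, fockIncl_coe, PreFock.map_single, wedge]

lemma norm_fockProj_le (v : Fock H) : ‖fockProj b v‖ ≤ ‖v‖ := by
  induction v using Fock.coe_induction with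
  | hp => exact isClosed_le (by fun_prop) (by fun_prop)
  | h u =>
    rw [fockProj_coe, Completion.norm_coe, Completion.norm_coe]
    exact PreFock.norm_map_proj_le b u

/-- The representation of the free `*`-algebra given by `α†(f) ↦ α†(T f)`. -/
def repOf (T : H →ₗ[ℂ] K) : FreeStar H →⋆ₐ[ℂ] CAR K := FreeStar.lift (CAR.create ∘ₗ T)

lemma rep_eq_repOf : rep b = repOf (b.1.orthogonalProjectionOnto : H →ₗ[ℂ] b.1) := rfl

lemma repOf_id : repOf (LinearMap.id : H →ₗ[ℂ] H) = FreeStar.lift CAR.create := rfl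

lemma repOf_create (T : H →ₗ[ℂ] K) (f : H) :
    repOf T (FreeStar.create f) = CAR.create (T f) := by simp [repOf]

lemma repOf_annih (T : H →ₗ[ℂ] K) (f : H) :
    repOf T (FreeStar.annih f) = CAR.annih (T f) := by
  rw [← FreeStar.star_create, map_star, repOf_create, CAR.annih]

lemma repOf_anticomm (T : H →ₗ[ℂ] K) (f g : H) :
    repOf T (FreeStar.anticomm f g) = algebraMap ℂ (CAR K) ⟪T f, T g⟫_ℂ := by
  simp only [FreeStar.anticomm, map_add, map_mul, repOf_create, repOf_annih, CAR.annih_create]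

/-- The inclusion of Fock spaces intertwines the representation in the CAR algebra of `b` with a
representation in the CAR algebra of `H`. -/
lemma fockIncl_rep (a : FreeStar H) (v : Fock b.1) :
    fockIncl b (CAR.toOp (rep b a) v) =
      CAR.toOp (repOf (b.1.subtype ∘ₗ (b.1.orthogonalProjectionOnto : H →ₗ[ℂ] b.1)) a)
        (fockIncl b v) := by
  induction a using FreeStar.induction_on generalizing v with
  | hc c =>
    rw [AlgHomClass.commutes, AlgHomClass.commutes, AlgHomClass.commutes, AlgHomClass.commutes]
    exact (fockIncl b).map_smul c v
  | hcr f =>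
    induction v using Fock.coe_induction with
    | hp => exact isClosed_eq (by fun_prop) (by fun_prop)
    | h u =>
      rw [rep_create, repOf_create, CAR.toOp_create_coe, fockIncl_coe, fockIncl_coe,
        CAR.toOp_create_coe, PreFock.map_create]
      rfl
  | han f =>
    induction v using Fock.coe_induction with
    | hp => exact isClosed_eq (by fun_prop) (by fun_prop)
    | h u =>
      rw [rep_eq_repOf, repOf_annih, repOf_annih, CAR.toOp_annih_coe, fockIncl_coe, fockIncl_coe,
        CAR.toOp_annih_coe, PreFock.map_annih (coe_inner_coe b)]
      rfl
  | hadd x y hx hy =>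
    simp only [map_add, add_apply, hx, hy]
  | hmul x y hx hy =>
    simp only [map_mul, mul_apply_eq_comp, hx, hy]

end Functoriality

/-! ### Approximation by finite-dimensional subspaces -/

section Approximation

open Filter Topology

variable {H : Type*} [NormedAddCommGroup H] [InnerProductSpace ℂ H]
  {K : Type*} [NormedAddCommGroup K] [InnerProductSpace ℂ K]
  {ι : Type*} {l : Filter ι}

lemma tendsto_clm_apply {A : ι → Fock H →L[ℂ] Fock H} {v : ι → Fock H} {A₀ : Fock H →L[ℂ] Fock H}
    {v₀ : Fock H} (hA : Tendsto A l (𝓝 A₀)) (hv : Tendsto v l (𝓝 v₀)) :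
    Tendsto (fun k => A k (v k)) l (𝓝 (A₀ v₀)) :=
  (isBoundedBilinearMap_apply.continuous.tendsto (A₀, v₀)).comp (hA.prodMk_nhds hv)

lemma tendsto_wedge {n : ℕ} {x : ι → Fin n → H} {y : Fin n → H}
    (h : ∀ i, Tendsto (fun k => x k i) l (𝓝 (y i))) :
    Tendsto (fun k => wedge (x k)) l (𝓝 (wedge y)) := by
  induction n with
  | zero => simp only [wedge_zero]; exact tendsto_const_nhds
  | succ n ih =>
    have hw : ∀ z : Fin (n + 1) → H, wedge z = ((√(n + 1 : ℝ) : ℝ) : ℂ)⁻¹ •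
        CAR.toOp (CAR.create (z 0)) (wedge fun i => z i.succ) := by
      intro z
      rw [CAR.toOp_create_wedge, smul_smul, inv_mul_cancel₀ (PreFock.sqrt_ne n), one_smul]
      congr 1
      exact (Fin.cons_self_tail z).symm
    simp only [hw]
    have hc : Continuous (fun f : H => CAR.toOp (CAR.create f)) :=
      AddMonoidHomClass.continuous_of_bound (creation (H := H)) 1 fun f => by
        rw [one_mul]; exact norm_creation_le f
    have h0 := (hc.tendsto _).comp (h 0)
    exact (tendsto_clm_apply h0 (ih fun i => h i.succ)).const_smul _

lemma tendsto_repOf {T : ι → H →ₗ[ℂ] K} {S : H →ₗ[ℂ] K}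
    (h : ∀ f, Tendsto (fun k => T k f) l (𝓝 (S f))) (a : FreeStar H) :
    Tendsto (fun k => repOf (T k) a) l (𝓝 (repOf S a)) := by
  have hc : Continuous (CAR.create : K →ₗ[ℂ] CAR K) :=
    AddMonoidHomClass.continuous_of_bound _ 1 fun f => by
      rw [one_mul]; exact CAR.norm_create_le f
  induction a using FreeStar.induction_on with
  | hc c => simp only [AlgHomClass.commutes]; exact tendsto_const_nhds
  | hcr f => simp only [repOf_create]; exact (hc.tendsto _).comp (h f)
  | han f =>
    simp only [repOf_annih, CAR.annih]
    exact (continuous_star.tendsto _).comp ((hc.tendsto _).comp (h f))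
  | hadd x y hx hy => simp only [map_add]; exact hx.add hy
  | hmul x y hx hy => simp only [map_mul]; exact hx.mul hy

variable {b : ι → Gr H}
  (h : ∀ f, Tendsto (fun k => ((b k).1.orthogonalProjectionOnto f : H)) l (𝓝 f))

include h in
lemma tendsto_fockIncl_fockProj (v : Fock H) :
    Tendsto (fun k => fockIncl (b k) (fockProj (b k) v)) l (𝓝 v) := by
  have hpre : ∀ u : PreFock H,
      Tendsto (fun k => fockIncl (b k) (fockProj (b k) (u : Fock H))) l (𝓝 (u : Fock H)) := by
    intro u
    induction u using PreFock.induction_on with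
    | h0 => simp only [Completion.coe_zero, map_zero]; exact tendsto_const_nhds
    | hadd u w hu hw => simp only [Completion.coe_add, map_add]; exact hu.add hw
    | hsmul c u hu => simp only [Completion.coe_smul, map_smul]; exact hu.const_smul c
    | hs x =>
      change Tendsto (fun k => fockIncl (b k) (fockProj (b k) (wedge x))) l (𝓝 (wedge x))
      simp only [fockProj_wedge, fockIncl_wedge]
      exact tendsto_wedge fun i => h (x i)
  rw [Metric.tendsto_nhds]
  intro ε hε
  obtain ⟨u, hu⟩ := (Completion.denseRange_coe (α := PreFock H)).exists_dist_lt v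
    (show 0 < ε / 3 by positivity)
  filter_upwards [Metric.tendsto_nhds.1 (hpre u) (ε / 3) (by positivity)] with k hk
  have h1 : dist (fockIncl (b k) (fockProj (b k) v)) (fockIncl (b k) (fockProj (b k) (u : Fock H))) ≤
      dist v (u : Fock H) := by
    rw [dist_eq_norm, dist_eq_norm, ← map_sub, ← map_sub, norm_fockIncl]
    exact norm_fockProj_le _ _
  calc _ ≤ _ := dist_triangle4 _ (fockIncl (b k) (fockProj (b k) (u : Fock H))) (u : Fock H) _
    _ < ε / 3 + ε / 3 + ε / 3 := by
      rw [dist_comm (u : Fock H) v]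
      gcongr
      exact h1.trans_lt hu
    _ = ε := by ring

include h in
/-- The norm in the CAR algebra is at most the supremum of the norms `‖·‖_b`. -/
lemma norm_lift_create_le [NeBot l] (a : FreeStar H) {M : ℝ} (hM : ∀ k, ‖rep (b k) a‖ ≤ M) :
    ‖FreeStar.lift (CAR.create (H := H)) a‖ ≤ M := by
  have hM0 : 0 ≤ M := by
    obtain ⟨k⟩ := l.nonempty_of_neBot
    exact (norm_nonneg _).trans (hM k)
  rw [← CAR.norm_toOp]
  refine ContinuousLinearMap.opNorm_le_bound _ hM0 fun v => ?_
  have h1 := tendsto_repOf (T := fun k => (b k).1.subtype ∘ₗ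
    ((b k).1.orthogonalProjectionOnto : H →ₗ[ℂ] (b k).1)) (S := LinearMap.id) (l := l)
    (fun f => h f) a
  have hc : Continuous (CAR.toOp (H := H)) :=
    AddMonoidHomClass.continuous_of_bound _ 1 fun A => by rw [one_mul, CAR.norm_toOp]
  have h2 := (hc.tendsto _).comp h1
  have h3 := (tendsto_clm_apply h2 (tendsto_fockIncl_fockProj h v)).norm
  refine le_of_tendsto h3 (Eventually.of_forall fun k => ?_)
  rw [Function.comp_apply]
  rw [← fockIncl_rep, norm_fockIncl]
  refine ((CAR.toOp (rep (b k) a)).le_opNorm _).trans ?_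
  rw [CAR.norm_toOp]
  exact mul_le_mul (hM k) (norm_fockProj_le _ v) (norm_nonneg _) hM0

end Approximation

section FiltrationLimit

open Filter Topology

variable {H : Type*} [NormedAddCommGroup H] [InnerProductSpace ℂ H] {Γ : Set (Gr H)}
  (𝓕 : Filtration Γ)

instance : Nonempty 𝓕.points := by
  obtain ⟨f, hf⟩ := 𝓕.dense.nonempty
  obtain ⟨b, hb, -⟩ := Set.mem_iUnion₂.1 hf
  exact ⟨⟨b, hb⟩⟩

instance : IsDirectedOrder 𝓕.points :=
  ⟨fun b c => by
    obtain ⟨d, hd, h1, h2⟩ := 𝓕.directed b.1 b.2 c.1 c.2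
    exact ⟨⟨d, hd⟩, h1, h2⟩⟩

lemma tendsto_orthogonalProjection (f : H) :
    Tendsto (fun b : 𝓕.points => (b.1.1.orthogonalProjectionOnto f : H)) atTop (𝓝 f) := by
  rw [Metric.tendsto_nhds]
  intro ε hε
  obtain ⟨g, hgf, hg⟩ := Metric.dense_iff.1 𝓕.dense f (ε / 2) (by positivity)
  obtain ⟨b, hb, hgb⟩ := Set.mem_iUnion₂.1 hg
  filter_upwards [eventually_ge_atTop (⟨b, hb⟩ : 𝓕.points)] with c hc
  have hgc : g ∈ c.1.1 := hc hgb
  have h1 : (c.1.1.orthogonalProjectionOnto f : H) - g = c.1.1.orthogonalProjectionOnto (f - g) := by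
    rw [map_sub, Submodule.coe_sub]
    congr 1
    exact (congrArg Subtype.val
      (Submodule.orthogonalProjectionOnto_mem_subspace_eq_self (⟨g, hgc⟩ : c.1.1))).symm
  have h2 : ‖(c.1.1.orthogonalProjectionOnto f : H) - g‖ ≤ dist g f := by
    rw [h1, dist_comm, dist_eq_norm]
    exact c.1.1.norm_orthogonalProjectionOnto_apply_le _
  calc _ ≤ _ := dist_triangle _ g _
    _ < ε / 2 + ε / 2 := by
      have := Metric.mem_ball.1 hgf
      rw [dist_eq_norm]
      exact add_lt_add (h2.trans_lt this) this
    _ = ε := add_halves ε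

end FiltrationLimit

/-! ### Wick products as normal ordered products -/

section Wick

variable {H : Type*} [NormedAddCommGroup H] [InnerProductSpace ℂ H]
  {K : Type*} [NormedAddCommGroup K] [InnerProductSpace ℂ K]
  {A : Type*} [Ring A] [Algebra ℂ A]

/-- A homomorphism of the free `*`-algebra under which the creators, and the annihilators,
anticommute among themselves, while anticommutators of creators and annihilators commute with
the creators. -/
structure IsCARHom (φ : FreeStar H →ₐ[ℂ] A) : Prop where
  create_sq : ∀ f, φ (FreeStar.create f) * φ (FreeStar.create f) = 0
  annih_sq : ∀ f, φ (FreeStar.annih f) * φ (FreeStar.annih f) = 0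
  commute : ∀ f g h, Commute (φ (FreeStar.anticomm f g)) (φ (FreeStar.create h))

lemma isCARHom_repOf (T : H →ₗ[ℂ] K) : IsCARHom (repOf T : FreeStar H →ₐ[ℂ] CAR K) where
  create_sq f := by
    change repOf T _ * repOf T _ = 0
    rw [repOf_create, CAR.create_mul_self]
  annih_sq f := by
    change repOf T _ * repOf T _ = 0
    rw [repOf_annih, CAR.annih_mul_self]
  commute f g h := by
    change Commute (repOf T _) (repOf T _)
    rw [repOf_anticomm]
    exact Algebra.commutes _ _

lemma isCARHom_hat {Γ : Set (Gr H)} (𝓕 : Filtration Γ) :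
    IsCARHom (HatAlg.mk 𝓕 : FreeStar H →ₐ[ℂ] HatAlg 𝓕) where
  create_sq f := by
    change HatAlg.mkₐ 𝓕 _ * HatAlg.mkₐ 𝓕 _ = 0
    rw [← map_mul, ← map_zero (HatAlg.mkₐ 𝓕), HatAlg.mkₐ_eq_iff]
    intro b _
    rw [map_mul, map_zero]
    exact (isCARHom_repOf _).create_sq f
  annih_sq f := by
    change HatAlg.mkₐ 𝓕 _ * HatAlg.mkₐ 𝓕 _ = 0
    rw [← map_mul, ← map_zero (HatAlg.mkₐ 𝓕), HatAlg.mkₐ_eq_iff]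
    intro b _
    rw [map_mul, map_zero]
    exact (isCARHom_repOf _).annih_sq f
  commute f g h := by
    change HatAlg.mkₐ 𝓕 _ * HatAlg.mkₐ 𝓕 _ = HatAlg.mkₐ 𝓕 _ * HatAlg.mkₐ 𝓕 _
    rw [← map_mul, ← map_mul, HatAlg.mkₐ_eq_iff]
    intro b _
    rw [map_mul, map_mul]
    exact (isCARHom_repOf _).commute f g h

variable [CompleteSpace H]

namespace FieldData

variable (D : FieldData H)

/-- The antiunitary map `κ U`. -/
def J : H →ₗ⋆[ℂ] H := D.kappa.comp (D.U : H →ₗ[ℂ] H)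

lemma J_apply (f : H) : D.J f = D.kappa (D.U f) := rfl

lemma inner_J_J (f g : H) : ⟪D.J f, D.J g⟫_ℂ = ⟪g, f⟫_ℂ := by
  rw [J_apply, J_apply, D.inner_kappa]
  exact ContinuousLinearMap.inner_map_map_of_mem_unitary D.unitary g f

lemma norm_J (f : H) : ‖D.J f‖ = ‖f‖ := by
  rw [@norm_eq_sqrt_re_inner ℂ, @norm_eq_sqrt_re_inner ℂ, inner_J_J]

lemma J_J (f : H) : D.J (D.J f) = -f := by
  have h1 := congrArg D.kappa (D.antisymm f)
  rw [D.kappa_kappa, map_neg] at h1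
  have h2 : D.U (star D.U (D.kappa f)) = D.kappa f := by
    rw [← mul_apply_eq_comp, (Unitary.mem_iff.1 D.unitary).2]; rfl
  have h3 := congrArg (fun z => D.kappa (D.U z)) h1
  simp only [h2, map_neg, D.kappa_kappa] at h3
  exact (neg_eq_iff_eq_neg.2 h3).symm

lemma inner_J_left (f g : H) : ⟪D.J f, g⟫_ℂ = -⟪D.J g, f⟫_ℂ := by
  rw [← D.inner_J_J g (D.J f), D.J_J, inner_neg_right]

lemma freeField_eq (f : H) : D.freeField f = FreeStar.create f + FreeStar.annih (D.J f) := rfl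

lemma freeWick_zero (x : Fin 0 → H) : D.freeWick 0 x = 1 := rfl

lemma freeWick_one (x : Fin 1 → H) : D.freeWick 1 x = D.freeField (x 0) := rfl

lemma freeWick_add_two (n : ℕ) (x : Fin (n + 2) → H) : D.freeWick (n + 2) x =
    D.freeField (x 0) * D.freeWick (n + 1) (fun j => x j.succ) -
      ∑ i : Fin (n + 1), (-1 : ℂ) ^ (i : ℕ) •
        (FreeStar.anticomm (D.J (x 0)) (x i.succ) *
          D.freeWick n (fun j => x (i.succAbove j).succ)) := rfl

end FieldData

namespace IsCARHom

variable {φ : FreeStar H →ₐ[ℂ] A} (hφ : IsCARHom φ) (D : FieldData H)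

/-- The normal ordered product of fields in the image of the free `*`-algebra under `φ`. -/
def wickMap (n : ℕ) : H [⋀^Fin n]→ₗ[ℂ] A :=
  normalProd (c := φ.toLinearMap ∘ₗ FreeStar.create)
    (a := φ.toLinearMap ∘ₗ FreeStar.annih.comp D.J)
    (fun f => hφ.create_sq f) (fun f => hφ.annih_sq (D.J f)) n

lemma wickMap_zero (x : Fin 0 → H) : hφ.wickMap D 0 x = 1 := normalProd_zero _ _ x

lemma wickMap_succ {n : ℕ} (x : Fin (n + 1) → H) : hφ.wickMap D (n + 1) x =
    φ (FreeStar.create (x 0)) * hφ.wickMap D n (fun j => x j.succ) +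
      (-1 : ℂ) ^ n • (hφ.wickMap D n (fun j => x j.succ) * φ (FreeStar.annih (D.J (x 0)))) :=
  normalProd_succ _ _ x

/-- The Wick recursion produces normal ordered products. In particular it is alternating. -/
lemma wickMap_apply : ∀ (n : ℕ) (x : Fin n → H), hφ.wickMap D n x = φ (D.freeWick n x)
  | 0, x => by rw [wickMap_zero, D.freeWick_zero, map_one]
  | 1, x => by
    rw [wickMap_succ, wickMap_zero, D.freeWick_one, D.freeField_eq, map_add]
    simp
  | n + 2, x => by
    have h := normalProd_add_two (c := φ.toLinearMap ∘ₗ FreeStar.create)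
      (a := φ.toLinearMap ∘ₗ FreeStar.annih.comp D.J)
      (fun f => hφ.create_sq f) (fun f => hφ.annih_sq (D.J f))
      (B := fun f g => φ (FreeStar.anticomm (D.J f) g))
      (fun f g => by
        simp only [FreeStar.anticomm, map_add, map_mul]
        rfl)
      (fun f g x => hφ.commute _ g x) x
    refine Eq.trans h ?_
    have h1 := wickMap_apply (n + 1) (fun j => x j.succ)
    have h2 := fun i : Fin (n + 1) => wickMap_apply n (fun j => x (i.succAbove j).succ)
    simp only [wickMap] at h1 h2
    simp only [h1, h2, D.freeWick_add_two, D.freeField_eq, map_sub, map_mul, map_add, map_sum,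
      map_smul]
    rfl

include hφ in
/-- The Wick products only depend on the images of the fields. -/
lemma freeWick_congr {Q : H → H} (hc : ∀ f, φ (FreeStar.create (Q f)) = φ (FreeStar.create f))
    (ha : ∀ f, φ (FreeStar.annih (D.J (Q f))) = φ (FreeStar.annih (D.J f)))
    (n : ℕ) (x : Fin n → H) : φ (D.freeWick n fun i => Q (x i)) = φ (D.freeWick n x) := by
  rw [← hφ.wickMap_apply, ← hφ.wickMap_apply]
  induction n with
  | zero => rw [wickMap_zero, wickMap_zero]
  | succ n ih =>
    rw [wickMap_succ, wickMap_succ, hc, ha, ih fun j => x j.succ]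

end IsCARHom

variable (D : FieldData H)

/-- A Wick product creates the corresponding wedge product from the vacuum, as all annihilators
are on the right. -/
lemma repOf_freeWick_vacuum (T : H →ₗ[ℂ] K) (n : ℕ) (x : Fin n → H) :
    CAR.toOp (repOf T (D.freeWick n x)) (vacuum K) =
      ((√(n.factorial : ℝ) : ℝ) : ℂ) • wedge fun i => T (x i) := by
  change CAR.toOp ((repOf T : FreeStar H →ₐ[ℂ] CAR K) (D.freeWick n x)) (vacuum K) = _
  rw [← (isCARHom_repOf T).wickMap_apply]
  induction n with
  | zero =>
    rw [IsCARHom.wickMap_zero, map_one, wedge_zero]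
    simp
  | succ n ih =>
    rw [IsCARHom.wickMap_succ, map_add, map_mul, map_smul, map_mul, add_apply, smul_apply,
      mul_apply_eq_comp, mul_apply_eq_comp, ih]
    change CAR.toOp (repOf T _) _ + _ • CAR.toOp _ (CAR.toOp (repOf T _) _) = _
    rw [repOf_create, repOf_annih, CAR.toOp_annih_vacuum, map_zero, smul_zero, add_zero, map_smul,
      CAR.toOp_create_wedge, smul_smul, Nat.factorial_succ, mul_comm (n + 1), Nat.cast_mul,
      Real.sqrt_mul (Nat.cast_nonneg _), Complex.ofReal_mul, Nat.cast_succ]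
    congr 2
    ext i
    refine Fin.cases ?_ (fun i => ?_) i <;> simp

lemma vacuumState_field_mul_field (f g : H) :
    CAR.vacuumState H (D.field f * D.field g) = ⟪D.J f, g⟫_ℂ := by
  have h1 : D.field f * D.field g = CAR.create f * D.field g +
      (algebraMap ℂ (CAR H) ⟪D.J f, g⟫_ℂ - CAR.create g * CAR.annih (D.J f) +
        CAR.annih (D.J f) * CAR.annih (D.J g)) := by
    rw [← CAR.annih_create]
    simp only [FieldData.field, D.J_apply]
    noncomm_ring
  rw [h1, map_add, map_add, map_sub, vacuumState_create_mul, vacuumState_create_mul,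
    vacuumState_mul_annih, Algebra.algebraMap_eq_smul_one, map_smul, vacuumState_one]
  simp

lemma lift_freeField (f : H) : FreeStar.lift CAR.create (D.freeField f) = D.field f := by
  change repOf LinearMap.id _ = _
  rw [D.freeField_eq, map_add, repOf_create, repOf_annih]
  rfl

lemma lift_freeWick : ∀ (n : ℕ) (x : Fin n → H),
    FreeStar.lift CAR.create (D.freeWick n x) = D.wick n x
  | 0, _ => map_one _
  | 1, x => lift_freeField D (x 0)
  | n + 2, x => by
    rw [D.freeWick_add_two, FieldData.wick, map_sub, map_mul, lift_freeField,
      lift_freeWick (n + 1), map_sum]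
    congr 1
    refine Finset.sum_congr rfl fun i _ => ?_
    rw [map_smul, map_mul, lift_freeWick n, vacuumState_field_mul_field, ← repOf_id, repOf_anticomm,
      ← Algebra.smul_def, smul_smul]
    rfl

lemma freeWick_mem_adjoin : ∀ (n : ℕ) (x : Fin n → H), D.freeWick n x ∈
    Algebra.adjoin ℂ (Set.range D.freeField ∪
      Set.range fun p : H × H => FreeStar.anticomm p.1 p.2)
  | 0, _ => one_mem _
  | 1, x => by
    rw [D.freeWick_one]
    exact Algebra.subset_adjoin (Or.inl ⟨x 0, rfl⟩)
  | n + 2, x => by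
    rw [D.freeWick_add_two]
    refine sub_mem (mul_mem (Algebra.subset_adjoin (Or.inl ⟨x 0, rfl⟩)) (freeWick_mem_adjoin _ _))
      (sum_mem fun i _ => ?_)
    refine Subalgebra.smul_mem _ (mul_mem ?_ (freeWick_mem_adjoin _ _)) _
    exact Algebra.subset_adjoin (Or.inr ⟨(D.J (x 0), x i.succ), rfl⟩)

end Wick

/-! ### Expansion in wedge products of basis vectors -/

section Expansion

/-- An alternating map evaluated on linear combinations of vectors `e k`, in terms of determinants
of the coefficients. -/
lemma alternating_sum_smul {V M κ : Type*} [AddCommGroup V] [Module ℂ V] [AddCommGroup M]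
    [Module ℂ M] [Fintype κ] {n : ℕ} (T : V [⋀^Fin n]→ₗ[ℂ] M) (e : κ → V) (a : Fin n → κ → ℂ) :
    T (fun l => ∑ k, a l k • e k) = ∑ i : Fin n → κ,
      ((n.factorial : ℂ)⁻¹ * (Matrix.of fun k l => a l (i k)).det) • T fun l => e (i l) := by
  classical
  have h1 : T (fun l => ∑ k, a l k • e k) =
      ∑ i : Fin n → κ, (∏ l, a l (i l)) • T fun l => e (i l) := by
    refine (T.toMultilinearMap.map_sum fun l k => a l k • e k).trans ?_
    exact Finset.sum_congr rfl fun i _ => T.toMultilinearMap.map_smul_univ _ _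
  have h2 : ∀ σ : Equiv.Perm (Fin n),
      ∑ i : Fin n → κ, (((Equiv.Perm.sign σ : ℤ) : ℂ) * ∏ l, a l (i (σ l))) • T (fun l => e (i l)) =
      ∑ i : Fin n → κ, (∏ l, a l (i l)) • T fun l => e (i l) := by
    intro σ
    refine Fintype.sum_equiv (Equiv.arrowCongr σ.symm (Equiv.refl κ)) _ _ fun i => ?_
    have h3 := T.map_perm (fun l => e (i l)) σ
    have h4 : (fun l => e ((Equiv.arrowCongr σ.symm (Equiv.refl κ)) i l)) =
        (fun l => e (i l)) ∘ σ := by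
      ext l; simp
    rw [h4, h3, mul_comm, mul_smul]
    congr 1
    rw [Units.smul_def, ← Int.cast_smul_eq_zsmul ℂ]
  have h3 : ∀ i : Fin n → κ, ((n.factorial : ℂ)⁻¹ * (Matrix.of fun k l => a l (i k)).det) •
      T (fun l => e (i l)) = (n.factorial : ℂ)⁻¹ • ∑ σ : Equiv.Perm (Fin n),
        (((Equiv.Perm.sign σ : ℤ) : ℂ) * ∏ l, a l (i (σ l))) • T fun l => e (i l) := by
    intro i
    rw [mul_smul, Matrix.det_apply', Finset.sum_smul]
    rfl
  rw [h1, Finset.sum_congr rfl fun i _ => h3 i, ← Finset.smul_sum, Finset.sum_comm,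
    Finset.sum_congr rfl fun σ _ => h2 σ, Finset.sum_const, Finset.card_univ, Fintype.card_perm,
    Fintype.card_fin, ← Nat.cast_smul_eq_nsmul ℂ, smul_smul, inv_mul_cancel₀, one_smul]
  exact_mod_cast n.factorial_ne_zero

variable {H : Type*} [NormedAddCommGroup H] [InnerProductSpace ℂ H] {κ : Type*} [Fintype κ]
  {e : κ → H} (he : Orthonormal ℂ e)

include he in
/-- The wedge products of the vectors of an orthonormal family are a Parseval frame of their
span: all index tuples occur, which compensates the normalization of the inner product. -/
lemma sum_inner_mul_inner_single (n : ℕ) (i : Fin n → κ) (u : PreFock H) :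
    ∑ j : Fin n → κ, ⟪PreFock.single fun l => e (i l), PreFock.single fun l => e (j l)⟫_ℂ *
        ⟪PreFock.single fun l => e (j l), u⟫_ℂ = ⟪PreFock.single fun l => e (i l), u⟫_ℂ := by
  classical
  induction u using PreFock.induction_on with
  | h0 => simp
  | hadd u w hu hw => simp only [inner_add_right, mul_add, Finset.sum_add_distrib, hu, hw]
  | hsmul c u hu =>
    simp only [inner_smul_right]
    rw [← hu, Finset.mul_sum]
    exact Finset.sum_congr rfl fun j _ => by ring
  | @hs m x =>
  by_cases h : n = m
  · subst h
    have h1 := det_inner_eq_sum n (fun p k => ⟪e k, e (i p)⟫_ℂ) (fun l k => ⟪e k, x l⟫_ℂ)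
    have h2 : (Matrix.of fun p l : Fin n => ∑ k, conj ⟪e k, e (i p)⟫_ℂ * ⟪e k, x l⟫_ℂ) =
        Matrix.of fun p l => ⟪e (i p), x l⟫_ℂ := by
      ext p l
      simp [orthonormal_iff_ite.1 he]
    have hf : (n.factorial : ℂ) ≠ 0 := by exact_mod_cast n.factorial_ne_zero
    have h3 : ∀ j : Fin n → κ,
        ⟪PreFock.single fun l => e (i l), PreFock.single fun l => e (j l)⟫_ℂ *
          ⟪PreFock.single fun l => e (j l), PreFock.single x⟫_ℂ =
        ((n.factorial : ℂ)⁻¹ * (n.factorial : ℂ)⁻¹) *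
        (conj (Matrix.of fun p q => ⟪e (j p), e (i q)⟫_ℂ).det *
          (Matrix.of fun p q => ⟪e (j p), x q⟫_ℂ).det) := by
      intro j
      rw [← inner_conj_symm, PreFock.inner_single, PreFock.inner_single, wedgeKernel_same,
        wedgeKernel_same, map_mul, map_inv₀, Complex.conj_natCast]
      ring
    rw [h2] at h1
    rw [Finset.sum_congr rfl fun j _ => h3 j, ← Finset.mul_sum, h1, PreFock.inner_single,
      wedgeKernel_same]
    field_simp
  · rw [PreFock.inner_single, wedgeKernel_ne h]
    refine Finset.sum_eq_zero fun j _ => ?_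
    rw [PreFock.inner_single _ x, wedgeKernel_ne h, mul_zero]

include he in
/-- The Bessel inequality for wedge products of the vectors of an orthonormal family. -/
lemma sum_norm_inner_single_sq_le (n : ℕ) (u : PreFock H) :
    ∑ i : Fin n → κ, ‖⟪PreFock.single fun l => e (i l), u⟫_ℂ‖ ^ 2 ≤ ‖u‖ ^ 2 := by
  set c : (Fin n → κ) → ℂ := fun i => ⟪PreFock.single fun l => e (i l), u⟫_ℂ with hc
  set v : PreFock H := ∑ j : Fin n → κ, c j • PreFock.single fun l => e (j l) with hv
  set s : ℝ := ∑ i, ‖c i‖ ^ 2 with hs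
  have hs' : (s : ℂ) = ∑ i, conj (c i) * c i := by
    rw [hs, Complex.ofReal_sum]
    exact Finset.sum_congr rfl fun i _ => by rw [Complex.conj_mul', Complex.ofReal_pow]
  have h1 : ⟪v, u⟫_ℂ = s := by
    rw [hv, sum_inner, hs']
    simp only [inner_smul_left, hc]
  have h2 : ⟪v, v⟫_ℂ = s := by
    nth_rw 1 [hv]
    rw [sum_inner, hs']
    refine Finset.sum_congr rfl fun i _ => ?_
    rw [inner_smul_left, hv, inner_sum]
    congr 1
    refine Eq.trans ?_ (sum_inner_mul_inner_single he n i u)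
    refine Finset.sum_congr rfl fun j _ => ?_
    rw [inner_smul_right, mul_comm]
  have h3 : ‖v‖ ^ 2 = s := by
    rw [inner_self_eq_norm_sq_to_K] at h2
    exact Complex.ofReal_injective (by rw [← h2]; push_cast; rfl)
  have h4 : s ≤ ‖v‖ * ‖u‖ := by
    have h5 : ‖(s : ℂ)‖ ≤ ‖v‖ * ‖u‖ := h1 ▸ norm_inner_le_norm v u
    rw [Complex.norm_real] at h5
    exact (le_abs_self s).trans h5
  have h6 : ‖v‖ ≤ ‖u‖ := by
    rcases (norm_nonneg v).eq_or_lt with h | h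
    · rw [← h]; exact norm_nonneg u
    · rw [← h3, sq] at h4
      exact le_of_mul_le_mul_left h4 h
  rw [← h3]
  exact pow_le_pow_left₀ (norm_nonneg v) h6 2

end Expansion

/-! ### Bounds for Wick products in a finite-dimensional CAR algebra -/

section Bounds

lemma sum_sqrt_le {α : Type*} [Fintype α] (g : α → ℝ) (hg : ∀ a, 0 ≤ g a) :
    ∑ a, √(g a) ≤ √(Fintype.card α) * √(∑ a, g a) := by
  have h := Real.sum_sqrt_mul_sqrt_le (s := (Finset.univ : Finset α)) (f := fun _ => (1 : ℝ))
    (g := g) (fun _ => zero_le_one) hg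
  simpa using h

lemma norm_sum_mul_le {α : Type*} [Fintype α] (x y : α → ℂ) :
    ‖∑ a, x a * y a‖ ≤ √(∑ a, ‖x a‖ ^ 2) * √(∑ a, ‖y a‖ ^ 2) := by
  refine (norm_sum_le _ _).trans ?_
  simp only [norm_mul]
  exact Real.sum_mul_le_sqrt_mul_sqrt _ _ _

variable {H : Type*} [NormedAddCommGroup H] [InnerProductSpace ℂ H]

lemma norm_sum_smul_orthonormal {κ : Type*} [Fintype κ] {e : κ → H} (he : Orthonormal ℂ e)
    (c : κ → ℂ) : ‖∑ k, c k • e k‖ = √(∑ k, ‖c k‖ ^ 2) := by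
  rw [@norm_eq_sqrt_re_inner ℂ, he.inner_sum]
  congr 1
  simp only [Complex.conj_mul', map_sum]
  refine Finset.sum_congr rfl fun k _ => ?_
  rw [← Complex.ofReal_pow]
  rfl

lemma CAR.norm_one_le : ‖(1 : CAR H)‖ ≤ 1 := by
  rw [← CAR.norm_toOp, map_one]
  exact ContinuousLinearMap.norm_id_le

/-- The constants in the bounds for Wick products, which are determined by the recursion. -/
def wickConst : ℕ → ℝ
  | 0 => 1
  | 1 => 2
  | n + 2 => 2 * wickConst (n + 1) + (n + 1) * wickConst n

lemma wickConst_nonneg : ∀ n, 0 ≤ wickConst n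
  | 0 => zero_le_one
  | 1 => zero_le_two
  | n + 2 => by
    have h1 := wickConst_nonneg (n + 1)
    have h2 := wickConst_nonneg n
    rw [wickConst]
    positivity

variable [CompleteSpace H] (D : FieldData H) (b : Gr H)

/-- The field in the CAR algebra of the subspace `b`, as a linear map. -/
def repField : H →ₗ[ℂ] CAR b.1 where
  toFun f := rep b (D.freeField f)
  map_add' f g := by
    simp only [D.freeField_eq, map_add]
    abel
  map_smul' c f := by
    simp only [D.freeField_eq, map_add, map_smulₛₗ, smul_add, RingHom.id_apply, Complex.conj_conj]

lemma norm_repField_le (f : H) : ‖repField D b f‖ ≤ 2 * ‖f‖ := by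
  change ‖rep b (D.freeField f)‖ ≤ _
  rw [D.freeField_eq, map_add, rep_eq_repOf, repOf_create, repOf_annih, CAR.annih]
  refine (norm_add_le _ _).trans ?_
  rw [norm_star, two_mul]
  refine add_le_add ((CAR.norm_create_le _).trans ?_) ((CAR.norm_create_le _).trans ?_)
  · exact b.1.norm_orthogonalProjectionOnto_apply_le f
  · refine (b.1.norm_orthogonalProjectionOnto_apply_le _).trans ?_
    rw [D.norm_J]

/-- The covariance of the field in the CAR algebra of `b`. -/
def repCov (f g : H) : ℂ :=
  ⟪b.1.orthogonalProjectionOnto (D.J f), b.1.orthogonalProjectionOnto g⟫_ℂ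

lemma repCov_eq (f g : H) :
    repCov D b f g = ⟪(b.1.orthogonalProjectionOnto (D.J f) : H), g⟫_ℂ :=
  Submodule.inner_orthogonalProjectionOnto_eq_of_mem_left _ _

lemma norm_repCov_le (f g : H) : ‖repCov D b f g‖ ≤ ‖f‖ * ‖g‖ := by
  rw [repCov]
  refine (norm_inner_le_norm _ _).trans ?_
  rw [← D.norm_J f]
  exact mul_le_mul (b.1.norm_orthogonalProjectionOnto_apply_le _)
    (b.1.norm_orthogonalProjectionOnto_apply_le _) (norm_nonneg _) (norm_nonneg _)

lemma sum_norm_repCov_sq_le {κ : Type*} [Fintype κ] {e : κ → H} (he : Orthonormal ℂ e) :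
    ∑ p : κ × κ, ‖repCov D b (e p.1) (e p.2)‖ ^ 2 ≤ Fintype.card κ := by
  rw [Fintype.sum_prod_type]
  calc _ ≤ ∑ _ : κ, (1 : ℝ) := Finset.sum_le_sum fun k _ => ?_
    _ = _ := by simp
  have h1 := he.sum_inner_products_le (s := Finset.univ)
    (b.1.orthogonalProjectionOnto (D.J (e k)) : H)
  have h2 : ‖(b.1.orthogonalProjectionOnto (D.J (e k)) : H)‖ ≤ 1 := by
    refine (b.1.norm_orthogonalProjectionOnto_apply_le _).trans ?_
    rw [D.norm_J, he.1 k]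
  refine le_trans (le_of_eq ?_) (h1.trans (pow_le_one₀ (norm_nonneg _) h2))
  refine Finset.sum_congr rfl fun l _ => ?_
  rw [repCov_eq, norm_inner_symm]

lemma rep_freeWick_add_two (n : ℕ) (x : Fin (n + 2) → H) :
    rep b (D.freeWick (n + 2) x) =
      repField D b (x 0) * rep b (D.freeWick (n + 1) fun j => x j.succ) -
      ∑ i : Fin (n + 1), ((-1 : ℂ) ^ (i : ℕ) * repCov D b (x 0) (x i.succ)) •
        rep b (D.freeWick n fun j => x (i.succAbove j).succ) := by
  rw [D.freeWick_add_two, map_sub, map_mul, map_sum]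
  congr 1
  refine Finset.sum_congr rfl fun i _ => ?_
  rw [map_smul, map_mul, mul_smul, rep_eq_repOf, repOf_anticomm, ← Algebra.smul_def]
  rfl

/-- The bound which ignores the dimension, for arguments in the unit ball. -/
lemma norm_rep_freeWick_le : ∀ (n : ℕ) (x : Fin n → H), (∀ i, ‖x i‖ ≤ 1) →
    ‖rep b (D.freeWick n x)‖ ≤ wickConst n
  | 0, _, _ => by
    rw [D.freeWick_zero, map_one]
    exact CAR.norm_one_le
  | 1, x, hx => by
    refine (norm_repField_le D b (x 0)).trans ?_
    rw [wickConst]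
    linarith [hx 0]
  | n + 2, x, hx => by
    have h1 := norm_rep_freeWick_le (n + 1) (fun j => x j.succ) fun j => hx _
    have h2 := fun i : Fin (n + 1) =>
      norm_rep_freeWick_le n (fun j => x (i.succAbove j).succ) fun j => hx _
    rw [rep_freeWick_add_two, wickConst]
    refine (norm_sub_le _ _).trans (add_le_add ((norm_mul_le _ _).trans ?_)
      ((norm_sum_le _ _).trans ?_))
    · refine mul_le_mul ((norm_repField_le D b (x 0)).trans ?_) h1 (norm_nonneg _) zero_le_two
      linarith [hx 0]
    · calc _ ≤ ∑ i : Fin (n + 1), wickConst n := Finset.sum_le_sum fun i _ => ?_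
        _ = _ := by simp
      rw [norm_smul, norm_mul, norm_pow, norm_neg, norm_one, one_pow, one_mul]
      refine (mul_le_mul ((norm_repCov_le D b _ _).trans
        (mul_le_one₀ (hx 0) (norm_nonneg _) (hx i.succ))) (h2 i) (norm_nonneg _) zero_le_one).trans ?_
      rw [one_mul]

variable {κ : Type*} [Fintype κ] {e : κ → H} (he : Orthonormal ℂ e)

include he in
/-- The bound by the Cauchy-Schwarz inequality over all indices, which also covers degree zero. -/
lemma norm_sum_rep_freeWick_le_crude (n : ℕ) (c : (Fin n → κ) → ℂ) :
    ‖∑ φ, c φ • rep b (D.freeWick n fun l => e (φ l))‖ ≤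
      wickConst n * √((Fintype.card κ : ℝ) ^ n) * √(∑ φ, ‖c φ‖ ^ 2) := by
  calc _ ≤ ∑ φ, ‖c φ • rep b (D.freeWick n fun l => e (φ l))‖ := norm_sum_le _ _
    _ ≤ ∑ φ, wickConst n * √(‖c φ‖ ^ 2) := Finset.sum_le_sum fun φ _ => by
      rw [norm_smul, mul_comm, Real.sqrt_sq (norm_nonneg _)]
      exact mul_le_mul_of_nonneg_right
        (norm_rep_freeWick_le D b n _ fun l => (he.1 _).le) (norm_nonneg _)
    _ ≤ _ := by
      rw [← Finset.mul_sum, mul_assoc]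
      refine mul_le_mul_of_nonneg_left ((sum_sqrt_le _ fun _ => by positivity).trans ?_)
        (wickConst_nonneg n)
      simp

include he in
/-- The bound for Wick polynomials with coefficients in an orthonormal family. Compared to the
Cauchy-Schwarz inequality over all indices, one index is summed before taking norms, because
`‖Ψ(f)‖ ≤ 2 ‖f‖`, and a pair of indices is contracted with the covariance, whose Hilbert-Schmidt
norm is at most the square root of the dimension. -/
lemma norm_sum_rep_freeWick_le (n : ℕ) (c : (Fin (n + 1) → κ) → ℂ) :
    ‖∑ φ, c φ • rep b (D.freeWick (n + 1) fun l => e (φ l))‖ ≤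
      wickConst (n + 1) * √((Fintype.card κ : ℝ) ^ n) * √(∑ φ, ‖c φ‖ ^ 2) := by
  -- A bound for the sum over one index of a product of the field with a factor independent of that index.
  have field_bound : ∀ (m : ℕ) (c : (Fin (m + 1) → κ) → ℂ) (X : (Fin m → κ) → CAR b.1) (M : ℝ),
      (∀ ψ, ‖X ψ‖ ≤ M) → ‖∑ φ, c φ • (repField D b (e (φ 0)) * X fun j => φ j.succ)‖ ≤
        2 * M * √((Fintype.card κ : ℝ) ^ m) * √(∑ φ, ‖c φ‖ ^ 2) := by
    intro m c X M hX
    have hM : 0 ≤ 2 * M ∨ IsEmpty (Fin m → κ) := by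
      rcases isEmpty_or_nonempty (Fin m → κ) with h | ⟨⟨ψ⟩⟩
      · exact Or.inr h
      · exact Or.inl (mul_nonneg zero_le_two ((norm_nonneg _).trans (hX ψ)))
    have h1 : ∑ φ, c φ • (repField D b (e (φ 0)) * X fun j => φ j.succ) =
        ∑ ψ : Fin m → κ, repField D b (∑ p, c (Fin.cons p ψ) • e p) * X ψ := by
      rw [← (Fin.consEquiv fun _ => κ).sum_comp, Fintype.sum_prod_type_right]
      refine Finset.sum_congr rfl fun ψ _ => ?_
      rw [map_sum, Finset.sum_mul]
      refine Finset.sum_congr rfl fun p _ => ?_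
      rw [map_smul, smul_mul_assoc]
      simp [Fin.consEquiv]
    have h2 : ∑ φ, ‖c φ‖ ^ 2 = ∑ ψ : Fin m → κ, ∑ p, ‖c (Fin.cons p ψ)‖ ^ 2 := by
      rw [← (Fin.consEquiv fun _ => κ).sum_comp, Fintype.sum_prod_type_right]
      rfl
    rw [h1, h2]
    calc _ ≤ ∑ ψ : Fin m → κ, 2 * M * √(∑ p, ‖c (Fin.cons p ψ)‖ ^ 2) :=
          norm_sum_le_of_le _ fun ψ _ => by
            refine (norm_mul_le _ _).trans ?_
            refine (mul_le_mul (norm_repField_le D b _) (hX ψ) (norm_nonneg _)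
              (by positivity)).trans (le_of_eq ?_)
            rw [norm_sum_smul_orthonormal he]
            ring
      _ ≤ _ := by
        rw [← Finset.mul_sum, mul_assoc (2 * M)]
        rcases hM with hM | hM
        · refine mul_le_mul_of_nonneg_left
            ((sum_sqrt_le (fun ψ : Fin m → κ => ∑ p, ‖c (Fin.cons p ψ)‖ ^ 2)
              fun _ => by positivity).trans ?_) hM
          simp
        · simp
  match n with
  | 0 =>
    have h := field_bound 0 c (fun _ => 1) 1 fun _ => CAR.norm_one_le
    simp only [mul_one] at h
    exact h
  | n + 1 =>
    simp only [rep_freeWick_add_two, smul_sub, Finset.sum_sub_distrib]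
    have h1 := field_bound (n + 1) c (fun ψ => rep b (D.freeWick (n + 1) fun l => e (ψ l)))
      (wickConst (n + 1)) fun ψ => norm_rep_freeWick_le D b _ _ fun l => (he.1 _).le
    have h2 : ∀ i : Fin (n + 1), ‖∑ φ : Fin (n + 2) → κ, c φ •
        (((-1 : ℂ) ^ (i : ℕ) * repCov D b (e (φ 0)) (e (φ i.succ))) •
          rep b (D.freeWick n fun j => e (φ (i.succAbove j).succ)))‖ ≤
        wickConst n * √((Fintype.card κ : ℝ) ^ (n + 1)) * √(∑ φ, ‖c φ‖ ^ 2) := by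
      intro i
      -- The index `φ` consists of the two contracted indices and the remaining ones.
      let E : (κ × κ) × (Fin n → κ) ≃ (Fin (n + 2) → κ) :=
        (Equiv.prodAssoc κ κ (Fin n → κ)).trans
          (((Equiv.refl κ).prodCongr (Fin.insertNthEquiv (fun _ => κ) i)).trans
            (Fin.consEquiv fun _ => κ))
      have hE0 : ∀ p ψ, E (p, ψ) 0 = p.1 := fun p ψ => rfl
      have hE1 : ∀ p ψ, E (p, ψ) i.succ = p.2 := fun p ψ => by
        simp [E, Fin.consEquiv]
      have hE2 : ∀ p ψ j, E (p, ψ) (i.succAbove j).succ = ψ j := fun p ψ j => by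
        simp [E, Fin.consEquiv]
      have h3 : ∑ φ : Fin (n + 2) → κ, c φ •
          (((-1 : ℂ) ^ (i : ℕ) * repCov D b (e (φ 0)) (e (φ i.succ))) •
            rep b (D.freeWick n fun j => e (φ (i.succAbove j).succ))) =
          ∑ ψ : Fin n → κ, ((-1 : ℂ) ^ (i : ℕ) * ∑ p : κ × κ, c (E (p, ψ)) *
            repCov D b (e p.1) (e p.2)) • rep b (D.freeWick n fun j => e (ψ j)) := by
        rw [← E.sum_comp, Fintype.sum_prod_type_right]
        refine Finset.sum_congr rfl fun ψ _ => ?_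
        rw [Finset.mul_sum, Finset.sum_smul]
        refine Finset.sum_congr rfl fun p _ => ?_
        simp only [hE0, hE1, hE2, smul_smul]
        congr 1
        ring
      have h4 : ∑ φ, ‖c φ‖ ^ 2 = ∑ ψ : Fin n → κ, ∑ p, ‖c (E (p, ψ))‖ ^ 2 := by
        rw [← E.sum_comp, Fintype.sum_prod_type_right]
      rw [h3, h4]
      calc _ ≤ ∑ ψ : Fin n → κ, wickConst n * √(Fintype.card κ) *
            √(∑ p, ‖c (E (p, ψ))‖ ^ 2) :=
            norm_sum_le_of_le _ fun ψ _ => by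
              rw [norm_smul, norm_mul, norm_pow, norm_neg, norm_one, one_pow, one_mul]
              have h5 := norm_sum_mul_le (fun p => c (E (p, ψ)))
                fun p : κ × κ => repCov D b (e p.1) (e p.2)
              have h6 := Real.sqrt_le_sqrt (sum_norm_repCov_sq_le D b he)
              have h7 := norm_rep_freeWick_le D b n (fun j => e (ψ j)) fun l => (he.1 _).le
              refine (mul_le_mul (h5.trans (mul_le_mul_of_nonneg_left h6 (Real.sqrt_nonneg _))) h7
                (norm_nonneg _) (mul_nonneg (Real.sqrt_nonneg _) (Real.sqrt_nonneg _))).trans (le_of_eq ?_)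
              ring
        _ ≤ _ := by
          rw [← Finset.mul_sum, mul_assoc, mul_assoc]
          refine mul_le_mul_of_nonneg_left ?_ (wickConst_nonneg n)
          refine (mul_le_mul_of_nonneg_left (sum_sqrt_le _ fun _ => by positivity)
            (Real.sqrt_nonneg _)).trans (le_of_eq ?_)
          rw [← mul_assoc, ← Real.sqrt_mul (Nat.cast_nonneg _), pow_succ']
          simp
    refine (norm_sub_le _ _).trans ?_
    rw [wickConst, add_mul, add_mul]
    refine add_le_add h1 ?_
    simp only [Finset.smul_sum]
    rw [Finset.sum_comm]
    refine (norm_sum_le_of_le _ fun i _ => h2 i).trans (le_of_eq ?_)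
    simp
    ring

end Bounds

/-! ### Wick polynomials as functions on the Fock space -/

section Carrier

variable {H : Type*} [NormedAddCommGroup H] [InnerProductSpace ℂ H]

lemma proj_eq_of_sub_mem_orthogonal (b : Gr H) {f g : H} (h : ∀ k ∈ b.1, ⟪k, f - g⟫_ℂ = 0) :
    b.1.orthogonalProjectionOnto f = b.1.orthogonalProjectionOnto g := by
  rw [← sub_eq_zero, ← map_sub, Submodule.orthogonalProjectionOnto_eq_zero_iff]
  exact (Submodule.mem_orthogonal _ _).2 h

variable [CompleteSpace H] (D : FieldData H) (b : Gr H)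

/-- A subspace which carries the fields in the CAR algebra of `b`. -/
lemma exists_carrier : ∃ E : Gr H, b.1 ≤ E.1 ∧ (∀ f ∈ b.1, D.J f ∈ E.1) ∧
    Module.finrank ℂ E.1 ≤ 2 * Module.finrank ℂ b.1 := by
  let e := Module.finBasis ℂ b.1
  let v : Fin (Module.finrank ℂ b.1) ⊕ Fin (Module.finrank ℂ b.1) → H :=
    Sum.elim (fun i => (e i : H)) fun i => D.J (e i)
  refine ⟨⟨Submodule.span ℂ (Set.range v), FiniteDimensional.span_of_finite ℂ (Set.finite_range v)⟩,
    fun f hf => ?_, fun f hf => ?_, ?_⟩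
  · have h := congrArg Subtype.val (e.sum_repr ⟨f, hf⟩)
    rw [Submodule.coe_sum] at h
    change _ = f at h
    rw [← h]
    exact sum_mem fun i _ => Submodule.smul_mem _ _ (Submodule.subset_span ⟨Sum.inl i, rfl⟩)
  · have h := congrArg Subtype.val (e.sum_repr ⟨f, hf⟩)
    rw [Submodule.coe_sum] at h
    change _ = f at h
    rw [← h, map_sum]
    refine sum_mem fun i _ => ?_
    rw [Submodule.coe_smul, map_smulₛₗ]
    exact Submodule.smul_mem _ _ (Submodule.subset_span ⟨Sum.inr i, rfl⟩)
  · refine (finrank_range_le_card v).trans ?_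
    rw [Fintype.card_sum, Fintype.card_fin, two_mul]

variable {D b} {E : Gr H} (h1 : b.1 ≤ E.1) (h2 : ∀ f ∈ b.1, D.J f ∈ E.1)

include h1 h2 in
/-- Wick products in the CAR algebra of `b` only depend on the projections of their arguments to a
carrier `E` of the fields. -/
lemma rep_freeWick_proj (n : ℕ) (x : Fin n → H) :
    rep b (D.freeWick n fun i => (E.1.orthogonalProjectionOnto (x i) : H)) =
      rep b (D.freeWick n x) := by
  have horth : ∀ (f k : H), k ∈ E.1 → ⟪k, (E.1.orthogonalProjectionOnto f : H) - f⟫_ℂ = 0 := by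
    intro f k hk
    have := E.1.sub_starProjection_mem_orthogonal f
    have h3 := (Submodule.mem_orthogonal _ _).1 this k hk
    rw [← neg_sub, inner_neg_right, neg_eq_zero]
    exact h3
  refine (isCARHom_repOf _).freeWick_congr D (Q := fun f => (E.1.orthogonalProjectionOnto f : H))
    (fun f => ?_) (fun f => ?_) n x
  · change repOf _ _ = repOf _ _
    rw [repOf_create, repOf_create]
    exact congrArg _ (proj_eq_of_sub_mem_orthogonal b fun k hk => horth f k (h1 hk))
  · change repOf _ _ = repOf _ _
    rw [repOf_annih, repOf_annih]
    refine congrArg _ (proj_eq_of_sub_mem_orthogonal b fun k hk => ?_)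
    rw [← map_sub, ← inner_conj_symm, D.inner_J_left, horth f _ (h2 k hk), neg_zero, map_zero]

variable (D b) in
/-- Wick products of degree larger than `2 dim b` vanish in the CAR algebra of `b`, because they are
alternating and factor through a subspace of dimension at most `2 dim b`. -/
lemma rep_freeWick_eq_zero {n : ℕ} (hn : 2 * Module.finrank ℂ b.1 < n) (x : Fin n → H) :
    rep b (D.freeWick n x) = 0 := by
  obtain ⟨E, h1, h2, h3⟩ := exists_carrier D b
  rw [← rep_freeWick_proj h1 h2]
  refine ((isCARHom_repOf (b.1.orthogonalProjectionOnto : H →ₗ[ℂ] b.1)).wickMap_apply D n _).symm.trans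
    (AlternatingMap.map_linearDependent
      (((isCARHom_repOf (b.1.orthogonalProjectionOnto : H →ₗ[ℂ] b.1)).wickMap D n).compLinearMap
        E.1.subtype) (fun i => E.1.orthogonalProjectionOnto (x i)) fun hli => ?_)
  have := hli.fintype_card_le_finrank
  rw [Fintype.card_fin] at this
  omega

end Carrier

section WickDegree

variable {H : Type*} [NormedAddCommGroup H] [InnerProductSpace ℂ H] [CompleteSpace H]
  (D : FieldData H)

/-- The linear map `x₁ ∧ ⋯ ∧ xₙ ↦ 𝚿^{⋄n}(x₁ ∧ ⋯ ∧ xₙ)`, extended by zero to other degrees. -/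
def wickDegree (n : ℕ) : PreFock H →ₗ[ℂ] FreeStar H :=
  PreFock.lift fun m x => if m = n then D.freeWick m x else 0

lemma wickDegree_single (n : ℕ) (x : Fin n → H) :
    wickDegree D n (PreFock.single x) = D.freeWick n x := by
  simp [wickDegree]

lemma wickDegree_single_ne {n m : ℕ} (h : m ≠ n) (x : Fin m → H) :
    wickDegree D n (PreFock.single x) = 0 := by
  simp [wickDegree, h]

variable (b : Gr H)

/-- The expansion of a Wick polynomial in wedge products of basis vectors of a carrier. -/
lemma rep_wickDegree_eq_sum {E : Gr H} (h1 : b.1 ≤ E.1) (h2 : ∀ f ∈ b.1, D.J f ∈ E.1)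
    {κ : Type*} [Fintype κ] (e : OrthonormalBasis κ ℂ E.1) (n : ℕ) (u : PreFock H) :
    rep b (wickDegree D n u) = ∑ i : Fin n → κ,
      ⟪PreFock.single fun l => (e (i l) : H), u⟫_ℂ • rep b (D.freeWick n fun l => (e (i l) : H)) := by
  induction u using PreFock.induction_on with
  | h0 => simp
  | hadd u w hu hw =>
    simp only [inner_add_right, add_smul, Finset.sum_add_distrib, map_add, hu, hw]
  | hsmul c u hu => simp only [inner_smul_right, mul_smul, ← Finset.smul_sum, map_smul, hu]
  | @hs m x =>
  by_cases h : m = n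
  · subst h
    have h3 : ∀ f : H, (E.1.orthogonalProjectionOnto f : H) = ∑ k, ⟪(e k : H), f⟫_ℂ • (e k : H) := by
      intro f
      have h4 := congrArg Subtype.val (e.sum_repr' (E.1.orthogonalProjectionOnto f))
      rw [Submodule.coe_sum] at h4
      rw [← h4]
      refine Finset.sum_congr rfl fun k _ => ?_
      rw [Submodule.coe_smul]
      congr 1
      exact (Submodule.inner_orthogonalProjectionOnto_eq_of_mem_left (e k) f)
    have h5 := alternating_sum_smul
      ((isCARHom_repOf (b.1.orthogonalProjectionOnto : H →ₗ[ℂ] b.1)).wickMap D m)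
      (fun k => (e k : H)) fun l k => ⟪(e k : H), x l⟫_ℂ
    simp only [IsCARHom.wickMap_apply] at h5
    rw [wickDegree_single, ← rep_freeWick_proj h1 h2]
    simp only [h3]
    refine h5.trans (Finset.sum_congr rfl fun i _ => ?_)
    rw [PreFock.inner_single, wedgeKernel_same]
    rfl
  · rw [wickDegree_single_ne D h, map_zero]
    symm
    refine Finset.sum_eq_zero fun i _ => ?_
    rw [PreFock.inner_single, wedgeKernel_ne (Ne.symm h), zero_smul]

/-- Bounds for sums over an orthonormal family become bounds in terms of the norm of the Fock space,
by the Bessel inequality. -/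
lemma norm_rep_wickDegree_le_of_sum {n : ℕ} {M r : ℝ} (hM : 0 ≤ M) (k : ℕ)
    (hr : 2 * (Module.finrank ℂ b.1 : ℝ) ≤ r)
    (h : ∀ {κ : Type} [Fintype κ] {e : κ → H}, Orthonormal ℂ e → ∀ c : (Fin n → κ) → ℂ,
      ‖∑ φ, c φ • rep b (D.freeWick n fun l => e (φ l))‖ ≤
        M * √((Fintype.card κ : ℝ) ^ k) * √(∑ φ, ‖c φ‖ ^ 2)) (u : PreFock H) :
    ‖rep b (wickDegree D n u)‖ ≤ M * √(r ^ k) * ‖u‖ := by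
  obtain ⟨E, h1, h2, h3⟩ := exists_carrier D b
  let e := stdOrthonormalBasis ℂ E.1
  have he : Orthonormal ℂ fun k => (e k : H) := e.orthonormal.comp_linearIsometry E.1.subtypeₗᵢ
  rw [rep_wickDegree_eq_sum D b h1 h2 e]
  refine (h he _).trans ?_
  have h4 : √(∑ i : Fin n → _, ‖⟪PreFock.single fun l => (e (i l) : H), u⟫_ℂ‖ ^ 2) ≤ ‖u‖ :=
    Real.sqrt_le_iff.2 ⟨norm_nonneg _, sum_norm_inner_single_sq_le he n u⟩
  have h5 : (Fintype.card (Fin (Module.finrank ℂ E.1)) : ℝ) ≤ r := by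
    rw [Fintype.card_fin]
    refine le_trans ?_ hr
    exact_mod_cast h3
  gcongr

lemma norm_rep_wickDegree_le_crude (n : ℕ) {r : ℝ} (hr : 2 * (Module.finrank ℂ b.1 : ℝ) ≤ r)
    (u : PreFock H) : ‖rep b (wickDegree D n u)‖ ≤ wickConst n * √(r ^ n) * ‖u‖ :=
  norm_rep_wickDegree_le_of_sum D b (wickConst_nonneg n) n hr
    (fun he c => norm_sum_rep_freeWick_le_crude D b he n c) u

lemma norm_rep_wickDegree_le (n : ℕ) (hn : 1 ≤ n) (u : PreFock H) :
    ‖rep b (wickDegree D n u)‖ ≤ wickConst n * √(2 ^ (n - 1)) *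
      (1 + (Module.finrank ℂ b.1 : ℝ)) ^ (((n : ℝ) - 1) / 2) * ‖u‖ := by
  obtain ⟨n, rfl⟩ := Nat.exists_eq_add_of_le' hn
  refine (norm_rep_wickDegree_le_of_sum D b (wickConst_nonneg (n + 1)) n
    (r := 2 * (1 + (Module.finrank ℂ b.1 : ℝ))) (by linarith)
    (fun he c => norm_sum_rep_freeWick_le D b he n c) u).trans (le_of_eq ?_)
  have h0 : (0 : ℝ) ≤ 1 + Module.finrank ℂ b.1 := by positivity
  rw [mul_pow, Real.sqrt_mul (by positivity), Nat.add_sub_cancel, Nat.cast_succ,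
    add_sub_cancel_right, Real.sqrt_eq_rpow ((1 + (Module.finrank ℂ b.1 : ℝ)) ^ n),
    ← Real.rpow_natCast (1 + (Module.finrank ℂ b.1 : ℝ)), ← Real.rpow_mul h0, mul_one_div]
  ring

/-- The sum of all degrees of the Wick products, normalized so that the resulting Wick polynomial
maps the vacuum to the given vector of the Fock space. -/
def wickTotal : PreFock H →ₗ[ℂ] FreeStar H :=
  PreFock.lift fun n x => ((√(n.factorial : ℝ) : ℝ) : ℂ)⁻¹ • D.freeWick n x

lemma wickTotal_single {n : ℕ} (x : Fin n → H) :
    wickTotal D (PreFock.single x) = ((√(n.factorial : ℝ) : ℝ) : ℂ)⁻¹ • D.freeWick n x := by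
  simp [wickTotal]

lemma sqrt_factorial_ne (n : ℕ) : ((√(n.factorial : ℝ) : ℝ) : ℂ) ≠ 0 := by
  rw [Complex.ofReal_ne_zero]
  have := n.factorial_pos
  positivity

lemma lift_wickTotal_vacuum (u : PreFock H) :
    CAR.toOp (FreeStar.lift CAR.create (wickTotal D u)) (vacuum H) = (u : Fock H) := by
  induction u using PreFock.induction_on with
  | h0 => rw [map_zero, map_zero, map_zero, Completion.coe_zero]; rfl
  | hadd u w hu hw => rw [map_add, map_add, map_add, add_apply, hu, hw, Completion.coe_add]
  | hsmul c u hu => rw [map_smul, map_smul, map_smul, smul_apply, hu, Completion.coe_smul]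
  | @hs n x =>
    rw [wickTotal_single, map_smul, map_smul, smul_apply, ← repOf_id, repOf_freeWick_vacuum,
      smul_smul, inv_mul_cancel₀ (sqrt_factorial_ne n), one_smul]
    rfl

/-- Only degrees up to `2 dim b` contribute in the CAR algebra of `b`. -/
lemma rep_wickTotal_eq_sum {d : ℕ} (hd : Module.finrank ℂ b.1 ≤ d) (u : PreFock H) :
    rep b (wickTotal D u) = ∑ n ∈ Finset.range (2 * d + 1),
      ((√(n.factorial : ℝ) : ℝ) : ℂ)⁻¹ • rep b (wickDegree D n u) := by
  induction u using PreFock.induction_on with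
  | h0 => simp
  | hadd u w hu hw => simp only [map_add, hu, hw, smul_add, Finset.sum_add_distrib]
  | hsmul c u hu =>
    simp only [map_smul, hu, Finset.smul_sum]
    exact Finset.sum_congr rfl fun n _ => smul_comm _ _ _
  | @hs m x =>
    rw [wickTotal_single, map_smul]
    by_cases hm : m ∈ Finset.range (2 * d + 1)
    · rw [Finset.sum_eq_single_of_mem m hm fun n _ hn => by
        rw [wickDegree_single_ne D (Ne.symm hn), map_zero, smul_zero], wickDegree_single]
    · rw [rep_freeWick_eq_zero D b (by rw [Finset.mem_range] at hm; omega), smul_zero]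
      symm
      refine Finset.sum_eq_zero fun n hn => ?_
      rw [wickDegree_single_ne D (fun h : m = n => hm (by rwa [h])), map_zero, smul_zero]

lemma exists_bound_wickTotal (d : ℕ) : ∃ M : ℝ, 0 ≤ M ∧ ∀ b : Gr H, Module.finrank ℂ b.1 ≤ d →
    ∀ u : PreFock H, ‖rep b (wickTotal D u)‖ ≤ M * ‖u‖ := by
  refine ⟨∑ n ∈ Finset.range (2 * d + 1), ‖((√(n.factorial : ℝ) : ℝ) : ℂ)⁻¹‖ *
    (wickConst n * √((2 * (d : ℝ)) ^ n)), Finset.sum_nonneg fun n _ => ?_, fun b hb u => ?_⟩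
  · have := wickConst_nonneg n
    positivity
  · rw [rep_wickTotal_eq_sum D b hb, Finset.sum_mul]
    refine norm_sum_le_of_le _ fun n _ => ?_
    rw [norm_smul, mul_assoc]
    refine mul_le_mul_of_nonneg_left (norm_rep_wickDegree_le_crude D b n ?_ u) (norm_nonneg _)
    gcongr

lemma exists_bound_wickDegree (n d : ℕ) : ∃ M : ℝ, 0 ≤ M ∧ ∀ b : Gr H,
    Module.finrank ℂ b.1 ≤ d → ∀ u : PreFock H, ‖rep b (wickDegree D n u)‖ ≤ M * ‖u‖ := by
  refine ⟨wickConst n * √((2 * (d : ℝ)) ^ n),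
    mul_nonneg (wickConst_nonneg n) (Real.sqrt_nonneg _), fun b hb u => ?_⟩
  exact norm_rep_wickDegree_le_crude D b n (by gcongr) u

/-- In the CAR algebra, polynomials in the fields are linear combinations of Wick products. -/
lemma exists_wickTotal_eq {P : CAR H} (hP : P ∈ Algebra.adjoin ℂ (Set.range D.field)) :
    ∃ u : PreFock H, FreeStar.lift CAR.create (wickTotal D u) = P := by
  let R : Submodule ℂ (CAR H) := LinearMap.range
    (((FreeStar.lift CAR.create : FreeStar H →⋆ₐ[ℂ] CAR H) :
      FreeStar H →ₐ[ℂ] CAR H).toLinearMap ∘ₗ wickTotal D)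
  have hwick : ∀ (n : ℕ) (x : Fin n → H), D.wick n x ∈ R := by
    intro n x
    refine ⟨((√(n.factorial : ℝ) : ℝ) : ℂ) • PreFock.single x, ?_⟩
    change FreeStar.lift CAR.create (wickTotal D _) = _
    rw [map_smul, wickTotal_single, smul_smul, mul_inv_cancel₀ (sqrt_factorial_ne n), one_smul,
      lift_freeWick]
  -- The range is stable under multiplication by a field, by the recursion.
  have hfield : ∀ (f : H) (n : ℕ) (x : Fin n → H), D.field f * D.wick n x ∈ R := by
    intro f n x
    cases n with
    | zero =>
      have h := hwick 1 fun _ => f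
      change D.field f * 1 ∈ R
      rw [mul_one]
      exact h
    | succ n =>
      have h := hwick (n + 2) (Fin.cons f x)
      rw [FieldData.wick] at h
      have h2 := R.add_mem h (R.sum_mem (t := Finset.univ) fun (i : Fin (n + 1)) _ => R.smul_mem ((-1 : ℂ) ^ (i : ℕ) *
          CAR.vacuumState H (D.field f * D.field (x i))) (hwick n fun j => x (i.succAbove j)))
      simpa using h2
  have hmul : ∀ X ∈ R, P * X ∈ R := by
    induction hP using Algebra.adjoin_induction with
    | mem y hy =>
      obtain ⟨f, rfl⟩ := hy
      rintro _ ⟨u, rfl⟩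
      change _ * FreeStar.lift CAR.create (wickTotal D u) ∈ R
      induction u using PreFock.induction_on with
      | h0 => simp
      | hadd u w hu hw => rw [map_add, map_add, mul_add]; exact R.add_mem hu hw
      | hsmul c u hu => rw [map_smul, map_smul, mul_smul_comm]; exact R.smul_mem _ hu
      | hs x =>
        rw [wickTotal_single, map_smul, mul_smul_comm, lift_freeWick]
        exact R.smul_mem _ (hfield f _ x)
    | algebraMap r =>
      intro X hX
      rw [← Algebra.smul_def]
      exact R.smul_mem _ hX
    | add y z _ _ hy hz =>
      intro X hX
      rw [add_mul]
      exact R.add_mem (hy X hX) (hz X hX)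
    | mul y z _ _ hy hz =>
      intro X hX
      rw [mul_assoc]
      exact hy _ (hz X hX)
  have h := hmul 1 (hwick 0 Fin.elim0)
  rw [mul_one] at h
  exact h

lemma wickTotal_mem_adjoin (u : PreFock H) : wickTotal D u ∈
    Algebra.adjoin ℂ (Set.range D.freeField ∪
      Set.range fun p : H × H => FreeStar.anticomm p.1 p.2) := by
  induction u using PreFock.induction_on with
  | h0 => rw [map_zero]; exact zero_mem _
  | hadd u w hu hw => rw [map_add]; exact add_mem hu hw
  | hsmul c u hu => rw [map_smul]; exact Subalgebra.smul_mem _ hu _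
  | hs x =>
    rw [wickTotal_single]
    exact Subalgebra.smul_mem _ (freeWick_mem_adjoin D _ x) _

end WickDegree

/-! ### Extension to the Fock space -/

section Extension

open Filter Topology

variable {H : Type*} [NormedAddCommGroup H] [InnerProductSpace ℂ H]

/-- The inclusion of `PreFock H` in its completion. -/
def toFock : PreFock H →L[ℂ] Fock H := Completion.toComplL

lemma denseRange_toFock : DenseRange (toFock (H := H)) := Completion.denseRange_coe

lemma isUniformInducing_toFock : IsUniformInducing (toFock (H := H)) :=
  Completion.isUniformInducing_coe _

/-- `IsRepBounded G` means that `π_b ∘ G` is bounded, uniformly for all subspaces `b` of bounded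
dimension. -/
def IsRepBounded (G : PreFock H →ₗ[ℂ] FreeStar H) : Prop :=
  ∀ d : ℕ, ∃ M : ℝ, 0 ≤ M ∧ ∀ b : Gr H, Module.finrank ℂ b.1 ≤ d →
    ∀ u : PreFock H, ‖rep b (G u)‖ ≤ M * ‖u‖

variable {G : PreFock H →ₗ[ℂ] FreeStar H} (hG : IsRepBounded G)

/-- The extension of `π_b ∘ G` to the Fock space. -/
def repExtend (G : PreFock H →ₗ[ℂ] FreeStar H) (b : Gr H) : Fock H →L[ℂ] CAR b.1 :=
  ((rep b : FreeStar H →ₐ[ℂ] CAR b.1).toLinearMap ∘ₗ G).extendOfNorm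
    (toFock (H := H)).toLinearMap

include hG in
lemma repExtend_coe (b : Gr H) (u : PreFock H) : repExtend G b (u : Fock H) = rep b (G u) := by
  obtain ⟨M, -, hM⟩ := hG (Module.finrank ℂ b.1)
  exact LinearMap.extendOfNorm_eq (e := (toFock (H := H)).toLinearMap) denseRange_toFock
    ⟨M, fun u => (hM b le_rfl u).trans_eq (by rw [← Completion.norm_coe u]; rfl)⟩ u

include hG in
lemma norm_repExtend_le (b : Gr H) {M : ℝ} (hM : ∀ u, ‖rep b (G u)‖ ≤ M * ‖u‖) (v : Fock H) :
    ‖repExtend G b v‖ ≤ M * ‖v‖ := by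
  induction v using Fock.coe_induction with
  | hp => exact isClosed_le (by fun_prop) (by fun_prop)
  | h u =>
    rw [repExtend_coe hG, Completion.norm_coe]
    exact hM u

variable {Γ : Set (Gr H)} (𝓕 : Filtration Γ)

/-- The map `G`, with values in the extended CAR algebra. -/
def extLin (G : PreFock H →ₗ[ℂ] FreeStar H) : PreFock H →ₗ[ℂ] ExtCAR 𝓕 :=
  ((AInf.incl 𝓕).comp (AInf.ofFree 𝓕) : FreeStar H →ₐ[ℂ] ExtCAR 𝓕).toLinearMap ∘ₗ G

lemma seminorm_incl_ofFree_le {m : ℕ} {x : FreeStar H} {M : ℝ} (hM : 0 ≤ M)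
    (h : ∀ b ∈ 𝓕.level m, ‖rep b x‖ ≤ M) :
    ExtCAR.seminorm 𝓕 m (AInf.incl 𝓕 (AInf.ofFree 𝓕 x)) ≤ M := by
  rw [AInf.incl_ofFree, ExtCAR.seminorm_coe]
  exact Real.iSup_le (fun b => h b.1 b.2) hM

include hG in
lemma continuous_extLin : Continuous (extLin 𝓕 G) := by
  refine WithSeminorms.continuous_of_isBounded (norm_withSeminorms ℂ (PreFock H))
    (ExtCAR.withSeminorms 𝓕) (extLin 𝓕 G) ?_
  intro m
  obtain ⟨d, hd⟩ := 𝓕.dim_bounded m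
  obtain ⟨M, hM0, hM⟩ := hG d
  refine ⟨{0}, ⟨M, hM0⟩, fun u => ?_⟩
  have h := seminorm_incl_ofFree_le 𝓕 (m := m) (x := G u) (M := M * ‖u‖) (by positivity)
    fun b hb => hM b (hd b hb) u
  rw [Finset.sup_singleton]
  exact h

/-- The extension of `G` to a continuous linear map from the Fock space to the extended CAR
algebra. -/
def extCLM : Fock H →L[ℂ] ExtCAR 𝓕 :=
  (⟨extLin 𝓕 G, continuous_extLin hG 𝓕⟩ : PreFock H →L[ℂ] ExtCAR 𝓕).extend toFock

lemma extCLM_coe (u : PreFock H) :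
    extCLM hG 𝓕 (u : Fock H) = AInf.incl 𝓕 (AInf.ofFree 𝓕 (G u)) :=
  ContinuousLinearMap.extend_eq _ denseRange_toFock isUniformInducing_toFock u

lemma continuous_rep (b : 𝓕.points) : Continuous (ExtCAR.rep 𝓕 b) :=
  Completion.continuous_extension

lemma rep_extCLM (b : 𝓕.points) (v : Fock H) :
    ExtCAR.rep 𝓕 b (extCLM hG 𝓕 v) = repExtend G b.1 v := by
  induction v using Fock.coe_induction with
  | hp => exact isClosed_eq ((continuous_rep 𝓕 b).comp (extCLM hG 𝓕).continuous) (by fun_prop)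
  | h u =>
    rw [extCLM_coe, AInf.incl_ofFree, ExtCAR.rep_coe, repExtend_coe hG]
    rfl

lemma norm_rep_le_seminorm (b : 𝓕.points) {m : ℕ} (hb : b.1 ∈ 𝓕.level m) (a : ExtCAR 𝓕) :
    ‖ExtCAR.rep 𝓕 b a‖ ≤ ExtCAR.seminorm 𝓕 m a := by
  induction a using Completion.induction_on with
  | hp => exact isClosed_le (continuous_rep 𝓕 b).norm (ExtCAR.continuous_seminorm 𝓕 m)
  | ih x =>
    rw [ExtCAR.rep_coe, ExtCAR.seminorm_coe]
    exact HatAlg.le_seminormFun 𝓕 m x ⟨b.1, hb⟩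

end Extension

section WickExtension

open Filter Topology

variable {H : Type*} [NormedAddCommGroup H] [InnerProductSpace ℂ H] [CompleteSpace H]
  (D : FieldData H) {Γ : Set (Gr H)} (𝓕 : Filtration Γ)

lemma isRepBounded_wickDegree (n : ℕ) : IsRepBounded (wickDegree D n) :=
  fun d => exists_bound_wickDegree D n d

lemma isRepBounded_wickTotal : IsRepBounded (wickTotal D) :=
  fun d => exists_bound_wickTotal D d

lemma repExtend_wedge (n : ℕ) (b : Gr H) (x : Fin n → H) :
    repExtend (wickDegree D n) b (wedge x) = rep b (D.freeWick n x) := by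
  rw [wedge, repExtend_coe (isRepBounded_wickDegree D n), wickDegree_single]

lemma extCLM_wedge (n : ℕ) (x : Fin n → H) :
    extCLM (isRepBounded_wickDegree D n) 𝓕 (wedge x) =
      AInf.incl 𝓕 (AInf.ofFree 𝓕 (D.freeWick n x)) := by
  rw [wedge, extCLM_coe, wickDegree_single]

/-- Applying a Wick product of degree `n` to the vacuum gives `√n!` times the projection of its
argument to the Fock space of `b`. -/
lemma repExtend_vacuum (n : ℕ) (b : Gr H) {G : Fock H} (hG : G ∈ wedgePower H n) :
    CAR.toOp (repExtend (wickDegree D n) b G) (vacuum b.1) =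
      ((√(n.factorial : ℝ) : ℝ) : ℂ) • fockProj b G := by
  let T : CAR b.1 →L[ℂ] Fock b.1 :=
    ((LinearMap.applyₗ (vacuum b.1)).comp
      ((ContinuousLinearMap.coeLM ℂ).comp
        ((CAR.toOp : CAR b.1 →⋆ₐ[ℂ] _) : CAR b.1 →ₐ[ℂ] _).toLinearMap)).mkContinuous 1 fun A => by
      rw [one_mul, ← CAR.norm_toOp]
      refine ((CAR.toOp A).le_opNorm _).trans_eq ?_
      rw [norm_vacuum, mul_one]
  have h : Set.EqOn (T.comp (repExtend (wickDegree D n) b))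
      (((√(n.factorial : ℝ) : ℝ) : ℂ) • fockProj b : Fock H →L[ℂ] Fock b.1) (Set.range fun x : Fin n → H => wedge x) := by
    rintro _ ⟨x, rfl⟩
    change CAR.toOp (repExtend (wickDegree D n) b (wedge x)) (vacuum b.1) =
      ((√(n.factorial : ℝ) : ℝ) : ℂ) • fockProj b (wedge x)
    rw [repExtend_wedge, rep_eq_repOf, repOf_freeWick_vacuum, fockProj_wedge]
    rfl
  exact ContinuousLinearMap.eqOn_closure_span h hG

lemma norm_fockProj_le_norm_repExtend (n : ℕ) (b : Gr H) {G : Fock H} (hG : G ∈ wedgePower H n) :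
    ‖fockProj b G‖ ≤ ‖repExtend (wickDegree D n) b G‖ := by
  have h1 := (CAR.toOp (repExtend (wickDegree D n) b G)).le_opNorm (vacuum b.1)
  rw [repExtend_vacuum D n b hG, norm_vacuum, mul_one, CAR.norm_toOp, norm_smul,
    Complex.norm_real, Real.norm_of_nonneg (Real.sqrt_nonneg _)] at h1
  refine le_trans (le_mul_of_one_le_left (norm_nonneg _) ?_) h1
  rw [Real.one_le_sqrt]
  exact_mod_cast n.factorial_pos

/-- The lower bound for the lifted Wick products, obtained from the vacuum vectors. -/
lemma norm_le_iSup_seminorm (n : ℕ) {G : Fock H} (hG : G ∈ wedgePower H n) :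
    ENNReal.ofReal ‖G‖ ≤ ⨆ m, ENNReal.ofReal
      (ExtCAR.seminorm 𝓕 m (extCLM (isRepBounded_wickDegree D n) 𝓕 G)) := by
  have h1 := (tendsto_fockIncl_fockProj (l := atTop) (b := fun b : 𝓕.points => b.1)
    (tendsto_orthogonalProjection 𝓕) G).norm
  have h2 := (ENNReal.continuous_ofReal.tendsto _).comp h1
  refine le_of_tendsto h2 (Eventually.of_forall fun b => ?_)
  obtain ⟨m, hm⟩ := Set.mem_iUnion.1 b.2
  refine le_iSup_of_le m (ENNReal.ofReal_le_ofReal ?_)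
  refine (norm_fockIncl b.1 _).trans_le ?_
  refine (norm_fockProj_le_norm_repExtend D n b.1 hG).trans ?_
  rw [← rep_extCLM (isRepBounded_wickDegree D n) 𝓕 b]
  exact norm_rep_le_seminorm 𝓕 b hm _

/-- The constants in the bounds by powers of `1 + dim b`. The factor `√(2 ^ (n - 1))` accounts for the
carrier of the fields, whose dimension is at most `2 dim b`. -/
def wickBound (n : ℕ) : ℝ := wickConst n * √(2 ^ (n - 1))

/-- The properties of the lifted Wick products of positive degree. -/
theorem wick_products (n : ℕ) (hn : 1 ≤ n) :
    (∃ W₀ : H [⋀^Fin n]→ₗ[ℂ] HatAlg 𝓕, ∀ x, W₀ x = HatAlg.mk 𝓕 (D.freeWick n x)) ∧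
    (∀ b : Gr H, ∃ W : wedgePower H n →L[ℂ] CAR b.1,
      (∀ x : Fin n → H, W ⟨wedge x, wedge_mem x⟩ = rep b (D.freeWick n x)) ∧
      ∀ G, ‖W G‖ ≤ wickBound n * (1 + (Module.finrank ℂ b.1 : ℝ)) ^ (((n : ℝ) - 1) / 2) * ‖G‖) ∧
    ∃ W : wedgePower H n →L[ℂ] ExtCAR 𝓕,
      (∀ x : Fin n → H,
        W ⟨wedge x, wedge_mem x⟩ = AInf.incl 𝓕 (AInf.ofFree 𝓕 (D.freeWick n x))) ∧
      (∀ (b : 𝓕.points) (G : wedgePower H n), ‖ExtCAR.rep 𝓕 b (W G)‖ ≤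
        wickBound n * (1 + (Module.finrank ℂ b.1.1 : ℝ)) ^ (((n : ℝ) - 1) / 2) * ‖G‖) ∧
      ∀ G : wedgePower H n,
        ENNReal.ofReal ‖G‖ ≤ ⨆ m, ENNReal.ofReal (ExtCAR.seminorm 𝓕 m (W G)) := by
  have hb := isRepBounded_wickDegree D n
  have hbound : ∀ (b : Gr H) (v : Fock H), ‖repExtend (wickDegree D n) b v‖ ≤
      wickBound n * (1 + (Module.finrank ℂ b.1 : ℝ)) ^ (((n : ℝ) - 1) / 2) * ‖v‖ :=
    fun b v => norm_repExtend_le hb b (fun u => norm_rep_wickDegree_le D b n hn u) v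
  refine ⟨⟨(isCARHom_hat 𝓕).wickMap D n, fun x => (isCARHom_hat 𝓕).wickMap_apply D n x⟩,
    fun b => ⟨(repExtend (wickDegree D n) b).comp (wedgePower H n).subtypeL,
      fun x => repExtend_wedge D n b x, fun G => hbound b G⟩,
    (extCLM hb 𝓕).comp (wedgePower H n).subtypeL, fun x => extCLM_wedge D 𝓕 n x, fun b G => ?_,
    fun G => norm_le_iSup_seminorm D 𝓕 n G.2⟩
  change ‖ExtCAR.rep 𝓕 b (extCLM hb 𝓕 G)‖ ≤ _
  rw [rep_extCLM]
  exact hbound b.1 G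

end WickExtension

/-! ### Surjectivity of `*`-homomorphisms with dense range -/

section Surjective

variable {A B : Type*} [CStarAlgebra A] [CStarAlgebra B]

lemma continuous_starAlgHom (φ : A →⋆ₐ[ℂ] B) :
    Continuous φ :=
  AddMonoidHomClass.continuous_of_bound φ 1 fun x => by
    rw [one_mul]; exact NonUnitalStarAlgHom.norm_apply_le φ x

/-- A selfadjoint element of the image of a `*`-homomorphism has a preimage of at most the same
norm, which is obtained from any selfadjoint preimage by truncation. -/
lemma exists_preimage_of_isSelfAdjoint (φ : A →⋆ₐ[ℂ] B) {a : A} (ha : IsSelfAdjoint a) :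
    ∃ a' : A, φ a' = φ a ∧ ‖a'‖ ≤ ‖φ a‖ := by
  have hφ := continuous_starAlgHom φ
  have hb : IsSelfAdjoint (φ a) := ha.map φ
  set r := ‖φ a‖ with hr
  have hr0 : 0 ≤ r := norm_nonneg _
  let f : ℝ → ℝ := fun t => max (-r) (min r t)
  have hf : Continuous f := by fun_prop
  refine ⟨cfc f a, ?_, norm_cfc_le hr0 fun t _ => ?_⟩
  · rw [StarAlgHom.map_cfc φ f a hf.continuousOn hφ ha hb]
    refine (cfc_congr fun t ht => ?_).trans (cfc_id' ℝ (φ a) hb)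
    have h1 : |t| ≤ r := by
      have h := norm_apply_le_norm_cfc (fun t : ℝ => t) (φ a) ht continuousOn_id hb
      rwa [cfc_id' ℝ (φ a) hb] at h
    obtain ⟨h2, h3⟩ := abs_le.1 h1
    simp only [f, min_eq_right h3, max_eq_right h2]
  · rw [Real.norm_eq_abs, abs_le]
    exact ⟨le_max_left _ _, max_le (by linarith) (min_le_left _ _)⟩

lemma exists_preimage_norm_le (φ : A →⋆ₐ[ℂ] B) (a : A) :
    ∃ a' : A, φ a' = φ a ∧ ‖a'‖ ≤ 2 * ‖φ a‖ := by
  have hre : ∀ a : A, ‖φ (realPart a : A)‖ ≤ ‖φ a‖ := by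
    intro a
    have h : φ (realPart a : A) = (realPart (φ a) : B) := by
      rw [realPart_apply_coe, realPart_apply_coe, ← Complex.coe_smul, ← Complex.coe_smul, map_smul,
        map_add, map_star]
    rw [h]
    exact realPart.norm_le (φ a)
  have him : ‖φ (imaginaryPart a : A)‖ ≤ ‖φ a‖ := by
    have h := hre (Complex.I • a)
    rwa [realPart_I_smul, AddSubgroup.coe_neg, map_neg, norm_neg, map_smul, norm_smul,
      Complex.norm_I, one_mul] at h
  obtain ⟨x, hx, hxn⟩ := exists_preimage_of_isSelfAdjoint φ (realPart a).2
  obtain ⟨y, hy, hyn⟩ := exists_preimage_of_isSelfAdjoint φ (imaginaryPart a).2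
  refine ⟨x + Complex.I • y, ?_, ?_⟩
  · rw [map_add, map_smul, hx, hy, ← map_smul, ← map_add, realPart_add_I_smul_imaginaryPart]
  · refine (norm_add_le _ _).trans ?_
    rw [norm_smul, Complex.norm_I, one_mul, two_mul]
    exact add_le_add (hxn.trans (hre a)) (hyn.trans him)

/-- A `*`-homomorphism of `C*`-algebras with dense range is surjective. -/
lemma surjective_of_denseRange (φ : A →⋆ₐ[ℂ] B) (h : DenseRange φ) : Function.Surjective φ := by
  let f : NormedAddGroupHom A B := AddMonoidHom.mkNormedAddGroupHom
    ((φ : A →ₐ[ℂ] B) : A →+ B) 1 fun x => by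
      rw [one_mul]; exact NonUnitalStarAlgHom.norm_apply_le φ x
  have h1 : f.SurjectiveOnWith f.range 2 := by
    rintro _ ⟨a, rfl⟩
    exact exists_preimage_norm_le φ a
  have h2 := controlled_closure_of_complete two_pos one_pos h1
  intro y
  obtain ⟨x, hx, -⟩ := h2 y (h y)
  exact ⟨x, hx⟩

end Surjective

/-! ### The homomorphism to the CAR algebra -/

section Hom

variable {H : Type*} [NormedAddCommGroup H] [InnerProductSpace ℂ H] {Γ : Set (Gr H)}
  (𝓕 : Filtration Γ)

lemma denseRange_ofFree : DenseRange (AInf.ofFree 𝓕) := by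
  intro a
  rw [Metric.mem_closure_iff]
  intro ε hε
  obtain ⟨x, hx⟩ := AInf.approx 𝓕 a (ε / 2) (by positivity)
  obtain ⟨y, rfl⟩ := HatAlg.mk_surjective 𝓕 x
  refine ⟨_, ⟨y, rfl⟩, ?_⟩
  rw [dist_eq_norm]
  refine lt_of_le_of_lt (AInf.norm_le 𝓕 (M := ε / 2) fun n => ?_) (by linarith)
  rw [map_sub]
  exact hx n

/-- The homomorphism from the free `*`-algebra to the CAR algebra is continuous for `‖·‖_∞`. -/
lemma norm_lift_create_le_norm_ofFree (x : FreeStar H) :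
    ‖FreeStar.lift (CAR.create (H := H)) x‖ ≤ ‖AInf.ofFree 𝓕 x‖ := by
  refine norm_lift_create_le (l := Filter.atTop) (b := fun b : 𝓕.points => b.1)
    (tendsto_orthogonalProjection 𝓕) x fun b => ?_
  obtain ⟨m, hm⟩ := Set.mem_iUnion.1 b.2
  refine le_trans ?_ (AInf.le_norm 𝓕 _ m)
  refine le_trans (le_of_eq ?_) (norm_rep_le_seminorm 𝓕 b hm _)
  rw [AInf.incl_ofFree, ExtCAR.rep_coe]
  rfl

include 𝓕 in
lemma lift_create_eq_zero {x : FreeStar H} (hx : x ∈ vanishingIdeal Γ) :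
    FreeStar.lift (CAR.create (H := H)) x = 0 := by
  rw [← norm_le_zero_iff]
  exact norm_lift_create_le (l := Filter.atTop) (b := fun b : 𝓕.points => b.1)
    (tendsto_orthogonalProjection 𝓕) x fun b => by
      rw [hx b.1 (𝓕.points_subset b.2), norm_zero]

/-- The algebra homomorphism underlying `ofFree`, as a linear map. -/
def ofFreeLin : FreeStar H →ₗ[ℂ] AInf 𝓕 := (AInf.ofFree 𝓕 : FreeStar H →ₐ[ℂ] AInf 𝓕).toLinearMap

/-- The homomorphism from `𝔄_∞` to the CAR algebra, as a continuous linear map. -/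
def toCARCLM : AInf 𝓕 →L[ℂ] CAR H :=
  (((FreeStar.lift CAR.create : FreeStar H →⋆ₐ[ℂ] CAR H) :
    FreeStar H →ₐ[ℂ] CAR H).toLinearMap).extendOfNorm (ofFreeLin 𝓕)

lemma toCARCLM_ofFree (x : FreeStar H) :
    toCARCLM 𝓕 (AInf.ofFree 𝓕 x) = FreeStar.lift CAR.create x :=
  LinearMap.extendOfNorm_eq (e := ofFreeLin 𝓕) (denseRange_ofFree 𝓕)
    ⟨1, fun x => by rw [one_mul]; exact norm_lift_create_le_norm_ofFree 𝓕 x⟩ x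

/-- The `*`-homomorphism from `𝔄_∞` to the CAR algebra. -/
def toCAR : AInf 𝓕 →⋆ₐ[ℂ] CAR H :=
  { toFun := toCARCLM 𝓕
    map_one' := by rw [← map_one (AInf.ofFree 𝓕), toCARCLM_ofFree, map_one]
    map_zero' := map_zero _
    map_add' := map_add _
    map_mul' := fun a b => by
      refine (denseRange_ofFree 𝓕).induction_on₂ (p := fun a b =>
        toCARCLM 𝓕 (a * b) = toCARCLM 𝓕 a * toCARCLM 𝓕 b) ?_ (fun x y => ?_) a b
      · exact isClosed_eq (by fun_prop) (by fun_prop)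
      · rw [← map_mul, toCARCLM_ofFree, toCARCLM_ofFree, toCARCLM_ofFree, map_mul]
    commutes' := fun c => by
      rw [← AlgHomClass.commutes (AInf.ofFree 𝓕), toCARCLM_ofFree, AlgHomClass.commutes]
    map_star' := fun a => by
      refine (denseRange_ofFree 𝓕).induction_on (p := fun a =>
        toCARCLM 𝓕 (star a) = star (toCARCLM 𝓕 a)) a ?_ (fun x => ?_)
      · exact isClosed_eq (by fun_prop) (by fun_prop)
      · rw [← map_star, toCARCLM_ofFree, toCARCLM_ofFree, map_star] }

lemma toCAR_ofFree (x : FreeStar H) :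
    toCAR 𝓕 (AInf.ofFree 𝓕 x) = FreeStar.lift CAR.create x := toCARCLM_ofFree 𝓕 x

lemma continuous_toCAR : Continuous (toCAR 𝓕) := (toCARCLM 𝓕).continuous

lemma toCAR_unique {F' : AInf 𝓕 →⋆ₐ[ℂ] CAR H}
    (h : ∀ f : H, F' (AInf.ofFree 𝓕 (FreeStar.create f)) = CAR.create f) : F' = toCAR 𝓕 := by
  have h1 : ∀ x, F' (AInf.ofFree 𝓕 x) = FreeStar.lift CAR.create x := by
    intro x
    induction x using FreeStar.induction_on with
    | hc c => rw [AlgHomClass.commutes, AlgHomClass.commutes, AlgHomClass.commutes]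
    | hcr f => rw [h, FreeStar.lift_create]
    | han f => rw [← FreeStar.star_create, map_star, map_star, map_star, h, FreeStar.lift_create]
    | hadd x y hx hy => rw [map_add, map_add, map_add, hx, hy]
    | hmul x y hx hy => rw [map_mul, map_mul, map_mul, hx, hy]
  refine DFunLike.coe_injective ((denseRange_ofFree 𝓕).equalizer (continuous_starAlgHom F')
    (continuous_toCAR 𝓕) ?_)
  ext x
  exact (h1 x).trans (toCAR_ofFree 𝓕 x).symm

lemma denseRange_toCAR : DenseRange (toCAR 𝓕) := by
  -- The range contains the `*`-algebra generated by the `α†(f)`, which is dense by definition.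
  have h1 : StarAlgebra.adjoin ℂ (Set.range (creation (H := H))) ≤
      (CAR.toOp.comp (toCAR 𝓕)).range := by
    refine StarAlgebra.adjoin_le ?_
    rintro _ ⟨f, rfl⟩
    refine ⟨AInf.ofFree 𝓕 (FreeStar.create f), ?_⟩
    change CAR.toOp (toCAR 𝓕 _) = _
    rw [toCAR_ofFree, FreeStar.lift_create]
    rfl
  intro X
  rw [Metric.mem_closure_iff]
  intro ε hε
  have h2 : CAR.toOp X ∈ closure
      (StarAlgebra.adjoin ℂ (Set.range (creation (H := H))) : Set (Fock H →L[ℂ] Fock H)) := X.2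
  obtain ⟨Y, hY, hXY⟩ := Metric.mem_closure_iff.1 h2 ε hε
  obtain ⟨a, rfl⟩ := h1 hY
  exact ⟨toCAR 𝓕 a, ⟨a, rfl⟩, hXY⟩

lemma surjective_toCAR : Function.Surjective (toCAR 𝓕) :=
  surjective_of_denseRange _ (denseRange_toCAR 𝓕)

end Hom

/-! ### The `L²` spaces -/

section L2

variable {A B : Type*} [CStarAlgebra A] [PartialOrder A] [StarOrderedRing A]
  [CStarAlgebra B] [PartialOrder B] [StarOrderedRing B]

lemma norm_toL2_sq (ω : A →ₚ[ℂ] ℂ) (a : A) : (‖toL2 ω a‖ ^ 2 : ℂ) = ω (star a * a) := by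
  rw [toL2, Completion.norm_coe, ω.preGNS_norm_sq]
  rfl

lemma pullback_apply (φ : A →⋆ₐ[ℂ] B) (ω : B →ₚ[ℂ] ℂ) (a : A) : pullback φ ω a = ω (φ a) := rfl

lemma norm_toL2_pullback (φ : A →⋆ₐ[ℂ] B) (ω : B →ₚ[ℂ] ℂ) (a : A) :
    ‖toL2 (pullback φ ω) a‖ = ‖toL2 ω (φ a)‖ := by
  have h : (‖toL2 (pullback φ ω) a‖ ^ 2 : ℂ) = ‖toL2 ω (φ a)‖ ^ 2 := by
    rw [norm_toL2_sq, norm_toL2_sq, pullback_apply, map_mul, map_star]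
  have h2 : ‖toL2 (pullback φ ω) a‖ ^ 2 = ‖toL2 ω (φ a)‖ ^ 2 := by exact_mod_cast h
  exact (pow_left_inj₀ (norm_nonneg _) (norm_nonneg _) two_ne_zero).1 h2

/-- The map `a ↦ [a]`, as a linear map. -/
def toL2Lin (ω : A →ₚ[ℂ] ℂ) : A →ₗ[ℂ] ω.GNS :=
  (Completion.toComplL : ω.PreGNS →L[ℂ] ω.GNS).toLinearMap ∘ₗ ω.toPreGNS.toLinearMap

lemma toL2Lin_apply (ω : A →ₚ[ℂ] ℂ) (a : A) : toL2Lin ω a = toL2 ω a := rfl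

lemma denseRange_toL2 (ω : A →ₚ[ℂ] ℂ) : DenseRange (toL2Lin ω) :=
  Completion.denseRange_coe.comp ω.toPreGNS.surjective.denseRange (Completion.continuous_coe _)

/-- A surjective homomorphism induces an isomorphism of the `L²` spaces. -/
lemma exists_linearIsometryEquiv_toL2 (φ : A →⋆ₐ[ℂ] B) (hφ : Function.Surjective φ)
    (ω : B →ₚ[ℂ] ℂ) : ∃ V : (pullback φ ω).GNS ≃ₗᵢ[ℂ] ω.GNS,
      ∀ a : A, V (toL2 _ a) = toL2 _ (φ a) := by
  let T : A →ₗ[ℂ] ω.GNS := toL2Lin ω ∘ₗ (φ : A →ₐ[ℂ] B).toLinearMap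
  have hT : ∀ a, ‖T a‖ = ‖toL2Lin (pullback φ ω) a‖ := fun a => (norm_toL2_pullback φ ω a).symm
  have hd := denseRange_toL2 (pullback φ ω)
  let V : (pullback φ ω).GNS →L[ℂ] ω.GNS := T.extendOfNorm (toL2Lin (pullback φ ω))
  have hV : ∀ a : A, V (toL2 _ a) = toL2 _ (φ a) := fun a =>
    LinearMap.extendOfNorm_eq hd ⟨1, fun x => by rw [one_mul, hT]⟩ a
  have hn : ∀ v, ‖V v‖ = ‖v‖ := fun v =>
    hd.induction_on (p := fun v => ‖V v‖ = ‖v‖) v (isClosed_eq (by fun_prop) (by fun_prop))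
      fun a => (congrArg norm (hV a)).trans (hT a)
  let V' : (pullback φ ω).GNS →ₗᵢ[ℂ] ω.GNS := ⟨V.toLinearMap, hn⟩
  have hs : Function.Surjective V' := by
    rw [← Set.range_eq_univ]
    refine V'.isometry.isClosedEmbedding.isClosed_range.closure_eq.symm.trans ?_
    refine (Set.eq_univ_of_univ_subset ?_)
    rw [← (denseRange_toL2 ω).closure_range]
    refine closure_mono ?_
    rintro _ ⟨b, rfl⟩
    obtain ⟨a, rfl⟩ := hφ b
    exact ⟨toL2 _ a, hV a⟩
  exact ⟨LinearIsometryEquiv.ofSurjective V' hs, hV⟩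

variable {H : Type*} [NormedAddCommGroup H] [InnerProductSpace ℂ H]

lemma norm_toL2_vacuumState (X : CAR H) :
    ‖toL2 (CAR.vacuumState H) X‖ = ‖CAR.toOp X (vacuum H)‖ := by
  have h : (‖toL2 (CAR.vacuumState H) X‖ ^ 2 : ℂ) = ‖CAR.toOp X (vacuum H)‖ ^ 2 := by
    rw [norm_toL2_sq, CAR.vacuumState_apply, map_mul, map_star, mul_apply_eq_comp,
      ContinuousLinearMap.star_eq_adjoint, ContinuousLinearMap.adjoint_inner_right,
      inner_self_eq_norm_sq_to_K]
    rfl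
  have h2 : ‖toL2 (CAR.vacuumState H) X‖ ^ 2 = ‖CAR.toOp X (vacuum H)‖ ^ 2 := by exact_mod_cast h
  exact (pow_left_inj₀ (norm_nonneg _) (norm_nonneg _) two_ne_zero).1 h2

end L2

/-! ### Lifting of convergent sequences -/

section Lifting

open Filter Topology

variable {H : Type*} [NormedAddCommGroup H] [InnerProductSpace ℂ H] [CompleteSpace H]
  (D : FieldData H) {Γ : Set (Gr H)} (𝓕 : Filtration Γ)

lemma ofFree_mem_adjoin {x : FreeStar H} (hx : x ∈ Algebra.adjoin ℂ (Set.range D.freeField ∪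
      Set.range fun p : H × H => FreeStar.anticomm p.1 p.2)) :
    AInf.ofFree 𝓕 x ∈ Algebra.adjoin ℂ
      ((Set.range fun f : H => AInf.ofFree 𝓕 (D.freeField f)) ∪
        Set.range fun p : H × H => AInf.ofFree 𝓕 (FreeStar.anticomm p.1 p.2)) := by
  have h := (AlgHom.map_adjoin (AInf.ofFree 𝓕 : FreeStar H →ₐ[ℂ] AInf 𝓕) _).le
    (Subalgebra.mem_map.2 ⟨x, hx, rfl⟩)
  rw [Set.image_union, ← Set.range_comp, ← Set.range_comp] at h
  exact h

/-- Polynomials in the fields which converge in `L²` have lifts which converge in the extended CAR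
algebra: the `L²` norm is the norm of the Fock space, on which Wick polynomials with values in the
extended CAR algebra depend continuously. -/
lemma exists_convergent_lift (P : ℕ → CAR H)
    (hP : ∀ k, P k ∈ Algebra.adjoin ℂ (Set.range D.field))
    (hl : ∃ l, Tendsto (fun k => toL2 (CAR.vacuumState H) (P k)) atTop (𝓝 l)) :
    ∃ Q : ℕ → AInf 𝓕,
      (∀ k, Q k ∈ Algebra.adjoin ℂ
        ((Set.range fun f : H => AInf.ofFree 𝓕 (D.freeField f)) ∪
          Set.range fun p : H × H => AInf.ofFree 𝓕 (FreeStar.anticomm p.1 p.2))) ∧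
      (∀ k, toCAR 𝓕 (Q k) = P k) ∧
      ∃ l, Tendsto (fun k => AInf.incl 𝓕 (Q k)) atTop (𝓝 l) := by
  choose u hu using fun k => exists_wickTotal_eq D (hP k)
  have hvac : ∀ k, (u k : Fock H) = CAR.toOp (P k) (vacuum H) := fun k => by
    rw [← lift_wickTotal_vacuum D, hu]
  have hcauchy : CauchySeq fun k => (u k : Fock H) := by
    obtain ⟨l, hl⟩ := hl
    rw [Metric.cauchySeq_iff]
    intro ε hε
    obtain ⟨N, hN⟩ := Metric.cauchySeq_iff.1 hl.cauchySeq ε hε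
    refine ⟨N, fun j hj k hk => ?_⟩
    have h := hN j hj k hk
    rw [dist_eq_norm] at h ⊢
    have h2 : toL2 (CAR.vacuumState H) (P j) - toL2 (CAR.vacuumState H) (P k) =
        toL2 (CAR.vacuumState H) (P j - P k) := by
      rw [← toL2Lin_apply, ← toL2Lin_apply, ← toL2Lin_apply, map_sub]
    rw [h2, norm_toL2_vacuumState, map_sub] at h
    rw [hvac, hvac]
    exact h
  obtain ⟨v, hv⟩ := cauchySeq_tendsto_of_complete hcauchy
  refine ⟨fun k => AInf.ofFree 𝓕 (wickTotal D (u k)),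
    fun k => ofFree_mem_adjoin D 𝓕 (wickTotal_mem_adjoin D _),
    fun k => (toCAR_ofFree 𝓕 _).trans (hu k), extCLM (isRepBounded_wickTotal D) 𝓕 v, ?_⟩
  have h := ((extCLM (isRepBounded_wickTotal D) 𝓕).continuous.tendsto v).comp hv
  refine h.congr fun k => ?_
  exact extCLM_coe (isRepBounded_wickTotal D) 𝓕 (u k)

end Lifting

/-! ### The locally `C*`-algebra -/

section LocallyCStar

variable {H : Type*} [NormedAddCommGroup H] [InnerProductSpace ℂ H] {Γ : Set (Gr H)}
  (𝓕 : Filtration Γ)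

lemma isLocallyCStarAlgebra_extCAR : IsLocallyCStarAlgebra (ExtCAR 𝓕) (ExtCAR.seminorm 𝓕) where
  completeSpace := inferInstance
  t2Space := inferInstance
  isUniformAddGroup := inferInstance
  isTopologicalRing := inferInstance
  continuousSMul := (ExtCAR.withSeminorms 𝓕).continuousSMul
  starModule := inferInstance
  continuousStar := inferInstance
  withSeminorms := ExtCAR.withSeminorms 𝓕
  mul_le := ExtCAR.seminorm_mul_le 𝓕
  star_mul_self := ExtCAR.seminorm_star_mul_self 𝓕

lemma dense_boundedSubalgebra : Dense (boundedSubalgebra 𝓕 : Set (ExtCAR 𝓕)) := by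
  refine (Completion.denseRange_coe (α := HatAlg 𝓕)).mono ?_
  rintro _ ⟨x, rfl⟩
  obtain ⟨y, rfl⟩ := HatAlg.mk_surjective 𝓕 x
  exact (AInf.ofFree 𝓕 y).2

end LocallyCStar

end
end ExtendedCAR

theorem theorem1p1 : ∃ C : ℕ → ℝ,
    ∀ (H : Type*) [NormedAddCommGroup H] [InnerProductSpace ℂ H] [CompleteSpace H]
      (D : FieldData H) (Γ : Set (Gr H)) (𝓕 : Filtration Γ),
    -- `𝒜` is a locally `C*`-algebra
    IsLocallyCStarAlgebra (ExtCAR 𝓕) (ExtCAR.seminorm 𝓕) ∧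
    -- `𝔄_∞` is a dense `*`-subalgebra, and a `C*`-algebra for `supₙ ‖·‖ₙ`
    Dense (boundedSubalgebra 𝓕 : Set (ExtCAR 𝓕)) ∧
    (∀ a : AInf 𝓕, IsLUB (Set.range fun n => ExtCAR.seminorm 𝓕 n (AInf.incl 𝓕 a)) ‖a‖) ∧
    CompleteSpace (AInf 𝓕) ∧
    (∀ a : AInf 𝓕, ‖star a * a‖ = ‖a‖ ^ 2) ∧
    -- the map `α†(f) ↦ α†(f)` descends to the quotient
    (∀ x ∈ vanishingIdeal Γ, FreeStar.lift (CAR.create (H := H)) x = 0) ∧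
    -- its extension to `𝔄_∞`, and the isomorphism of the `L²` spaces
    (∃ F : AInf 𝓕 →⋆ₐ[ℂ] CAR H,
      (∀ x : FreeStar H, F (AInf.ofFree 𝓕 x) = FreeStar.lift CAR.create x) ∧
      (∀ F' : AInf 𝓕 →⋆ₐ[ℂ] CAR H,
        (∀ f : H, F' (AInf.ofFree 𝓕 (FreeStar.create f)) = CAR.create f) → F' = F) ∧
      Continuous F ∧
      Function.Surjective F ∧
      pullback F (CAR.vacuumState H) 1 = 1 ∧
      (∃ V : (pullback F (CAR.vacuumState H)).GNS ≃ₗᵢ[ℂ] (CAR.vacuumState H).GNS,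
        ∀ a : AInf 𝓕, V (toL2 _ a) = toL2 _ (F a)) ∧
      (∀ (n : ℕ) (x : Fin n → H), F (AInf.ofFree 𝓕 (D.freeWick n x)) = D.wick n x) ∧
      -- lifting of polynomials in the fields which converge in `L²`
      (∀ P : ℕ → CAR H, (∀ k, P k ∈ Algebra.adjoin ℂ (Set.range D.field)) →
        (∃ l, Filter.Tendsto (fun k => toL2 (CAR.vacuumState H) (P k)) Filter.atTop (nhds l)) →
        ∃ Q : ℕ → AInf 𝓕,
          (∀ k, Q k ∈ Algebra.adjoin ℂ
            ((Set.range fun f : H => AInf.ofFree 𝓕 (D.freeField f)) ∪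
              Set.range fun p : H × H => AInf.ofFree 𝓕 (FreeStar.anticomm p.1 p.2))) ∧
          (∀ k, F (Q k) = P k) ∧
          ∃ l, Filter.Tendsto (fun k => AInf.incl 𝓕 (Q k)) Filter.atTop (nhds l))) ∧
    -- the lifted Wick products
    ∀ n : ℕ, 1 ≤ n →
      (∃ W₀ : H [⋀^Fin n]→ₗ[ℂ] HatAlg 𝓕, ∀ x, W₀ x = HatAlg.mk 𝓕 (D.freeWick n x)) ∧
      (∀ b : Gr H, ∃ W : wedgePower H n →L[ℂ] CAR b.1,
        (∀ x : Fin n → H, W ⟨wedge x, wedge_mem x⟩ = rep b (D.freeWick n x)) ∧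
        ∀ G, ‖W G‖ ≤ C n * (1 + (Module.finrank ℂ b.1 : ℝ)) ^ (((n : ℝ) - 1) / 2) * ‖G‖) ∧
      ∃ W : wedgePower H n →L[ℂ] ExtCAR 𝓕,
        (∀ x : Fin n → H,
          W ⟨wedge x, wedge_mem x⟩ = AInf.incl 𝓕 (AInf.ofFree 𝓕 (D.freeWick n x))) ∧
        (∀ (b : 𝓕.points) (G : wedgePower H n), ‖ExtCAR.rep 𝓕 b (W G)‖ ≤
          C n * (1 + (Module.finrank ℂ b.1.1 : ℝ)) ^ (((n : ℝ) - 1) / 2) * ‖G‖) ∧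
        ∀ G : wedgePower H n,
          ENNReal.ofReal ‖G‖ ≤ ⨆ m, ENNReal.ofReal (ExtCAR.seminorm 𝓕 m (W G)) := by
  refine ⟨wickBound, fun H _ _ _ D Γ 𝓕 => ⟨isLocallyCStarAlgebra_extCAR 𝓕,
    dense_boundedSubalgebra 𝓕, fun a => isLUB_ciSup (AInf.bddAbove 𝓕 a), inferInstance,
    fun a => by rw [CStarRing.norm_star_mul_self, sq], fun x hx => lift_create_eq_zero 𝓕 hx,
    ⟨toCAR 𝓕, toCAR_ofFree 𝓕, fun F' h => toCAR_unique 𝓕 h, continuous_toCAR 𝓕,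
      surjective_toCAR 𝓕, ?_,
      exists_linearIsometryEquiv_toL2 (toCAR 𝓕) (surjective_toCAR 𝓕) (CAR.vacuumState H),
      fun n x => (toCAR_ofFree 𝓕 _).trans (lift_freeWick D n x),
      exists_convergent_lift D 𝓕⟩,
    fun n hn => wick_products D 𝓕 n hn⟩⟩
  rw [pullback_apply, map_one, vacuumState_one]
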